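/- Let $\mathbb{T}^2=(\mathbb{R}/2\pi\mathbb{Z})^2$ with Lebesgue measure, let $G$ be the mean-zero Green function of the Laplacian on $\mathbb{T}^2$ (that is, $\Delta G=\delta_0-(2\pi)^{-2}$) and let $K=\nabla^\perp G=(-\partial_2G,\partial_1G)$. There is an absolute constant $C>0$ such that the following holds for every $T>0$ and every $\xi_0\in L^\infty(\mathbb{T}^2)$. Let $M$ be the set of measurable maps $\psi:[0,T]\times\mathbb{T}^2\to\mathbb{T}^2$, $(t,x)\mapsto\psi_t(x)$, such that $\sup_{t\in[0,T]}\int_{\mathbb{T}^2}|\psi_t(x)|\,dx<\infty$ and $\psi_t$ preserves Lebesgue measure for a.e. $t\in[0,T]$. Consider the nonlocal Euler flow equation $$\Phi_t(x)=x+\int_0^t\int_{\mathbb{T}^2}K(\Phi_s(x)-\Phi_s(y))\,\xi_0(y)\,dy\,ds,$$ where the vector given by the integral acts on $\mathbb{T}^2$ by translation and the integrals converge absolutely (the inner one for a.e. $s\in[0,t]$). Then there is $\Phi\in M$ which satisfies this equation for all $t\in[0,T]$ and all $x\in\mathbb{T}^2$ and such that: 1. for every $t\in[0,T]$, $\Phi_t$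 is a homeomorphism of $\mathbb{T}^2$ that preserves Lebesgue measure; 2. $\Phi$ is of class $C^\alpha$ in space, uniformly in time, with $\alpha=\exp(-C\|\xi_0\|_{L^\infty}T)$: there is $H<\infty$ with $d(\Phi_t(x),\Phi_t(x'))\le H\,d(x,x')^\alpha$ for all $t\in[0,T]$ and $x,x'\in\mathbb{T}^2$; 3. $\Phi$ is Lipschitz in time, uniformly in space: there is $L<\infty$ with $d(\Phi_t(x),\Phi_{t'}(x))\le L|t-t'|$ for all $t,t'\in[0,T]$ and $x\in\mathbb{T}^2$. Moreover $\Phi$ is the unique solution in $M$: if $\Psi\in M$ satisfies the equation for every $t\in[0,T]$ and a.e. $x\in\mathbb{T}^2$, then for every $t\in[0,T]$ one has $\Psi_t=\Phi_t$ a.e. on $\mathbb{T}^2$; and if $\Psi\in M$ satisfies it for all $t\in[0,T]$ and all $x\in\mathbb{T}^2$, then $\Psi=\Phi$ everywhere. -/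

import Mathlib

open MeasureTheory

namespace EulerFlow

instance instTwoPiPos : Fact (0 < 2 * Real.pi) := ⟨Real.two_pi_pos⟩

/-- The two-dimensional torus `(ℝ / 2πℤ)²`. Its `volume` is Lebesgue measure, of total mass
`(2π)²`, and its distance is the maximum of the two circle distances, which is equivalent to the
flat Euclidean distance (the factor between them is at most `√2`). -/
abbrev Torus : Type := AddCircle (2 * Real.pi) × AddCircle (2 * Real.pi)

/-- The canonical projection from the plane to the torus. -/
noncomputable def proj (v : ℝ × ℝ) : Torus :=
  ((v.1 : AddCircle (2 * Real.pi)), (v.2 : AddCircle (2 * Real.pi)))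

/-- The character `x ↦ exp (i k · x)` of the torus. -/
noncomputable def character (k : ℤ × ℤ) (x : Torus) : ℂ :=
  fourier k.1 x.1 * fourier k.2 x.2

/-- The solution of the heat equation `∂ₜ v = Δ v` on the torus with initial datum
`δ₀ - (2π)⁻²`, that is `v(t, x) = (2π)⁻² ∑_{k ≠ 0} exp (-|k|² t) exp (i k · x)` for `t > 0`
(the sum converges absolutely and is real). -/
noncomputable def heatKernel (t : ℝ) (x : Torus) : ℝ :=
  ((2 * Real.pi) ^ 2)⁻¹ *
    ∑' k : {k : ℤ × ℤ // k ≠ 0},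
      Real.exp (-(((k.1.1 : ℝ) ^ 2 + (k.1.2 : ℝ) ^ 2) * t)) * (character k.1 x).re

/-- The mean-zero Green function of the Laplacian on the torus, `Δ G = δ₀ - (2π)⁻²`, with Fourier
expansion `G(x) = - (2π)⁻² ∑_{k ≠ 0} |k|⁻² exp (i k · x)`. As this series is not absolutely
convergent, `|k|⁻² = ∫₀^∞ exp (-|k|² t) dt` is used: `G(x) = - ∫₀^∞ v(t, x) dt`, which converges
for every `x ≠ 0`. The value at `0`, where `G` is singular, plays no role. -/
noncomputable def greenFunction (x : Torus) : ℝ :=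
  -∫ t in Set.Ioi (0 : ℝ), heatKernel t x

/-- The Biot-Savart kernel `K = ∇^⊥ G = (-∂₂ G, ∂₁ G)`. The derivatives are classical ones at
every `x ≠ 0`; the value at `0` plays no role. -/
noncomputable def kernelK (x : Torus) : ℝ × ℝ :=
  (-deriv (fun h : ℝ => greenFunction (x + proj (0, h))) 0,
    deriv (fun h : ℝ => greenFunction (x + proj (h, 0))) 0)

/-- Maps `[0, T] × 𝕋² → 𝕋²`, written `Φ t x`. -/
abbrev Flow (T : ℝ) : Type := Set.Icc (0 : ℝ) T → Torus → Torus

/-- Lebesgue measure on the time interval `[0, T]`. -/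
noncomputable def timeMeasure (T : ℝ) : Measure (Set.Icc (0 : ℝ) T) :=
  Measure.comap Subtype.val volume

/-- The set `M` of measurable measure-preserving flows. -/
structure MemM {T : ℝ} (ψ : Flow T) : Prop where
  measurable : Measurable (fun p : Set.Icc (0 : ℝ) T × Torus => ψ p.1 p.2)
  bounded : ∃ B : ℝ, ∀ t, ∫ x, ‖ψ t x‖ ≤ B
  measurePreserving : ∀ᵐ t ∂(timeMeasure T), MeasurePreserving (ψ t) volume volume

/-- The velocity `u^Φ(t, z) = ∫ K(z - Φ_t(y)) ξ₀(y) dy` generated by the flow. -/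
noncomputable def velocity {T : ℝ} (ξ₀ : Torus → ℝ) (Φ : Flow T) (t : Set.Icc (0 : ℝ) T)
    (z : Torus) : ℝ × ℝ :=
  ∫ y, ξ₀ y • kernelK (z - Φ t y)

/-- The Euler flow equation
`Φ_t(x) = x + ∫₀ᵗ ∫ K(Φ_s(x) - Φ_s(y)) ξ₀(y) dy ds` at the time `t` and the point `x`,
together with the absolute convergence of the integrals in it. -/
structure SolvesAt {T : ℝ} (ξ₀ : Torus → ℝ) (Φ : Flow T) (t : Set.Icc (0 : ℝ) T)
    (x : Torus) : Prop where
  integrable_space : ∀ᵐ s ∂((timeMeasure T).restrict (Set.Iic t)),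
    Integrable (fun y => ξ₀ y • kernelK (Φ s x - Φ s y)) volume
  integrable_time : IntegrableOn (fun s => velocity ξ₀ Φ s (Φ s x)) (Set.Iic t) (timeMeasure T)
  eq : Φ t x = x + proj (∫ s in Set.Iic t, velocity ξ₀ Φ s (Φ s x) ∂(timeMeasure T))

end EulerFlow

/-! The velocity is a convolution of the vorticity with `K` along a measure preserving map, so only
`L¹` properties of `K` matter: `y ↦ z - ψ y` preserves the measure, and nothing else about `ψ` is
needed. The decisive property is that translations of `K` in `L¹` have the modulus `r (2 - log r)`
up to a constant (`exists_kernelK_translate_le`). This modulus is concave and its tangent at `d` is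
`d + r (1 - log d)`; the estimates are stated for all these tangents, with `d` in `(0, 1]`. Being
affine in `r`, they can be integrated over space, and a mean distance obeys the same inequality as a
single distance.

The modulus comes from writing `K` as a time integral of `∇^⊥` of heat kernels, which are products
of theta functions. Poisson summation bounds the `L¹` norm at time `t` by a multiple of `t ^ (-1/2)`
and the difference of two translates by a multiple of `‖a‖ / t`; the spectral gap gives exponential
decay after time `1`. The integral of `1 / t` produces the logarithm. Pointwise, `K` is identified
with this integral only almost everywhere, which is enough.

Osgood's inequality is proved by comparing with `y' = A y (2 - log y)` along its tangents
(`OsgoodIneq.le_rpow`); the explicit solution yields the Hölder exponent `exp (-A T)`. It is applied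
to the distance of two trajectories (`exists_osgood_pointwise`) and to the mean distance of two
flows (`exists_osgood_mean`).

For existence, `K` is approximated in `L¹` by finite sums of the modes `sin (k · x) k^⊥`. The
velocity generated by one mode is a shear in the rational direction `k^⊥`, and an explicit Euler
step along a shear preserves the measure exactly. Composing such steps gives measure preserving
approximate solutions (`exists_approx_solution`). The mean Osgood inequality makes two of them close
in mean; splitting `K` into a Lipschitz part and an `L¹`-small part then makes their velocities
uniformly close, and the pointwise inequality makes the flows uniformly close
(`exists_approx_close`). The limit solves the equation.

Mean distance gives uniqueness almost everywhere; flows that agree almost everywhere have the same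
velocity field, and trajectories of one log-Lipschitz field are unique. Time reversal gives
injectivity; surjectivity follows since a compact range of full measure is everything; time
Lipschitz continuity is the boundedness of the velocity. -/

namespace EulerFlow

/-! ### One-dimensional theta functions -/

/-- The circle of length `2π`. -/
abbrev Circ : Type := AddCircle (2 * Real.pi)

/-- `∑ exp (-n² t) cos (n x)`, which is `2π` times the heat kernel of the circle. -/
noncomputable def theta (t : ℝ) (x : Circ) : ℝ :=
  ∑' n : ℤ, Real.exp (-((n : ℝ) ^ 2 * t)) * (fourier n x).re

/-- The derivative of `theta` in space. -/
noncomputable def thetaDeriv (t : ℝ) (x : Circ) : ℝ :=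
  ∑' n : ℤ, -((n : ℝ) * Real.exp (-((n : ℝ) ^ 2 * t)) * (fourier n x).im)

/-- The second derivative of `theta` in space. -/
noncomputable def thetaDeriv2 (t : ℝ) (x : Circ) : ℝ :=
  ∑' n : ℤ, -((n : ℝ) ^ 2 * Real.exp (-((n : ℝ) ^ 2 * t)) * (fourier n x).re)

/-- `∑ n² exp (-n² t)`, an upper bound for `theta - 1` and its first two derivatives. -/
noncomputable def thetaBound (t : ℝ) : ℝ :=
  ∑' n : ℤ, (n : ℝ) ^ 2 * Real.exp (-((n : ℝ) ^ 2 * t))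

lemma abs_fourier_re_le (n : ℤ) (x : Circ) : |(fourier n x).re| ≤ 1 := by
  refine (Complex.abs_re_le_norm _).trans ?_
  rw [fourier_apply, Circle.norm_coe]

lemma abs_fourier_im_le (n : ℤ) (x : Circ) : |(fourier n x).im| ≤ 1 := by
  refine (Complex.abs_im_le_norm _).trans ?_
  rw [fourier_apply, Circle.norm_coe]

lemma fourier_coe_eq (n : ℤ) (x : ℝ) :
    fourier n (x : Circ) = Complex.exp (((n * x : ℝ) : ℂ) * Complex.I) := by
  rw [fourier_coe_apply]
  congr 1
  have : (Real.pi : ℂ) ≠ 0 := by exact_mod_cast Real.pi_ne_zero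
  push_cast
  field_simp

lemma fourier_coe_re (n : ℤ) (x : ℝ) : (fourier n (x : Circ)).re = Real.cos (n * x) := by
  rw [fourier_coe_eq, Complex.exp_ofReal_mul_I_re]

lemma fourier_coe_im (n : ℤ) (x : ℝ) : (fourier n (x : Circ)).im = Real.sin (n * x) := by
  rw [fourier_coe_eq, Complex.exp_ofReal_mul_I_im]

/-- This is `exp u ≥ u ^ 2 / 2` at `u = n ^ 2 t`. For `n = 0` both sides vanish, as `1 / 0 = 0`. -/
lemma sq_mul_exp_le {t : ℝ} (ht : 0 < t) (n : ℤ) :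
    (n : ℝ) ^ 2 * Real.exp (-((n : ℝ) ^ 2 * t)) ≤ 2 / t ^ 2 * (1 / (n : ℝ) ^ 2) := by
  rcases eq_or_ne n 0 with rfl | hn
  · simp
  have hn' : 0 < (n : ℝ) ^ 2 := by positivity
  have h := Real.quadratic_le_exp_of_nonneg (x := (n : ℝ) ^ 2 * t) (by positivity)
  have h1 : ((n : ℝ) ^ 2 * t) ^ 2 / 2 ≤ Real.exp ((n : ℝ) ^ 2 * t) := by nlinarith
  rw [Real.exp_neg]
  have h2 : (Real.exp ((n : ℝ) ^ 2 * t))⁻¹ ≤ (((n : ℝ) ^ 2 * t) ^ 2 / 2)⁻¹ :=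
    inv_anti₀ (by positivity) h1
  calc (n : ℝ) ^ 2 * (Real.exp ((n : ℝ) ^ 2 * t))⁻¹
      ≤ (n : ℝ) ^ 2 * (((n : ℝ) ^ 2 * t) ^ 2 / 2)⁻¹ := by gcongr
    _ = _ := by field_simp

lemma summable_sq_mul_exp {t : ℝ} (ht : 0 < t) :
    Summable fun n : ℤ => (n : ℝ) ^ 2 * Real.exp (-((n : ℝ) ^ 2 * t)) :=
  Summable.of_nonneg_of_le (fun n => by positivity) (sq_mul_exp_le ht)
    ((Real.summable_one_div_int_pow.2 one_lt_two).mul_left _)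

lemma abs_le_sq_int (n : ℤ) : |(n : ℝ)| ≤ (n : ℝ) ^ 2 := by
  rcases eq_or_ne n 0 with rfl | hn
  · simp
  have : (1 : ℝ) ≤ |(n : ℝ)| := by exact_mod_cast Int.one_le_abs hn
  rw [← sq_abs]; nlinarith

lemma abs_deriv_term_le (t : ℝ) (n : ℤ) (x : Circ) :
    ‖-((n : ℝ) * Real.exp (-((n : ℝ) ^ 2 * t)) * (fourier n x).im)‖ ≤
      (n : ℝ) ^ 2 * Real.exp (-((n : ℝ) ^ 2 * t)) := by
  rw [norm_neg, norm_mul, norm_mul, Real.norm_eq_abs, Real.norm_eq_abs, Real.norm_eq_abs,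
    abs_of_pos (Real.exp_pos _)]
  calc |(n : ℝ)| * Real.exp (-((n : ℝ) ^ 2 * t)) * |(fourier n x).im|
      ≤ (n : ℝ) ^ 2 * Real.exp (-((n : ℝ) ^ 2 * t)) * 1 := by
        gcongr
        · exact abs_le_sq_int n
        · exact abs_fourier_im_le n x
    _ = _ := mul_one _

lemma abs_deriv2_term_le (t : ℝ) (n : ℤ) (x : Circ) :
    ‖-((n : ℝ) ^ 2 * Real.exp (-((n : ℝ) ^ 2 * t)) * (fourier n x).re)‖ ≤
      (n : ℝ) ^ 2 * Real.exp (-((n : ℝ) ^ 2 * t)) := by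
  rw [norm_neg, norm_mul, Real.norm_eq_abs, Real.norm_eq_abs,
    abs_of_nonneg (by positivity : 0 ≤ (n : ℝ) ^ 2 * Real.exp (-((n : ℝ) ^ 2 * t)))]
  exact mul_le_of_le_one_right (by positivity) (abs_fourier_re_le n x)

lemma summable_exp_neg_sq {t : ℝ} (ht : 0 < t) :
    Summable fun n : ℤ => Real.exp (-((n : ℝ) ^ 2 * t)) := by
  have h : Summable fun n : ℤ => (if n = 0 then (1 : ℝ) else 0) +
      (n : ℝ) ^ 2 * Real.exp (-((n : ℝ) ^ 2 * t)) := by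
    refine Summable.add ?_ (summable_sq_mul_exp ht)
    exact summable_of_ne_finset_zero (s := {0}) (fun b hb => by simpa using hb)
  refine Summable.of_nonneg_of_le (fun n => (Real.exp_pos _).le) (fun n => ?_) h
  split_ifs with hn
  · subst hn; simp
  · have : (1 : ℝ) ≤ (n : ℝ) ^ 2 := by
      have := Int.one_le_abs hn
      have h2 : (1 : ℝ) ≤ |(n : ℝ)| := by exact_mod_cast this
      exact h2.trans (abs_le_sq_int n)
    rw [zero_add]
    exact le_mul_of_one_le_left (Real.exp_pos _).le this

lemma summable_theta {t : ℝ} (ht : 0 < t) (x : Circ) :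
    Summable fun n : ℤ => Real.exp (-((n : ℝ) ^ 2 * t)) * (fourier n x).re := by
  refine Summable.of_norm_bounded (summable_exp_neg_sq ht) fun n => ?_
  rw [norm_mul, Real.norm_eq_abs, Real.norm_eq_abs, abs_of_pos (Real.exp_pos _)]
  exact mul_le_of_le_one_right (Real.exp_pos _).le (abs_fourier_re_le n x)

lemma summable_thetaDeriv {t : ℝ} (ht : 0 < t) (x : Circ) :
    Summable fun n : ℤ => -((n : ℝ) * Real.exp (-((n : ℝ) ^ 2 * t)) * (fourier n x).im) :=
  Summable.of_norm_bounded (summable_sq_mul_exp ht) fun n => abs_deriv_term_le t n x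

lemma thetaBound_nonneg (t : ℝ) : 0 ≤ thetaBound t := tsum_nonneg fun n => by positivity

lemma abs_thetaDeriv_le {t : ℝ} (ht : 0 < t) (x : Circ) : |thetaDeriv t x| ≤ thetaBound t :=
  tsum_of_norm_bounded (summable_sq_mul_exp ht).hasSum fun n => abs_deriv_term_le t n x

lemma abs_thetaDeriv2_le {t : ℝ} (ht : 0 < t) (x : Circ) : |thetaDeriv2 t x| ≤ thetaBound t :=
  tsum_of_norm_bounded (summable_sq_mul_exp ht).hasSum fun n => abs_deriv2_term_le t n x

lemma abs_theta_sub_one_le {t : ℝ} (ht : 0 < t) (x : Circ) :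
    |theta t x - 1| ≤ thetaBound t := by
  have h1 : theta t x - 1 = ∑' n : ℤ, (Real.exp (-((n : ℝ) ^ 2 * t)) * (fourier n x).re -
      if n = 0 then 1 else 0) := by
    rw [Summable.tsum_sub (summable_theta ht x)
      (summable_of_ne_finset_zero (s := {0}) (fun b hb => by simpa using hb)), tsum_ite_eq]
    rfl
  rw [h1, ← Real.norm_eq_abs]
  refine tsum_of_norm_bounded (summable_sq_mul_exp ht).hasSum fun n => ?_
  rcases eq_or_ne n 0 with rfl | hn
  · simp
  have : (1 : ℝ) ≤ (n : ℝ) ^ 2 := by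
    have := Int.one_le_abs hn
    have h2 : (1 : ℝ) ≤ |(n : ℝ)| := by exact_mod_cast this
    exact h2.trans (abs_le_sq_int n)
  rw [if_neg hn, sub_zero, norm_mul, Real.norm_eq_abs, Real.norm_eq_abs,
    abs_of_pos (Real.exp_pos _), mul_comm]
  gcongr
  exact (abs_fourier_re_le n x).trans this

/-- The power of `t` is not sharp. Any fixed power will do, because it is only used against the
exponentially small factor of `theta` away from the origin. -/
lemma exists_thetaBound_le : ∃ c : ℝ, 0 < c ∧ ∀ t, 0 < t → thetaBound t ≤ c / t ^ 2 := by
  refine ⟨2 * (∑' n : ℤ, 1 / (n : ℝ) ^ 2) + 1, by positivity, fun t ht => ?_⟩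
  have hs : Summable fun n : ℤ => 1 / (n : ℝ) ^ 2 := Real.summable_one_div_int_pow.2 one_lt_two
  calc thetaBound t ≤ ∑' n : ℤ, 2 / t ^ 2 * (1 / (n : ℝ) ^ 2) :=
        Summable.tsum_le_tsum (sq_mul_exp_le ht) (summable_sq_mul_exp ht) (hs.mul_left _)
    _ = (2 * (∑' n : ℤ, 1 / (n : ℝ) ^ 2)) / t ^ 2 := by rw [tsum_mul_left]; ring
    _ ≤ _ := by gcongr; linarith

/-- Spectral gap: the weight `n ^ 2` kills the constant mode, and every other mode has `n ^ 2 ≥ 1`.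
-/
lemma sq_mul_exp_decay {e t : ℝ} (het : e ≤ t) (n : ℤ) :
    (n : ℝ) ^ 2 * Real.exp (-((n : ℝ) ^ 2 * t)) ≤
      Real.exp (-(t - e)) * ((n : ℝ) ^ 2 * Real.exp (-((n : ℝ) ^ 2 * e))) := by
  rcases eq_or_ne n 0 with rfl | hn
  · simp
  have h1 : (1 : ℝ) ≤ (n : ℝ) ^ 2 := by
    have := Int.one_le_abs hn
    have h2 : (1 : ℝ) ≤ |(n : ℝ)| := by exact_mod_cast this
    exact h2.trans (abs_le_sq_int n)
  rw [mul_left_comm, ← Real.exp_add]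
  gcongr
  nlinarith

lemma thetaBound_decay {e t : ℝ} (he : 0 < e) (het : e ≤ t) :
    thetaBound t ≤ Real.exp (-(t - e)) * thetaBound e := by
  unfold thetaBound
  rw [← tsum_mul_left]
  exact Summable.tsum_le_tsum (sq_mul_exp_decay het) (summable_sq_mul_exp (he.trans_le het))
    ((summable_sq_mul_exp he).mul_left _)

lemma hasDerivAt_theta {t : ℝ} (ht : 0 < t) (x : ℝ) :
    HasDerivAt (fun y : ℝ => theta t (y : Circ)) (thetaDeriv t (x : Circ)) x := by
  have hb := fun (n : ℤ) (y : ℝ) => abs_deriv_term_le t n (y : Circ)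
  have h0 := summable_theta ht ((0 : ℝ) : Circ)
  simp only [theta, thetaDeriv, fourier_coe_re, fourier_coe_im] at hb h0 ⊢
  have hd (n : ℤ) (y : ℝ) : HasDerivAt
      (fun y : ℝ => Real.exp (-((n : ℝ) ^ 2 * t)) * Real.cos (n * y))
      (-((n : ℝ) * Real.exp (-((n : ℝ) ^ 2 * t)) * Real.sin (n * y))) y := by
    have h := ((hasDerivAt_id' y).const_mul (n : ℝ)).cos.const_mul (Real.exp (-((n : ℝ) ^ 2 * t)))
    refine h.congr_deriv ?_
    ring
  exact hasDerivAt_tsum (y₀ := 0) (summable_sq_mul_exp ht) hd hb h0 x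

lemma hasDerivAt_thetaDeriv {t : ℝ} (ht : 0 < t) (x : ℝ) :
    HasDerivAt (fun y : ℝ => thetaDeriv t (y : Circ)) (thetaDeriv2 t (x : Circ)) x := by
  have hb := fun (n : ℤ) (y : ℝ) => abs_deriv2_term_le t n (y : Circ)
  have h0 := summable_thetaDeriv ht ((0 : ℝ) : Circ)
  simp only [thetaDeriv2, thetaDeriv, fourier_coe_re, fourier_coe_im] at hb h0 ⊢
  have hd (n : ℤ) (y : ℝ) : HasDerivAt
      (fun y : ℝ => -((n : ℝ) * Real.exp (-((n : ℝ) ^ 2 * t)) * Real.sin (n * y)))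
      (-((n : ℝ) ^ 2 * Real.exp (-((n : ℝ) ^ 2 * t)) * Real.cos (n * y))) y := by
    have h := (((hasDerivAt_id' y).const_mul (n : ℝ)).sin.const_mul
      ((n : ℝ) * Real.exp (-((n : ℝ) ^ 2 * t)))).fun_neg
    refine h.congr_deriv ?_
    ring
  exact hasDerivAt_tsum (y₀ := 0) (summable_sq_mul_exp ht) hd hb h0 x

/-! ### Poisson summation and Gaussian bounds -/

lemma summable_gaussian_shift {t : ℝ} (ht : 0 < t) (R : ℝ) :
    Summable (fun n : ℤ => Real.exp (R ^ 2 / t) * Real.exp (-((n : ℝ) ^ 2 * (1 / t)))) :=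
  (summable_exp_neg_sq (by positivity)).mul_left _

/-- Rests on `2 π² n² ≤ (x - 2 π n)² + x²`. The majorant does not depend on `x` in the ball of
radius `R`, which allows termwise differentiation. -/
lemma gaussian_shift_le {t : ℝ} (ht : 0 < t) {R x : ℝ} (hx : |x| ≤ R) (n : ℤ) :
    Real.exp (-((x - 2 * Real.pi * n) ^ 2 / t)) ≤
      Real.exp (R ^ 2 / t) * Real.exp (-((n : ℝ) ^ 2 * (1 / t))) := by
  rw [← Real.exp_add]
  gcongr
  have h1 : (n : ℝ) ^ 2 ≤ (x - 2 * Real.pi * n) ^ 2 + R ^ 2 := by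
    have h2 : x ^ 2 ≤ R ^ 2 := sq_le_sq' (by linarith [neg_abs_le x]) (by linarith [le_abs_self x])
    have h3 : (1 : ℝ) ≤ Real.pi ^ 2 := by nlinarith [Real.pi_gt_three]
    nlinarith [sq_nonneg (2 * x - 2 * Real.pi * n), mul_nonneg (sq_nonneg (n : ℝ)) (sub_nonneg.2 h3)]
  have h4 : R ^ 2 / t + -((n : ℝ) ^ 2 * (1 / t)) - -((x - 2 * Real.pi * n) ^ 2 / t) =
    ((x - 2 * Real.pi * n) ^ 2 + R ^ 2 - (n : ℝ) ^ 2) / t := by ring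
  have h5 : 0 ≤ ((x - 2 * Real.pi * n) ^ 2 + R ^ 2 - (n : ℝ) ^ 2) / t := by
    apply div_nonneg _ ht.le; linarith
  linarith

lemma summable_gaussian {t : ℝ} (ht : 0 < t) (x : ℝ) :
    Summable (fun n : ℤ => Real.exp (-((x - 2 * Real.pi * n) ^ 2 / t))) :=
  Summable.of_nonneg_of_le (fun _ => (Real.exp_pos _).le)
    (gaussian_shift_le ht le_rfl) (summable_gaussian_shift ht |x|)

lemma hasDerivAt_tsum_shift {t M : ℝ} (ht : 0 < t) {g g' : ℝ → ℝ}
    (hg : ∀ y, HasDerivAt g (g' y) y) (hM0 : ∀ y, |g y| ≤ M * Real.exp (-(y ^ 2 / t)))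
    (hM : ∀ y, |g' y| ≤ M * Real.exp (-(y ^ 2 / t))) (x : ℝ) :
    HasDerivAt (fun x : ℝ => ∑' n : ℤ, g (x - 2 * Real.pi * n))
      (∑' n : ℤ, g' (x - 2 * Real.pi * n)) x := by
  have hMpos : 0 ≤ M := by
    have := (abs_nonneg _).trans (hM 0)
    simpa using this
  set R := |x| + 1
  refine hasDerivAt_tsum_of_isPreconnected (t := Metric.ball 0 R) (y₀ := x)
    (g := fun (n : ℤ) x => g (x - 2 * Real.pi * n)) (g' := fun n x => g' (x - 2 * Real.pi * n))
    ((summable_gaussian_shift ht R).mul_left M) Metric.isOpen_ball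
    (convex_ball _ _).isPreconnected ?_ ?_ ?_ ?_ ?_
  · intro n y _
    exact (hg _).comp_sub_const y _
  · intro n y hy
    rw [mem_ball_zero_iff, Real.norm_eq_abs] at hy
    rw [Real.norm_eq_abs]
    refine (hM _).trans ?_
    gcongr
    exact gaussian_shift_le ht hy.le n
  · simp [R]
  · exact Summable.of_norm_bounded ((summable_gaussian ht x).mul_left M) fun n => hM0 _
  · simp [R]

/-- Poisson summation. The Fourier side shows the decay for large `t`; this Gaussian side shows
positivity and the behaviour for small `t`. -/
lemma theta_coe_eq {t : ℝ} (ht : 0 < t) (x : ℝ) :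
    theta t (x : Circ) = √(Real.pi / t) *
      ∑' n : ℤ, Real.exp (-((x - 2 * Real.pi * n) ^ 2 / (4 * t))) := by
  have hpi : (Real.pi : ℂ) ≠ 0 := by exact_mod_cast Real.pi_ne_zero
  have htc : (t : ℂ) ≠ 0 := by exact_mod_cast ht.ne'
  have ha : 0 < ((t / Real.pi : ℝ) : ℂ).re := by
    rw [Complex.ofReal_re]; positivity
  -- The parameters `t / π` and `i x / (2 π)` turn the general term of the left side into `exp (-n²
  -- t) exp (i n x)`.
  have key := Complex.tsum_exp_neg_quadratic ha (Complex.I * ((x / (2 * Real.pi) : ℝ) : ℂ))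
  have h1 : ∀ n : ℤ, Complex.exp (-(Real.pi : ℂ) * ((t / Real.pi : ℝ) : ℂ) * (n : ℂ) ^ 2 +
      2 * Real.pi * (Complex.I * ((x / (2 * Real.pi) : ℝ) : ℂ)) * n) =
      ((Real.exp (-((n : ℝ) ^ 2 * t)) : ℝ) : ℂ) * fourier n (x : Circ) := by
    intro n
    rw [fourier_coe_eq, Complex.ofReal_exp, ← Complex.exp_add]
    congr 1
    push_cast
    field_simp
  have h2 : ∀ n : ℤ, Complex.exp (-(Real.pi : ℂ) / ((t / Real.pi : ℝ) : ℂ) *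
      ((n : ℂ) + Complex.I * (Complex.I * ((x / (2 * Real.pi) : ℝ) : ℂ))) ^ 2) =
      ((Real.exp (-((x - 2 * Real.pi * n) ^ 2 / (4 * t))) : ℝ) : ℂ) := by
    intro n
    rw [Complex.ofReal_exp]
    congr 1
    have h3 : (n : ℂ) + Complex.I * (Complex.I * ((x / (2 * Real.pi) : ℝ) : ℂ)) =
        n - ((x / (2 * Real.pi) : ℝ) : ℂ) := by
      rw [← mul_assoc, Complex.I_mul_I]; ring
    rw [h3]
    push_cast
    field_simp
    ring
  simp_rw [h1, h2] at key
  have hs : Summable fun n : ℤ => ((Real.exp (-((n : ℝ) ^ 2 * t)) : ℝ) : ℂ) *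
      fourier n (x : Circ) := by
    refine Summable.of_norm_bounded (summable_exp_neg_sq ht) fun n => ?_
    rw [norm_mul, fourier_apply, Circle.norm_coe, mul_one, Complex.norm_real, Real.norm_eq_abs,
      abs_of_pos (Real.exp_pos _)]
  have h4 : (1 : ℂ) / ((t / Real.pi : ℝ) : ℂ) ^ (1 / 2 : ℂ) = ((√(Real.pi / t) : ℝ) : ℂ) := by
    have : (1 / 2 : ℂ) = ((1 / 2 : ℝ) : ℂ) := by push_cast; ring
    rw [this, ← Complex.ofReal_cpow (by positivity), ← Real.sqrt_eq_rpow,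
      ← Complex.ofReal_one, ← Complex.ofReal_div, ← inv_div t, Real.sqrt_inv, one_div]
  rw [h4, ← Complex.ofReal_tsum, ← Complex.ofReal_mul] at key
  have := congrArg Complex.re key
  rw [Complex.ofReal_re, Complex.re_tsum hs] at this
  rw [← this]
  simp only [theta, Complex.re_ofReal_mul]

lemma circ_forall {p : Circ → Prop} (h : ∀ x : ℝ, p (x : Circ)) (x : Circ) : p x :=
  QuotientAddGroup.induction_on x h

lemma theta_nonneg {t : ℝ} (ht : 0 < t) (x : Circ) : 0 ≤ theta t x := by
  revert x
  refine circ_forall fun x => ?_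
  rw [theta_coe_eq ht]
  exact mul_nonneg (Real.sqrt_nonneg _) (tsum_nonneg fun n => (Real.exp_pos _).le)

/-- Gaussians with half the exponent resum to `theta` at twice the time. The other half of the
exponent remains available to absorb polynomial factors or to express decay. -/
lemma sqrt_pi_div_mul {t : ℝ} (ht : 0 < t) (x : ℝ) : √(Real.pi / t) *
    ∑' n : ℤ, Real.exp (-((x - 2 * Real.pi * n) ^ 2 / (8 * t))) = √2 * theta (2 * t) (x : Circ) := by
  rw [theta_coe_eq (by positivity), ← mul_assoc, ← Real.sqrt_mul (by norm_num)]
  congr 2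
  · field_simp
  · funext n; ring_nf

lemma hasDerivAt_gaussian (t y : ℝ) :
    HasDerivAt (fun y : ℝ => Real.exp (-(y ^ 2 / (4 * t))))
      (-(y / (2 * t)) * Real.exp (-(y ^ 2 / (4 * t)))) y := by
  have h := (((hasDerivAt_id' y).fun_pow 2).div_const (4 * t)).fun_neg.exp
  refine h.congr_deriv ?_
  push_cast
  ring

lemma hasDerivAt_gaussian_deriv (t y : ℝ) :
    HasDerivAt (fun y : ℝ => -(y / (2 * t)) * Real.exp (-(y ^ 2 / (4 * t))))
      ((y ^ 2 / (4 * t ^ 2) - 1 / (2 * t)) * Real.exp (-(y ^ 2 / (4 * t)))) y := by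
  have h := ((hasDerivAt_id' y).div_const (2 * t)).fun_neg.mul (hasDerivAt_gaussian t y)
  refine h.congr_deriv ?_
  ring

lemma exp_neg_split (t y : ℝ) : Real.exp (-(y ^ 2 / (4 * t))) =
    Real.exp (-(y ^ 2 / (8 * t))) * Real.exp (-(y ^ 2 / (8 * t))) := by
  rw [← Real.exp_add]; ring_nf

lemma abs_gaussian_deriv_le {t : ℝ} (ht : 0 < t) (y : ℝ) :
    |-(y / (2 * t)) * Real.exp (-(y ^ 2 / (4 * t)))| ≤ 1 / √t * Real.exp (-(y ^ 2 / (8 * t))) := by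
  rw [exp_neg_split, ← mul_assoc, abs_mul, abs_of_pos (Real.exp_pos _)]
  gcongr
  rw [abs_mul, abs_neg, abs_of_pos (Real.exp_pos _), Real.exp_neg, ← div_eq_mul_inv,
    div_le_iff₀ (Real.exp_pos _)]
  have h1 : 1 + y ^ 2 / (8 * t) ≤ Real.exp (y ^ 2 / (8 * t)) := by
    have := Real.add_one_le_exp (y ^ 2 / (8 * t)); linarith
  refine le_trans ?_ (mul_le_mul_of_nonneg_left h1 (by positivity))
  have hr : 0 < √t := Real.sqrt_pos.2 ht
  have ht2 : t = √t ^ 2 := (Real.sq_sqrt ht.le).symm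
  -- In the scaled variable `z = |y| / √t` the claim is `z / 2 ≤ 1 + z ^ 2 / 8`.
  set r := √t
  set z := |y| / r
  have e1 : |y / (2 * t)| = 1 / r * (z / 2) := by
    rw [abs_div, abs_of_pos (by positivity : 0 < 2 * t), ht2]
    simp only [z]; field_simp
  have e2 : y ^ 2 / (8 * t) = z ^ 2 / 8 := by
    rw [← sq_abs y, ht2]; simp only [z]; field_simp
  rw [e1, e2]
  gcongr
  nlinarith [sq_nonneg (z - 2)]

lemma abs_gaussian_deriv2_le {t : ℝ} (ht : 0 < t) (y : ℝ) :
    |(y ^ 2 / (4 * t ^ 2) - 1 / (2 * t)) * Real.exp (-(y ^ 2 / (4 * t)))| ≤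
      3 / t * Real.exp (-(y ^ 2 / (8 * t))) := by
  rw [exp_neg_split, ← mul_assoc, abs_mul, abs_of_pos (Real.exp_pos _)]
  gcongr
  rw [abs_mul, abs_of_pos (Real.exp_pos _), Real.exp_neg, ← div_eq_mul_inv,
    div_le_iff₀ (Real.exp_pos _)]
  have h1 : 1 + y ^ 2 / (8 * t) ≤ Real.exp (y ^ 2 / (8 * t)) := by
    have := Real.add_one_le_exp (y ^ 2 / (8 * t)); linarith
  refine le_trans ?_ (mul_le_mul_of_nonneg_left h1 (by positivity))
  have h2 : 3 / t * (1 + y ^ 2 / (8 * t)) = 3 / t + 3 * (y ^ 2 / (8 * t ^ 2)) := by field_simp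
  have h3 : y ^ 2 / (4 * t ^ 2) = 2 * (y ^ 2 / (8 * t ^ 2)) := by ring
  have h4 : 1 / (2 * t) = (1 / 6) * (3 / t) := by field_simp; norm_num
  have h5 : 0 ≤ y ^ 2 / (8 * t ^ 2) := by positivity
  have h6 : 0 ≤ 3 / t := by positivity
  rw [h2, h3, h4, abs_le]
  constructor <;> linarith

lemma hasDerivAt_theta_gaussian {t : ℝ} (ht : 0 < t) (x : ℝ) :
    HasDerivAt (fun x : ℝ => theta t (x : Circ)) (√(Real.pi / t) * ∑' n : ℤ,
      (-((x - 2 * Real.pi * n) / (2 * t)) *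
        Real.exp (-((x - 2 * Real.pi * n) ^ 2 / (4 * t))))) x := by
  have h := hasDerivAt_tsum_shift (t := 8 * t) (M := max 1 (1 / √t)) (by positivity)
    (hasDerivAt_gaussian t) (fun y => ?_) (fun y => ?_) x
  · have e : (fun x : ℝ => theta t (x : Circ)) = fun x => √(Real.pi / t) *
      ∑' n : ℤ, Real.exp (-((x - 2 * Real.pi * n) ^ 2 / (4 * t))) := funext (theta_coe_eq ht)
    rw [e]
    exact h.const_mul _
  · rw [abs_of_pos (Real.exp_pos _), exp_neg_split]
    gcongr
    refine le_trans ?_ (le_max_left _ _)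
    exact Real.exp_le_one_iff.2 (neg_nonpos.2 (by positivity))
  · refine (abs_gaussian_deriv_le ht y).trans ?_
    gcongr
    exact le_max_right _ _

/-- Both sides are the derivative of the same function, so no second Poisson summation is needed. -/
lemma thetaDeriv_coe_eq {t : ℝ} (ht : 0 < t) (x : ℝ) :
    thetaDeriv t (x : Circ) = √(Real.pi / t) * ∑' n : ℤ, (-((x - 2 * Real.pi * n) / (2 * t)) *
        Real.exp (-((x - 2 * Real.pi * n) ^ 2 / (4 * t)))) :=
  (hasDerivAt_theta ht x).unique (hasDerivAt_theta_gaussian ht x)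

lemma thetaDeriv2_coe_eq {t : ℝ} (ht : 0 < t) (x : ℝ) :
    thetaDeriv2 t (x : Circ) = √(Real.pi / t) * ∑' n : ℤ,
      (((x - 2 * Real.pi * n) ^ 2 / (4 * t ^ 2) - 1 / (2 * t)) *
        Real.exp (-((x - 2 * Real.pi * n) ^ 2 / (4 * t)))) := by
  have h := hasDerivAt_tsum_shift (t := 8 * t) (M := max (3 / t) (1 / √t)) (by positivity)
    (hasDerivAt_gaussian_deriv t) (fun y => ?_) (fun y => ?_) x
  · have e : (fun x : ℝ => thetaDeriv t (x : Circ)) = _ := funext (thetaDeriv_coe_eq ht)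
    have h2 := hasDerivAt_thetaDeriv ht x
    rw [e] at h2
    exact h2.unique (h.const_mul _)
  · refine (abs_gaussian_deriv_le ht y).trans ?_
    gcongr
    exact le_max_right _ _
  · refine (abs_gaussian_deriv2_le ht y).trans ?_
    gcongr
    exact le_max_left _ _

/-- Domination by `theta` at time `2 t` reduces all `L¹` bounds to the mass of `theta`, which is `2
π` at every time. -/
lemma abs_sqrt_mul_tsum_le {t M : ℝ} (ht : 0 < t) {f : ℝ → ℝ}
    (hf : ∀ y, |f y| ≤ M * Real.exp (-(y ^ 2 / (8 * t)))) (x : ℝ) :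
    |√(Real.pi / t) * ∑' n : ℤ, f (x - 2 * Real.pi * n)| ≤
      2 * M * theta (2 * t) (x : Circ) := by
  have hM : 0 ≤ M := by simpa using (abs_nonneg _).trans (hf 0)
  have h1 : |∑' n : ℤ, f (x - 2 * Real.pi * n)| ≤
      M * ∑' n : ℤ, Real.exp (-((x - 2 * Real.pi * n) ^ 2 / (8 * t))) :=
    tsum_of_norm_bounded (f := fun n : ℤ => f (x - 2 * Real.pi * n))
      ((summable_gaussian (t := 8 * t) (by positivity) x).hasSum.mul_left M) fun n => hf _
  have h2 : √2 ≤ 2 := Real.sqrt_le_iff.2 ⟨by norm_num, by norm_num⟩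
  calc |√(Real.pi / t) * ∑' n : ℤ, f (x - 2 * Real.pi * n)|
      = √(Real.pi / t) * |∑' n : ℤ, f (x - 2 * Real.pi * n)| := by
        rw [abs_mul, abs_of_nonneg (Real.sqrt_nonneg _)]
    _ ≤ √(Real.pi / t) * (M * ∑' n : ℤ, Real.exp (-((x - 2 * Real.pi * n) ^ 2 / (8 * t)))) := by
        gcongr
    _ = √2 * M * theta (2 * t) (x : Circ) := by
        rw [mul_left_comm, sqrt_pi_div_mul ht]; ring
    _ ≤ _ := by
        have := theta_nonneg (by positivity : 0 < 2 * t) (x : Circ)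
        gcongr

lemma abs_thetaDeriv_le_theta {t : ℝ} (ht : 0 < t) (x : Circ) :
    |thetaDeriv t x| ≤ 2 * (1 / √t) * theta (2 * t) x := by
  revert x
  refine circ_forall fun x => ?_
  rw [thetaDeriv_coe_eq ht]
  exact abs_sqrt_mul_tsum_le ht (abs_gaussian_deriv_le ht) x

lemma abs_thetaDeriv2_le_theta {t : ℝ} (ht : 0 < t) (x : Circ) :
    |thetaDeriv2 t x| ≤ 2 * (3 / t) * theta (2 * t) x := by
  revert x
  refine circ_forall fun x => ?_
  rw [thetaDeriv2_coe_eq ht]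
  exact abs_sqrt_mul_tsum_le ht (abs_gaussian_deriv2_le ht) x

/-- Away from the origin, `theta` decays exponentially as `t → 0`. -/
lemma theta_le_exp_mul {t : ℝ} (ht : 0 < t) (x : Circ) :
    theta t x ≤ 2 * Real.exp (-(‖x‖ ^ 2 / (8 * t))) * theta (2 * t) x := by
  revert x
  refine circ_forall fun x => ?_
  rw [theta_coe_eq ht]
  have hn : ∀ n : ℤ, ‖(x : Circ)‖ ≤ |x - 2 * Real.pi * n| := by
    intro n
    have : (x : Circ) = ((x - 2 * Real.pi * n : ℝ) : Circ) := by
      rw [AddCircle.coe_sub, eq_comm, sub_eq_self, AddCircle.coe_eq_zero_iff]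
      exact ⟨n, by rw [zsmul_eq_mul]; ring⟩
    rw [this]
    exact QuotientAddGroup.norm_mk_le_norm
  have h2 : √2 ≤ 2 := Real.sqrt_le_iff.2 ⟨by norm_num, by norm_num⟩
  have h8 : Summable (fun n : ℤ => Real.exp (-((x - 2 * Real.pi * n) ^ 2 / (8 * t)))) :=
    summable_gaussian (by positivity) x
  have h1 : ∑' n : ℤ, Real.exp (-((x - 2 * Real.pi * n) ^ 2 / (4 * t))) ≤
      Real.exp (-(‖(x : Circ)‖ ^ 2 / (8 * t))) *
        ∑' n : ℤ, Real.exp (-((x - 2 * Real.pi * n) ^ 2 / (8 * t))) := by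
    rw [← tsum_mul_left]
    refine Summable.tsum_le_tsum (fun n => ?_) (summable_gaussian (by positivity) x)
      (h8.mul_left _)
    have hsq : ‖(x : Circ)‖ ^ 2 ≤ (x - 2 * Real.pi * n) ^ 2 := by
      rw [← sq_abs (x - 2 * Real.pi * n)]
      gcongr
      exact hn n
    rw [exp_neg_split]
    gcongr
  calc _ ≤ √(Real.pi / t) * (Real.exp (-(‖(x : Circ)‖ ^ 2 / (8 * t))) *
        ∑' n : ℤ, Real.exp (-((x - 2 * Real.pi * n) ^ 2 / (8 * t)))) := by gcongr
    _ = √2 * Real.exp (-(‖(x : Circ)‖ ^ 2 / (8 * t))) * theta (2 * t) (x : Circ) := by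
        rw [mul_left_comm, sqrt_pi_div_mul ht]; ring
    _ ≤ _ := by
        have := theta_nonneg (by positivity : 0 < 2 * t) (x : Circ)
        gcongr

/-! ### Continuity and integrals -/

lemma continuous_fourier_re (n : ℤ) : Continuous fun x : Circ => (fourier n x).re :=
  Complex.continuous_re.comp (fourier n).continuous

lemma continuous_fourier_im (n : ℤ) : Continuous fun x : Circ => (fourier n x).im :=
  Complex.continuous_im.comp (fourier n).continuous

lemma continuousOn_of_forall_Ici {f : ℝ × Circ → ℝ}
    (h : ∀ e, 0 < e → ContinuousOn f (Set.Ici e ×ˢ Set.univ)) :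
    ContinuousOn f (Set.Ioi 0 ×ˢ Set.univ) := by
  rintro ⟨t, x⟩ ⟨ht, -⟩
  have ht : 0 < t := ht
  refine ((h (t / 2) (by positivity)).continuousAt ?_).continuousWithinAt
  exact prod_mem_nhds (Ici_mem_nhds (by linarith)) Filter.univ_mem

lemma exp_neg_sq_mul_anti {e t : ℝ} (h : e ≤ t) (n : ℤ) :
    Real.exp (-((n : ℝ) ^ 2 * t)) ≤ Real.exp (-((n : ℝ) ^ 2 * e)) := by gcongr

lemma continuousOn_theta :
    ContinuousOn (fun p : ℝ × Circ => theta p.1 p.2) (Set.Ioi 0 ×ˢ Set.univ) := by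
  refine continuousOn_of_forall_Ici fun e he => ?_
  refine continuousOn_tsum (fun n => ?_) (summable_exp_neg_sq he) fun n p hp => ?_
  · have := (continuous_fourier_re n).comp (continuous_snd (X := ℝ))
    exact Continuous.continuousOn (by fun_prop)
  · rw [norm_mul, Real.norm_eq_abs, Real.norm_eq_abs, abs_of_pos (Real.exp_pos _)]
    exact (mul_le_of_le_one_right (Real.exp_pos _).le (abs_fourier_re_le n _)).trans
      (exp_neg_sq_mul_anti hp.1 n)

lemma continuousOn_thetaDeriv :
    ContinuousOn (fun p : ℝ × Circ => thetaDeriv p.1 p.2) (Set.Ioi 0 ×ˢ Set.univ) := by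
  refine continuousOn_of_forall_Ici fun e he => ?_
  refine continuousOn_tsum (fun n => ?_) (summable_sq_mul_exp he) fun n p hp => ?_
  · have := (continuous_fourier_im n).comp (continuous_snd (X := ℝ))
    exact Continuous.continuousOn (by fun_prop)
  · refine (abs_deriv_term_le p.1 n p.2).trans ?_
    gcongr
    exact hp.1

lemma continuousOn_thetaDeriv2 :
    ContinuousOn (fun p : ℝ × Circ => thetaDeriv2 p.1 p.2) (Set.Ioi 0 ×ˢ Set.univ) := by
  refine continuousOn_of_forall_Ici fun e he => ?_
  refine continuousOn_tsum (fun n => ?_) (summable_sq_mul_exp he) fun n p hp => ?_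
  · have := (continuous_fourier_re n).comp (continuous_snd (X := ℝ))
    exact Continuous.continuousOn (by fun_prop)
  · refine (abs_deriv2_term_le p.1 n p.2).trans ?_
    gcongr
    exact hp.1

lemma continuous_slice {f : ℝ → Circ → ℝ}
    (h : ContinuousOn (fun p : ℝ × Circ => f p.1 p.2) (Set.Ioi 0 ×ˢ Set.univ)) {t : ℝ}
    (ht : 0 < t) : Continuous (f t) :=
  h.comp_continuous (f := fun x => (t, x)) (by fun_prop) fun _ => ⟨ht, Set.mem_univ _⟩

lemma integrable_circ {f : Circ → ℝ} (hf : Continuous f) : Integrable f :=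
  hf.integrable_of_hasCompactSupport (HasCompactSupport.of_compactSpace f)

/-- A translation by half a wavelength changes the sign of the integrand. -/
lemma integral_fourier_re {n : ℤ} (hn : n ≠ 0) : ∫ x : Circ, (fourier n x).re = 0 := by
  have h : ∀ x : Circ, (fourier n (x + ((2 * Real.pi / 2 / n : ℝ) : Circ))).re =
      -(fourier n x).re := fun x => by
    rw [fourier_add_half_inv_index hn Real.two_pi_pos, Complex.neg_re]
  exact integral_eq_zero_of_add_right_eq_neg (μ := volume) h

lemma volume_real_circ : (volume : Measure Circ).real Set.univ = 2 * Real.pi := by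
  rw [Measure.real, AddCircle.measure_univ, ENNReal.toReal_ofReal Real.two_pi_pos.le]

lemma integral_theta {t : ℝ} (ht : 0 < t) : ∫ x : Circ, theta t x = 2 * Real.pi := by
  have hi (n : ℤ) : Integrable (fun x : Circ => Real.exp (-((n : ℝ) ^ 2 * t)) *
      (fourier n x).re) := (integrable_circ (continuous_fourier_re n)).const_mul _
  have hs : Summable fun n : ℤ => ∫ x : Circ, ‖Real.exp (-((n : ℝ) ^ 2 * t)) *
      (fourier n x).re‖ := by
    refine Summable.of_nonneg_of_le (fun n => integral_nonneg fun x => norm_nonneg _)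
      (fun n => ?_) ((summable_exp_neg_sq ht).mul_right (2 * Real.pi))
    calc ∫ x : Circ, ‖Real.exp (-((n : ℝ) ^ 2 * t)) * (fourier n x).re‖
        ≤ ∫ _ : Circ, Real.exp (-((n : ℝ) ^ 2 * t)) := by
          refine integral_mono (hi n).norm (integrable_const _) fun x => ?_
          simp only [norm_mul, Real.norm_eq_abs, Real.abs_exp]
          exact mul_le_of_le_one_right (Real.exp_pos _).le (abs_fourier_re_le n x)
      _ = _ := by rw [integral_const, volume_real_circ, smul_eq_mul, mul_comm]
  unfold theta
  rw [← integral_tsum_of_summable_integral_norm hi hs, tsum_eq_single 0]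
  · simp [volume_real_circ]
  · intro n hn
    rw [integral_const_mul, integral_fourier_re hn, mul_zero]

lemma integral_abs_thetaDeriv_le {t : ℝ} (ht : 0 < t) :
    ∫ x : Circ, |thetaDeriv t x| ≤ 4 * Real.pi / √t := by
  calc ∫ x : Circ, |thetaDeriv t x| ≤ ∫ x : Circ, 2 * (1 / √t) * theta (2 * t) x :=
        integral_mono (integrable_circ (continuous_slice continuousOn_thetaDeriv ht).abs)
          ((integrable_circ (continuous_slice continuousOn_theta (by positivity))).const_mul _)
          fun x => abs_thetaDeriv_le_theta ht x
    _ = _ := by rw [integral_const_mul, integral_theta (by positivity)]; ring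

lemma integral_abs_thetaDeriv2_le {t : ℝ} (ht : 0 < t) :
    ∫ x : Circ, |thetaDeriv2 t x| ≤ 12 * Real.pi / t := by
  calc ∫ x : Circ, |thetaDeriv2 t x| ≤ ∫ x : Circ, 2 * (3 / t) * theta (2 * t) x :=
        integral_mono (integrable_circ (continuous_slice continuousOn_thetaDeriv2 ht).abs)
          ((integrable_circ (continuous_slice continuousOn_theta (by positivity))).const_mul _)
          fun x => abs_thetaDeriv2_le_theta ht x
    _ = _ := by rw [integral_const_mul, integral_theta (by positivity)]; ring

/-! ### The Biot-Savart kernel as a time integral -/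

/-- `∇^⊥` of minus the heat kernel. -/
noncomputable def heatCurl (t : ℝ) (x : Torus) : ℝ × ℝ :=
  ((2 * Real.pi) ^ 2)⁻¹ •
    (theta t x.1 * thetaDeriv t x.2, -(thetaDeriv t x.1 * theta t x.2))

/-- The difference is the integral of `f'` over the segment; Fubini and translation invariance make
every point of the segment contribute the same `L¹` norm. -/
lemma integral_abs_translate_sub_le {f f' : Circ → ℝ} (hf : Continuous f) (hf' : Continuous f')
    (hd : ∀ x : ℝ, HasDerivAt (fun y : ℝ => f (y : Circ)) (f' (x : Circ)) x) (a : ℝ) :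
    ∫ x, |f (x + (a : Circ)) - f x| ≤ |a| * ∫ x, |f' x| := by
  have hcoe : Continuous ((↑) : ℝ → Circ) := AddCircle.continuous_mk' _
  have h1 : ∀ x : Circ, |f (x + (a : Circ)) - f x| ≤ ∫ s in Set.uIoc 0 a, |f' (x + (s : Circ))| := by
    refine circ_forall fun x => ?_
    have h2 : ∫ s in (0 : ℝ)..a, f' ((x + s : ℝ) : Circ) = f ((x + a : ℝ) : Circ) - f (x : Circ) := by
      have := intervalIntegral.integral_eq_sub_of_hasDerivAt (a := 0) (b := a)
        (f := fun s : ℝ => f ((x + s : ℝ) : Circ)) (f' := fun s : ℝ => f' ((x + s : ℝ) : Circ))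
        (fun s _ => (hd (x + s)).comp_const_add x s)
        (Continuous.intervalIntegrable (by fun_prop) _ _)
      rw [this, add_zero]
    rw [← AddCircle.coe_add, ← h2]
    have := intervalIntegral.norm_integral_le_integral_norm_uIoc
      (f := fun s : ℝ => f' ((x + s : ℝ) : Circ)) (a := 0) (b := a) (μ := volume)
    simpa [AddCircle.coe_add] using this
  have hc : Continuous (fun p : Circ × ℝ => |f' (p.1 + (p.2 : Circ))|) := by fun_prop
  have hbd : ∃ C, ∀ x, |f' x| ≤ C := by
    obtain ⟨C, hC⟩ := isCompact_univ.exists_bound_of_continuousOn (f := f') hf'.continuousOn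
    exact ⟨C, fun x => hC x (Set.mem_univ _)⟩
  obtain ⟨C, hC⟩ := hbd
  have : IsFiniteMeasure (volume.restrict (Set.uIoc 0 a)) := by
    constructor; rw [Measure.restrict_apply_univ]; exact measure_Ioc_lt_top
  have hint : Integrable (Function.uncurry fun (x : Circ) (s : ℝ) => |f' (x + (s : Circ))|)
      ((volume : Measure Circ).prod (volume.restrict (Set.uIoc 0 a))) := by
    refine Integrable.of_bound hc.aestronglyMeasurable C (Filter.Eventually.of_forall fun p => ?_)
    simp only [Function.uncurry, Real.norm_eq_abs, abs_abs]
    exact hC _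
  calc ∫ x, |f (x + (a : Circ)) - f x|
      ≤ ∫ x : Circ, ∫ s in Set.uIoc 0 a, |f' (x + (s : Circ))| :=
        integral_mono (integrable_circ (by fun_prop)) hint.integral_prod_left h1
    _ = ∫ s in Set.uIoc 0 a, ∫ x : Circ, |f' (x + (s : Circ))| := integral_integral_swap hint
    _ = ∫ s in Set.uIoc 0 a, ∫ x : Circ, |f' x| := by
        congr 1; funext s
        exact integral_add_right_eq_self (μ := (volume : Measure Circ)) (fun x => |f' x|) _
    _ = _ := by
        rw [setIntegral_const, smul_eq_mul, Measure.real, Set.uIoc, Real.volume_Ioc,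
          max_sub_min_eq_abs, sub_zero, ENNReal.toReal_ofReal (abs_nonneg _)]

lemma continuousOn_heatCurl :
    ContinuousOn (fun p : ℝ × Torus => heatCurl p.1 p.2) (Set.Ioi 0 ×ˢ Set.univ) := by
  have h0 (f : ℝ × Torus → ℝ × Circ) (hf : Continuous f) (hf1 : ∀ p, (f p).1 = p.1) :
      ContinuousOn (fun p => theta (f p).1 (f p).2) (Set.Ioi 0 ×ˢ Set.univ) :=
    continuousOn_theta.comp hf.continuousOn fun p hp => ⟨by rw [hf1]; exact hp.1, Set.mem_univ _⟩
  have h1 (f : ℝ × Torus → ℝ × Circ) (hf : Continuous f) (hf1 : ∀ p, (f p).1 = p.1) :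
      ContinuousOn (fun p => thetaDeriv (f p).1 (f p).2) (Set.Ioi 0 ×ˢ Set.univ) :=
    continuousOn_thetaDeriv.comp hf.continuousOn
      fun p hp => ⟨by rw [hf1]; exact hp.1, Set.mem_univ _⟩
  have a := h0 (fun p => (p.1, p.2.1)) (by fun_prop) (fun _ => rfl)
  have b := h0 (fun p => (p.1, p.2.2)) (by fun_prop) (fun _ => rfl)
  have c := h1 (fun p => (p.1, p.2.1)) (by fun_prop) (fun _ => rfl)
  have d := h1 (fun p => (p.1, p.2.2)) (by fun_prop) (fun _ => rfl)
  exact ((a.mul d).prodMk (c.mul b).neg).const_smul (((2 * Real.pi) ^ 2)⁻¹ : ℝ)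

lemma continuous_heatCurl {t : ℝ} (ht : 0 < t) : Continuous (heatCurl t) :=
  continuousOn_heatCurl.comp_continuous (f := fun x => (t, x)) (by fun_prop)
    fun _ => ⟨ht, Set.mem_univ _⟩

lemma integrable_torus {E : Type*} [NormedAddCommGroup E] {f : Torus → E} (hf : Continuous f) :
    Integrable f :=
  hf.integrable_of_hasCompactSupport (HasCompactSupport.of_compactSpace f)

lemma integral_abs_mul_prod (f g : Circ → ℝ) :
    ∫ x : Torus, |f x.1| * |g x.2| = (∫ x, |f x|) * ∫ x, |g x| :=
  integral_prod_mul (μ := (volume : Measure Circ)) (ν := (volume : Measure Circ))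
    (fun x => |f x|) (fun x => |g x|)

lemma norm_smul_pair_le {c a b : ℝ} (hc : 0 ≤ c) : ‖c • ((a, b) : ℝ × ℝ)‖ ≤ c * (|a| + |b|) := by
  rw [norm_smul, Real.norm_eq_abs, abs_of_nonneg hc]
  gcongr
  rw [Prod.norm_def]
  exact max_le (le_add_of_nonneg_right (abs_nonneg _)) (le_add_of_nonneg_left (abs_nonneg _))

lemma integral_abs_theta {t : ℝ} (ht : 0 < t) : ∫ x : Circ, |theta t x| = 2 * Real.pi := by
  refine Eq.trans ?_ (integral_theta ht)
  congr 1; funext x; exact abs_of_nonneg (theta_nonneg ht x)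

lemma integral_norm_heatCurl_le {t : ℝ} (ht : 0 < t) :
    ∫ x, ‖heatCurl t x‖ ≤ (∫ x : Circ, |thetaDeriv t x|) / Real.pi := by
  have c0 := continuous_slice continuousOn_theta ht
  have c1 := continuous_slice continuousOn_thetaDeriv ht
  calc ∫ x, ‖heatCurl t x‖ ≤ ∫ x : Torus, ((2 * Real.pi) ^ 2)⁻¹ *
        (|theta t x.1| * |thetaDeriv t x.2| + |thetaDeriv t x.1| * |theta t x.2|) := by
        refine integral_mono (integrable_torus (continuous_heatCurl ht)).norm
          (integrable_torus (by fun_prop)) fun x => ?_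
        refine (norm_smul_pair_le (by positivity)).trans_eq ?_
        rw [abs_neg, abs_mul, abs_mul]
    _ = _ := by
        rw [integral_const_mul, integral_add (integrable_torus (by fun_prop))
          (integrable_torus (by fun_prop)), integral_abs_mul_prod, integral_abs_mul_prod,
          integral_abs_theta ht]
        have := Real.pi_ne_zero
        field_simp; ring

/-- Each component is a product of functions of one variable, so its increment splits by the
discrete Leibniz rule into products whose `L¹` norms factor. -/
lemma integral_norm_heatCurl_translate_le {t : ℝ} (ht : 0 < t) (a : ℝ × ℝ) :
    ∫ x, ‖heatCurl t (x + proj a) - heatCurl t x‖ ≤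
      ((2 * Real.pi) ^ 2)⁻¹ * (2 * ‖a‖ * ((∫ x : Circ, |thetaDeriv t x|) ^ 2 +
        2 * Real.pi * ∫ x : Circ, |thetaDeriv2 t x|)) := by
  have c0 := continuous_slice continuousOn_theta ht
  have c1 := continuous_slice continuousOn_thetaDeriv ht
  have c2 := continuous_slice continuousOn_thetaDeriv2 ht
  set I1 := ∫ x : Circ, |thetaDeriv t x|
  set I2 := ∫ x : Circ, |thetaDeriv2 t x|
  have hI1 : 0 ≤ I1 := integral_nonneg fun x => abs_nonneg _
  have hI2 : 0 ≤ I2 := integral_nonneg fun x => abs_nonneg _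
  -- `d0` and `d1` are increments of `theta` and of its derivative, `s1` is the translated
  -- derivative.
  let d0 : ℝ → Circ → ℝ := fun b x => theta t (x + (b : Circ)) - theta t x
  let d1 : ℝ → Circ → ℝ := fun b x => thetaDeriv t (x + (b : Circ)) - thetaDeriv t x
  let s1 : ℝ → Circ → ℝ := fun b x => thetaDeriv t (x + (b : Circ))
  have hd0 : ∀ b, Continuous (d0 b) := fun b => by fun_prop
  have hd1 : ∀ b, Continuous (d1 b) := fun b => by fun_prop
  have hs1 : ∀ b, Continuous (s1 b) := fun b => by fun_prop
  have e0 : ∀ b, ∫ x, |d0 b x| ≤ |b| * I1 :=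
    integral_abs_translate_sub_le c0 c1 (hasDerivAt_theta ht)
  have e1 : ∀ b, ∫ x, |d1 b x| ≤ |b| * I2 :=
    integral_abs_translate_sub_le c1 c2 (hasDerivAt_thetaDeriv ht)
  have es : ∀ b, ∫ x, |s1 b x| = I1 := fun b =>
    integral_add_right_eq_self (μ := (volume : Measure Circ)) (fun x => |thetaDeriv t x|) _
  have ha1 : |a.1| ≤ ‖a‖ := norm_fst_le a
  have ha2 : |a.2| ≤ ‖a‖ := norm_snd_le a
  calc ∫ x, ‖heatCurl t (x + proj a) - heatCurl t x‖
      ≤ ∫ x : Torus, ((2 * Real.pi) ^ 2)⁻¹ *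
        ((|d0 a.1 x.1| * |s1 a.2 x.2| + |theta t x.1| * |d1 a.2 x.2|) +
          (|s1 a.1 x.1| * |d0 a.2 x.2| + |d1 a.1 x.1| * |theta t x.2|)) := by
        refine integral_mono (integrable_torus ?_).norm (integrable_torus (by fun_prop)) fun x => ?_
        · have := continuous_heatCurl ht
          fun_prop
        simp only [heatCurl, ← smul_sub, Prod.mk_sub_mk]
        refine (norm_smul_pair_le (by positivity)).trans ?_
        gcongr
        · rw [← abs_mul, ← abs_mul]
          refine le_trans (le_of_eq ?_) (abs_add_le _ _)
          congr 1
          simp only [d0, s1, d1, proj, Prod.fst_add, Prod.snd_add]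
          ring
        · rw [← abs_mul, ← abs_mul, ← abs_neg]
          refine le_trans (le_of_eq ?_) (abs_add_le _ _)
          congr 1
          simp only [d0, s1, d1, proj, Prod.fst_add, Prod.snd_add]
          ring
    _ = ((2 * Real.pi) ^ 2)⁻¹ *
        (((∫ x, |d0 a.1 x|) * I1 + (2 * Real.pi) * ∫ x, |d1 a.2 x|) +
          (I1 * (∫ x, |d0 a.2 x|) + (∫ x, |d1 a.1 x|) * (2 * Real.pi))) := by
        rw [integral_const_mul, integral_add (integrable_torus (by fun_prop))
          (integrable_torus (by fun_prop)), integral_add (integrable_torus (by fun_prop))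
          (integrable_torus (by fun_prop)), integral_add (integrable_torus (by fun_prop))
          (integrable_torus (by fun_prop)), integral_abs_mul_prod, integral_abs_mul_prod,
          integral_abs_mul_prod, integral_abs_mul_prod, integral_abs_theta ht, es, es]
    _ ≤ ((2 * Real.pi) ^ 2)⁻¹ *
        ((‖a‖ * I1 * I1 + (2 * Real.pi) * (‖a‖ * I2)) +
          (I1 * (‖a‖ * I1) + (‖a‖ * I2) * (2 * Real.pi))) := by
        have g1 := (e0 a.1).trans (mul_le_mul_of_nonneg_right ha1 hI1)
        have g2 := (e0 a.2).trans (mul_le_mul_of_nonneg_right ha2 hI1)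
        have g3 := (e1 a.1).trans (mul_le_mul_of_nonneg_right ha1 hI2)
        have g4 := (e1 a.2).trans (mul_le_mul_of_nonneg_right ha2 hI2)
        gcongr
    _ = _ := by ring

/-- The Biot-Savart kernel, written as a time integral of heat kernels. -/
noncomputable def biotSavart (x : Torus) : ℝ × ℝ := ∫ t in Set.Ioi (0 : ℝ), heatCurl t x

/-! ### `L¹` bounds in time and the log-Lipschitz modulus of the kernel -/

lemma integral_norm_heatCurl_le_sqrt {t : ℝ} (ht : 0 < t) :
    ∫ x, ‖heatCurl t x‖ ≤ 4 / √t := by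
  refine (integral_norm_heatCurl_le ht).trans ?_
  rw [div_le_iff₀ Real.pi_pos]
  refine (integral_abs_thetaDeriv_le ht).trans_eq ?_
  ring

lemma integral_norm_heatCurl_translate_le_div {t : ℝ} (ht : 0 < t) (a : ℝ × ℝ) :
    ∫ x, ‖heatCurl t (x + proj a) - heatCurl t x‖ ≤ 20 * ‖a‖ / t := by
  refine (integral_norm_heatCurl_translate_le ht a).trans ?_
  have h1 := integral_abs_thetaDeriv_le ht
  have h2 := integral_abs_thetaDeriv2_le ht
  have h0 : 0 ≤ ∫ x : Circ, |thetaDeriv t x| := integral_nonneg fun x => abs_nonneg _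
  have hsq : √t ^ 2 = t := Real.sq_sqrt ht.le
  calc _ ≤ ((2 * Real.pi) ^ 2)⁻¹ * (2 * ‖a‖ * ((4 * Real.pi / √t) ^ 2 +
        2 * Real.pi * (12 * Real.pi / t))) := by gcongr
    _ = _ := by
      rw [div_pow, hsq]
      have := Real.pi_ne_zero
      field_simp; ring

lemma integral_circ_le_of_bound {f : Circ → ℝ} {B : ℝ} (hB : ∀ x, |f x| ≤ B)
    (hf : Continuous f) : ∫ x, |f x| ≤ 2 * Real.pi * B := by
  calc ∫ x, |f x| ≤ ∫ _ : Circ, B :=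
        integral_mono (integrable_circ hf).abs (integrable_const _) hB
    _ = _ := by rw [integral_const, volume_real_circ, smul_eq_mul]

/-- Every term of `heatCurl` contains a derivative of `theta`, which has no constant mode and
therefore decays like `exp (-t)`. -/
lemma exists_heatCurl_exp_bound : ∃ c : ℝ, 0 ≤ c ∧ ∀ t : ℝ, 1 ≤ t →
    ∫ x, ‖heatCurl t x‖ ≤ c * Real.exp (-t) ∧
    ∀ a, ∫ x, ‖heatCurl t (x + proj a) - heatCurl t x‖ ≤ c * ‖a‖ * Real.exp (-t) := by
  set B := thetaBound 1 * Real.exp 1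
  have hB : 0 ≤ B := mul_nonneg (thetaBound_nonneg _) (Real.exp_pos _).le
  refine ⟨2 * (B ^ 2 + B), by positivity, fun t ht => ?_⟩
  have ht0 : 0 < t := by linarith
  have hdec : thetaBound t ≤ B * Real.exp (-t) := by
    refine (thetaBound_decay one_pos ht).trans_eq ?_
    rw [neg_sub, sub_eq_add_neg, Real.exp_add]; ring
  have he : Real.exp (-t) ≤ 1 := Real.exp_le_one_iff.2 (by linarith)
  have hep := Real.exp_pos (-t)
  have h1 : ∫ x : Circ, |thetaDeriv t x| ≤ 2 * Real.pi * (B * Real.exp (-t)) :=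
    integral_circ_le_of_bound (fun x => (abs_thetaDeriv_le ht0 x).trans hdec)
      (continuous_slice continuousOn_thetaDeriv ht0)
  have h2 : ∫ x : Circ, |thetaDeriv2 t x| ≤ 2 * Real.pi * (B * Real.exp (-t)) :=
    integral_circ_le_of_bound (fun x => (abs_thetaDeriv2_le ht0 x).trans hdec)
      (continuous_slice continuousOn_thetaDeriv2 ht0)
  have h0 : 0 ≤ ∫ x : Circ, |thetaDeriv t x| := integral_nonneg fun x => abs_nonneg _
  constructor
  · refine (integral_norm_heatCurl_le ht0).trans ?_
    rw [div_le_iff₀ Real.pi_pos]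
    refine h1.trans ?_
    have : 0 ≤ 2 * Real.pi * (B ^ 2 * Real.exp (-t)) := by positivity
    nlinarith
  · intro a
    refine (integral_norm_heatCurl_translate_le ht0 a).trans ?_
    calc _ ≤ ((2 * Real.pi) ^ 2)⁻¹ * (2 * ‖a‖ * ((2 * Real.pi * (B * Real.exp (-t))) ^ 2 +
        2 * Real.pi * (2 * Real.pi * (B * Real.exp (-t))))) := by gcongr
      _ = 2 * ‖a‖ * (B ^ 2 * (Real.exp (-t) * Real.exp (-t)) + B * Real.exp (-t)) := by
        have := Real.pi_ne_zero
        field_simp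
      _ ≤ 2 * ‖a‖ * (B ^ 2 * (Real.exp (-t) * 1) + B * Real.exp (-t)) := by gcongr
      _ = _ := by ring

lemma one_div_sqrt_eq_rpow {t : ℝ} (ht : 0 ≤ t) : 1 / √t = t ^ (-(1 / 2) : ℝ) := by
  rw [Real.rpow_neg ht, Real.sqrt_eq_rpow, one_div (t ^ (1 / 2 : ℝ))]

lemma integrableOn_inv_sqrt {s : ℝ} (hs : 0 ≤ s) :
    IntegrableOn (fun t => 1 / √t) (Set.Ioc 0 s) := by
  have h := intervalIntegral.intervalIntegrable_rpow' (a := 0) (b := s) (r := -(1 / 2))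
    (by norm_num)
  exact ((intervalIntegrable_iff_integrableOn_Ioc_of_le hs).1 h).congr_fun
    (fun t ht => (one_div_sqrt_eq_rpow ht.1.le).symm) measurableSet_Ioc

lemma integral_inv_sqrt {s : ℝ} (hs : 0 ≤ s) : ∫ t in Set.Ioc 0 s, 1 / √t = 2 * √s := by
  rw [setIntegral_congr_fun measurableSet_Ioc fun t ht => one_div_sqrt_eq_rpow ht.1.le,
    ← intervalIntegral.integral_of_le hs, integral_rpow (Or.inl (by norm_num)),
    Real.sqrt_eq_rpow]
  norm_num
  ring

lemma integrableOn_exp_neg (s : ℝ) : IntegrableOn (fun t => Real.exp (-t)) (Set.Ioi s) := by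
  simpa using exp_neg_integrableOn_Ioi s one_pos

/-- The three ranges contribute the integrals of `t ^ (-1/2)`, `1 / t` and `exp (-t)`. The logarithm
of the kernel's modulus originates in the middle one. -/
lemma integral_Ioi_le_of_pieces {D : ℝ → ℝ} (hD : IntegrableOn D (Set.Ioi 0)) {s a b c : ℝ}
    (hs : 0 < s) (hs1 : s ≤ 1) (hc : 0 ≤ c) (h1 : ∀ t, 0 < t → t ≤ s → D t ≤ a / √t)
    (h2 : ∀ t, s < t → t ≤ 1 → D t ≤ b / t) (h3 : ∀ t, 1 < t → D t ≤ c * Real.exp (-t)) :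
    ∫ t in Set.Ioi 0, D t ≤ 2 * a * √s - b * Real.log s + c := by
  have e1 : Set.Ioi (0 : ℝ) = Set.Ioc 0 s ∪ (Set.Ioc s 1 ∪ Set.Ioi 1) := by
    rw [Set.Ioc_union_Ioi_eq_Ioi hs1, Set.Ioc_union_Ioi_eq_Ioi hs.le]
  have i1 : IntegrableOn D (Set.Ioc 0 s) := hD.mono_set Set.Ioc_subset_Ioi_self
  have i2 : IntegrableOn D (Set.Ioc s 1) := hD.mono_set fun x hx => hs.trans hx.1
  have i3 : IntegrableOn D (Set.Ioi 1) := hD.mono_set (Set.Ioi_subset_Ioi zero_le_one)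
  rw [e1, setIntegral_union (by
      rw [Set.Ioc_union_Ioi_eq_Ioi hs1]; exact Set.Ioc_disjoint_Ioi le_rfl) (by measurability)
    i1 (i2.union i3), setIntegral_union (Set.Ioc_disjoint_Ioi le_rfl) measurableSet_Ioi i2 i3]
  have j1 : ∫ t in Set.Ioc 0 s, D t ≤ 2 * a * √s := by
    calc _ ≤ ∫ t in Set.Ioc 0 s, a * (1 / √t) :=
          setIntegral_mono_on i1 ((integrableOn_inv_sqrt hs.le).const_mul a) measurableSet_Ioc
            fun t ht => (h1 t ht.1 ht.2).trans_eq (by ring)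
      _ = _ := by rw [integral_const_mul, integral_inv_sqrt hs.le]; ring
  have j2 : ∫ t in Set.Ioc s 1, D t ≤ -(b * Real.log s) := by
    have hint : IntervalIntegrable (fun t : ℝ => 1 / t) volume s 1 :=
      intervalIntegral.intervalIntegrable_one_div (fun x hx => by
        rw [Set.uIcc_of_le hs1] at hx; exact (hs.trans_le hx.1).ne') (by fun_prop)
    calc _ ≤ ∫ t in Set.Ioc s 1, b * (1 / t) :=
          setIntegral_mono_on i2
            (((intervalIntegrable_iff_integrableOn_Ioc_of_le hs1).1 hint).const_mul b)
            measurableSet_Ioc fun t ht => (h2 t ht.1 ht.2).trans_eq (by ring)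
      _ = _ := by
        rw [integral_const_mul, ← intervalIntegral.integral_of_le hs1,
          integral_one_div_of_pos hs one_pos, one_div, Real.log_inv]; ring
  have j3 : ∫ t in Set.Ioi 1, D t ≤ c := by
    calc _ ≤ ∫ t in Set.Ioi 1, c * Real.exp (-t) :=
          setIntegral_mono_on i3 ((integrableOn_exp_neg 1).const_mul c) measurableSet_Ioi
            fun t ht => h3 t ht
      _ = c * Real.exp (-1) := by rw [integral_const_mul, integral_exp_neg_Ioi]
      _ ≤ c := mul_le_of_le_one_right hc (Real.exp_le_one_iff.2 (by norm_num))
  linarith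

lemma aestronglyMeasurable_heatCurl : AEStronglyMeasurable (Function.uncurry heatCurl)
    ((volume.restrict (Set.Ioi (0 : ℝ))).prod volume) := by
  have h := continuousOn_heatCurl.aestronglyMeasurable
    (μ := (volume : Measure ℝ).prod (volume : Measure Torus))
    (measurableSet_Ioi.prod MeasurableSet.univ)
  rwa [← Measure.prod_restrict, Measure.restrict_univ] at h

lemma integrable_heatCurl : Integrable (Function.uncurry heatCurl)
    ((volume.restrict (Set.Ioi (0 : ℝ))).prod volume) := by
  rw [integrable_prod_iff aestronglyMeasurable_heatCurl]
  refine ⟨ae_restrict_of_forall_mem measurableSet_Ioi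
    fun t ht => integrable_torus (continuous_heatCurl ht), ?_⟩
  have hm : AEStronglyMeasurable (fun t => ∫ x, ‖heatCurl t x‖) (volume.restrict (Set.Ioi (0:ℝ))) :=
    aestronglyMeasurable_heatCurl.norm.integral_prod_right'
  obtain ⟨c, hc, hb⟩ := exists_heatCurl_exp_bound
  have e1 : Set.Ioi (0 : ℝ) = Set.Ioc 0 1 ∪ Set.Ioi 1 :=
    (Set.Ioc_union_Ioi_eq_Ioi zero_le_one).symm
  have hnn (t : ℝ) : ‖∫ x, ‖heatCurl t x‖‖ = ∫ x, ‖heatCurl t x‖ :=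
    Real.norm_of_nonneg (integral_nonneg fun x => norm_nonneg _)
  change IntegrableOn (fun t => ∫ x, ‖heatCurl t x‖) (Set.Ioi 0) volume
  rw [e1]
  refine IntegrableOn.union ?_ ?_
  · refine Integrable.mono' ((integrableOn_inv_sqrt zero_le_one).const_mul 4)
      (hm.mono_set Set.Ioc_subset_Ioi_self) (ae_restrict_of_forall_mem measurableSet_Ioc ?_)
    intro t ht
    refine (hnn t).trans_le ((integral_norm_heatCurl_le_sqrt ht.1).trans_eq (by ring))
  · refine Integrable.mono' ((integrableOn_exp_neg 1).const_mul c)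
      (hm.mono_set (Set.Ioi_subset_Ioi zero_le_one))
      (ae_restrict_of_forall_mem measurableSet_Ioi ?_)
    intro t ht
    exact (hnn t).trans_le (hb t (le_of_lt ht)).1

lemma integral_norm_integral_le {α β E : Type*} [MeasurableSpace α] [MeasurableSpace β]
    [NormedAddCommGroup E] [NormedSpace ℝ E] {μ : Measure α} {ν : Measure β} [SFinite μ]
    [SFinite ν] {F : α → β → E} (hF : Integrable (Function.uncurry F) (μ.prod ν)) :
    ∫ x, ‖∫ t, F t x ∂μ‖ ∂ν ≤ ∫ t, ∫ x, ‖F t x‖ ∂ν ∂μ := by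
  rw [integral_integral_swap hF.norm]
  exact integral_mono hF.integral_prod_right.norm hF.norm.integral_prod_right
    fun x => norm_integral_le_integral_norm _

instance isAddHaarMeasure_torus : (volume : Measure Torus).IsAddHaarMeasure :=
  inferInstanceAs ((volume : Measure Circ).prod (volume : Measure Circ)).IsAddHaarMeasure

lemma measurePreserving_add_right_torus (a : Torus) :
    MeasurePreserving (fun x : Torus => x + a) volume volume :=
  measurePreserving_add_right volume a

lemma integrable_biotSavart : Integrable biotSavart := integrable_heatCurl.integral_prod_right

/-- The kernel is log-Lipschitz in `L¹`. -/
lemma exists_biotSavart_translate_le : ∃ C : ℝ, 0 < C ∧ ∀ (a : ℝ × ℝ) (d : ℝ), 0 < d → d ≤ 1 →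
    ∫ x, ‖biotSavart (x + proj a) - biotSavart x‖ ≤ C * (d + ‖a‖ * (1 - Real.log d)) := by
  obtain ⟨c, hc, hb⟩ := exists_heatCurl_exp_bound
  refine ⟨40 + c, by positivity, fun a d hd hd1 => ?_⟩
  set μ := (volume : Measure ℝ).restrict (Set.Ioi 0)
  have hT : MeasurePreserving (Prod.map (id : ℝ → ℝ) (fun x : Torus => x + proj a))
      (μ.prod volume) (μ.prod volume) :=
    (MeasurePreserving.id μ).prod (measurePreserving_add_right_torus _)
  have hI : Integrable (Function.uncurry fun t x => heatCurl t (x + proj a) - heatCurl t x)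
      (μ.prod (volume : Measure Torus)) :=
    (hT.integrable_comp_of_integrable integrable_heatCurl).sub integrable_heatCurl
  have hae : ∀ᵐ x : Torus, Integrable (fun t => heatCurl t x) μ :=
    integrable_heatCurl.prod_left_ae
  have hae2 : ∀ᵐ x : Torus, Integrable (fun t => heatCurl t (x + proj a)) μ :=
    (measurePreserving_add_right_torus (proj a)).quasiMeasurePreserving.ae hae
  calc ∫ x, ‖biotSavart (x + proj a) - biotSavart x‖
      = ∫ x, ‖∫ t, heatCurl t (x + proj a) - heatCurl t x ∂μ‖ := by
        refine integral_congr_ae ?_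
        filter_upwards [hae, hae2] with x h1 h2
        rw [integral_sub h2 h1]; rfl
    _ ≤ ∫ t, (∫ x, ‖heatCurl t (x + proj a) - heatCurl t x‖) ∂μ :=
        integral_norm_integral_le hI
    -- Parabolic scaling: the time ranges are split at `s = d ^ 2`. Before it translation is not
    -- exploited and the two norms are added; after it the difference gains the factor `‖a‖`.
    _ ≤ 2 * 8 * √(d ^ 2) - (20 * ‖a‖) * Real.log (d ^ 2) + c * ‖a‖ := by
        refine integral_Ioi_le_of_pieces hI.norm.integral_prod_left (by positivity)
          (pow_le_one₀ hd.le hd1) (by positivity) ?_ ?_ ?_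
        · intro t ht _
          have hi := integrable_torus (continuous_heatCurl ht)
          have hi2 := (measurePreserving_add_right_torus (proj a)).integrable_comp_of_integrable hi
          calc ∫ x, ‖heatCurl t (x + proj a) - heatCurl t x‖
              ≤ ∫ x, (‖heatCurl t (x + proj a)‖ + ‖heatCurl t x‖) :=
                integral_mono (hi2.sub hi).norm (hi2.norm.add hi.norm) fun x => norm_sub_le _ _
            _ = (∫ x, ‖heatCurl t (x + proj a)‖) + ∫ x, ‖heatCurl t x‖ :=
                integral_add hi2.norm hi.norm
            _ = (∫ x, ‖heatCurl t x‖) + ∫ x, ‖heatCurl t x‖ := by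
                congr 1
                exact integral_add_right_eq_self (μ := (volume : Measure Torus))
                  (fun x => ‖heatCurl t x‖) _
            _ ≤ 4 / √t + 4 / √t := by
                gcongr <;> exact integral_norm_heatCurl_le_sqrt ht
            _ = 8 / √t := by ring
        · intro t ht _
          exact integral_norm_heatCurl_translate_le_div ((sq_nonneg d).trans_lt ht) a
        · intro t ht
          exact (hb t (le_of_lt ht)).2 a
    _ ≤ _ := by
        rw [Real.sqrt_sq hd.le, Real.log_pow]
        have hl : 0 ≤ -Real.log d := by
          have := Real.log_nonpos hd.le hd1; linarith
        have hn := norm_nonneg a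
        push_cast
        nlinarith [mul_nonneg hn hl, mul_nonneg hc (mul_nonneg hn hl), mul_nonneg hc hd.le]

/-! ### The kernel `K` agrees almost everywhere with its time integral -/

lemma tsum_exp_mul_fourier {t : ℝ} (ht : 0 < t) (x : Circ) :
    ∑' n : ℤ, ((Real.exp (-((n : ℝ) ^ 2 * t)) : ℝ) : ℂ) * fourier n x = (theta t x : ℂ) := by
  have hs : Summable fun n : ℤ => ((Real.exp (-((n : ℝ) ^ 2 * t)) : ℝ) : ℂ) * fourier n x := by
    refine Summable.of_norm_bounded (summable_exp_neg_sq ht) fun n => ?_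
    rw [norm_mul, fourier_apply, Circle.norm_coe, mul_one, Complex.norm_real, Real.norm_eq_abs,
      abs_of_pos (Real.exp_pos _)]
  apply Complex.ext
  · rw [Complex.re_tsum hs, Complex.ofReal_re]
    simp only [theta, Complex.re_ofReal_mul]
  · rw [Complex.im_tsum hs, Complex.ofReal_im]
    -- The imaginary parts are odd in `n`, so their sum equals its own negative.
    have h : ∑' n : ℤ, (((Real.exp (-((n : ℝ) ^ 2 * t)) : ℝ) : ℂ) * fourier n x).im =
        -∑' n : ℤ, (((Real.exp (-((n : ℝ) ^ 2 * t)) : ℝ) : ℂ) * fourier n x).im := by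
      rw [← tsum_neg]
      conv_lhs => rw [← (Equiv.neg ℤ).tsum_eq]
      congr 1; funext n
      rw [Equiv.neg_apply, fourier_neg, Complex.im_ofReal_mul, Complex.im_ofReal_mul,
        Complex.conj_im]
      push_cast
      rw [neg_sq, mul_neg]
    linarith

/-- The full double series factors; the subtracted `1` is the excluded mode `k = 0`. -/
lemma heatKernel_eq {t : ℝ} (ht : 0 < t) (x : Torus) :
    heatKernel t x = ((2 * Real.pi) ^ 2)⁻¹ * (theta t x.1 * theta t x.2 - 1) := by
  have hn (x : Circ) : Summable fun n : ℤ =>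
      ‖((Real.exp (-((n : ℝ) ^ 2 * t)) : ℝ) : ℂ) * fourier n x‖ := by
    refine (summable_exp_neg_sq ht).congr fun n => ?_
    rw [norm_mul, fourier_apply, Circle.norm_coe, mul_one, Complex.norm_real, Real.norm_eq_abs,
      abs_of_pos (Real.exp_pos _)]
  have hmul := tsum_mul_tsum_of_summable_norm (hn x.1) (hn x.2)
  have hsum := summable_mul_of_summable_norm (hn x.1) (hn x.2)
  rw [tsum_exp_mul_fourier ht, tsum_exp_mul_fourier ht] at hmul
  have hterm (k : ℤ × ℤ) : ((Real.exp (-((k.1 : ℝ) ^ 2 * t)) : ℝ) : ℂ) * fourier k.1 x.1 *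
      (((Real.exp (-((k.2 : ℝ) ^ 2 * t)) : ℝ) : ℂ) * fourier k.2 x.2) =
      ((Real.exp (-(((k.1 : ℝ) ^ 2 + (k.2 : ℝ) ^ 2) * t)) : ℝ) : ℂ) * character k x := by
    rw [add_mul, neg_add, Real.exp_add, character]
    push_cast
    ring
  simp_rw [hterm] at hmul hsum
  have hre := congrArg Complex.re hmul
  rw [Complex.re_tsum hsum, ← Complex.ofReal_mul, Complex.ofReal_re] at hre
  have hsum' := Complex.reCLM.summable hsum
  simp only [Complex.reCLM_apply, Complex.re_ofReal_mul] at hre hsum'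
  rw [hre, ← hsum'.sum_add_tsum_subtype_compl {0}, Finset.sum_singleton, heatKernel,
    add_sub_assoc, add_comm, ← add_sub_right_comm, ← (Equiv.subtypeEquivRight
      (fun k : ℤ × ℤ => (Finset.mem_singleton (a := (0 : ℤ × ℤ)) (b := k)).not)).tsum_eq]
  simp [character]

/-- The factor `exp (-‖p‖² / (8 t))` beats the growth `t ^ (-2)` of the bound for `theta`. The
surplus `t ^ 2` is what later compensates `thetaBound`. -/
lemma exists_theta_le_sq {p : Circ} (hp : p ≠ 0) :
    ∃ D : ℝ, 0 ≤ D ∧ ∀ t, 0 < t → t ≤ 1 → theta t p ≤ D * t ^ 2 := by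
  obtain ⟨c, hc, hb⟩ := exists_thetaBound_le
  have hr : 0 < ‖p‖ := norm_pos_iff.2 hp
  set r := ‖p‖
  refine ⟨2 * (24 * (8 / r ^ 2) ^ 4) * (1 + c), by positivity, fun t ht ht1 => ?_⟩
  have h2t : 0 < 2 * t := by positivity
  have h1 : theta (2 * t) p ≤ (1 + c) / t ^ 2 := by
    have h := (abs_le.1 (abs_theta_sub_one_le h2t p)).2
    have h2 := hb _ h2t
    have h3 : c / (2 * t) ^ 2 ≤ c / t ^ 2 := by gcongr; linarith
    have h4 : 1 ≤ 1 / t ^ 2 := by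
      rw [le_div_iff₀ (by positivity)]; nlinarith
    rw [add_div]; linarith
  have h2 : Real.exp (-(r ^ 2 / (8 * t))) ≤ 24 * (8 / r ^ 2) ^ 4 * t ^ 4 := by
    -- The fourth Taylor term gives `t ^ 4`, of which two powers remain after division by `t ^ 2`.
    have h := Real.pow_div_factorial_le_exp (x := r ^ 2 / (8 * t)) (by positivity) 4
    rw [Real.exp_neg]
    refine (inv_anti₀ (by positivity) h).trans_eq ?_
    norm_num [Nat.factorial]
    field_simp
  calc theta t p ≤ 2 * Real.exp (-(r ^ 2 / (8 * t))) * theta (2 * t) p := theta_le_exp_mul ht p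
    _ ≤ 2 * (24 * (8 / r ^ 2) ^ 4 * t ^ 4) * ((1 + c) / t ^ 2) := by
        gcongr
        exact theta_nonneg h2t p
    _ = _ := by field_simp

/-- Supplies the integrable majorant `M exp (-t)` for differentiating the Green function under the
integral: near `t = 0` the factor at `p ≠ 0` is small, for `t ≥ 1` the spectral gap acts. The bounds
are uniform in the other coordinate. -/
lemma exists_theta_mul_bound {p : Circ} (hp : p ≠ 0) : ∃ M : ℝ, ∀ t, 0 < t →
    theta t p * thetaBound t ≤ M * Real.exp (-t) ∧
    ∀ q, |theta t p * theta t q - 1| ≤ M * Real.exp (-t) := by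
  obtain ⟨c, hc, hb⟩ := exists_thetaBound_le
  obtain ⟨D, hD, hth⟩ := exists_theta_le_sq hp
  set B := thetaBound 1 * Real.exp 1
  have hB : 0 ≤ B := mul_nonneg (thetaBound_nonneg _) (Real.exp_pos _).le
  refine ⟨(D * (1 + c) + 1) * Real.exp 1 + (2 + B) * B, fun t ht => ?_⟩
  have hθ0 := theta_nonneg ht p
  have hB0 := thetaBound_nonneg t
  rcases le_total t 1 with h1 | h1
  · have he : 1 ≤ Real.exp 1 * Real.exp (-t) := by
      rw [← Real.exp_add]; exact Real.one_le_exp (by linarith)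
    have hM : D * (1 + c) + 1 ≤
        ((D * (1 + c) + 1) * Real.exp 1 + (2 + B) * B) * Real.exp (-t) := by
      have h2 : 0 ≤ (2 + B) * B * Real.exp (-t) := by positivity
      have h3 : 0 ≤ D * (1 + c) + 1 := by positivity
      nlinarith
    have hp2 : theta t p * (c / t ^ 2) ≤ D * c := by
      calc theta t p * (c / t ^ 2) ≤ D * t ^ 2 * (c / t ^ 2) := by
            gcongr; exact hth t ht h1
        _ = D * c := by field_simp
    have hp3 : theta t p * thetaBound t ≤ D * c :=
      (mul_le_mul_of_nonneg_left (hb t ht) hθ0).trans hp2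
    refine ⟨by nlinarith, fun q => le_trans ?_ hM⟩
    have hq := abs_le.1 (abs_theta_sub_one_le ht q)
    have hq0 := theta_nonneg ht q
    have h4 : theta t p ≤ D := (hth t ht h1).trans (by nlinarith [pow_le_one₀ (n := 2) ht.le h1])
    have h5 : theta t p * theta t q ≤ theta t p * (1 + thetaBound t) := by
      gcongr; linarith
    rw [abs_le]
    constructor
    · have := mul_nonneg hθ0 hq0
      have : 0 ≤ D * (1 + c) := by positivity
      linarith
    · nlinarith
  · have hdec : thetaBound t ≤ B * Real.exp (-t) := by
      refine (thetaBound_decay one_pos h1).trans_eq ?_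
      rw [neg_sub, sub_eq_add_neg, Real.exp_add]; ring
    have he : Real.exp (-t) ≤ 1 := Real.exp_le_one_iff.2 (by linarith)
    have hBB : thetaBound t ≤ B := hdec.trans (mul_le_of_le_one_right hB he)
    have hpp := abs_le.1 (abs_theta_sub_one_le ht p)
    have hM : (2 + B) * (B * Real.exp (-t)) ≤
        ((D * (1 + c) + 1) * Real.exp 1 + (2 + B) * B) * Real.exp (-t) := by
      have : 0 ≤ (D * (1 + c) + 1) * Real.exp 1 * Real.exp (-t) := by positivity
      linarith
    have hb2 : (2 + B) * thetaBound t ≤ (2 + B) * (B * Real.exp (-t)) := by gcongr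
    refine ⟨?_, fun q => ?_⟩
    · refine le_trans ?_ (hb2.trans hM)
      gcongr
      linarith
    · refine le_trans ?_ (hb2.trans hM)
      have e : theta t p * theta t q - 1 = (theta t p - 1) + theta t p * (theta t q - 1) := by ring
      rw [e]
      refine (abs_add_le _ _).trans ?_
      rw [abs_mul, abs_of_nonneg hθ0]
      have h6 : theta t p * |theta t q - 1| ≤ (1 + B) * thetaBound t := by
        gcongr
        · linarith
        · exact abs_theta_sub_one_le ht q
      have := abs_theta_sub_one_le ht p
      linarith

lemma continuousOn_time_slice {f : ℝ → Circ → ℝ}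
    (h : ContinuousOn (fun p : ℝ × Circ => f p.1 p.2) (Set.Ioi 0 ×ˢ Set.univ)) (x : Circ) :
    ContinuousOn (fun t => f t x) (Set.Ioi 0) :=
  h.comp (f := fun t => (t, x)) (by fun_prop) fun _ ht => ⟨ht, Set.mem_univ _⟩

/-- Only the factor in `q` moves. The fixed factor at `p ≠ 0` tames the singularity at `t = 0`, so
`q = 0` is allowed. -/
lemma hasDerivAt_integral_theta_mul {p : Circ} (hp : p ≠ 0) (q : Circ) :
    HasDerivAt (fun h : ℝ => ∫ t in Set.Ioi (0 : ℝ), (theta t p * theta t (q + (h : Circ)) - 1))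
      (∫ t in Set.Ioi (0 : ℝ), theta t p * thetaDeriv t q) 0 := by
  obtain ⟨M, hM⟩ := exists_theta_mul_bound hp
  have c0 := continuousOn_time_slice continuousOn_theta
  have c1 := continuousOn_time_slice continuousOn_thetaDeriv
  have hmeas (h : ℝ) : AEStronglyMeasurable
      (fun t => theta t p * theta t (q + (h : Circ)) - 1) (volume.restrict (Set.Ioi (0 : ℝ))) :=
    (((c0 p).mul (c0 _)).sub continuousOn_const).aestronglyMeasurable measurableSet_Ioi
  have hmain := hasDerivAt_integral_of_dominated_loc_of_deriv_le
    (μ := volume.restrict (Set.Ioi (0 : ℝ))) (x₀ := (0 : ℝ)) (s := Set.univ)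
    (F := fun (h : ℝ) t => theta t p * theta t (q + (h : Circ)) - 1)
    (F' := fun (h : ℝ) t => theta t p * thetaDeriv t (q + (h : Circ)))
    (bound := fun t => M * Real.exp (-t)) Filter.univ_mem
    (Filter.Eventually.of_forall hmeas) ?_ ?_ ?_ ?_ ?_
  · simpa using hmain.2
  · refine Integrable.mono' ((integrableOn_exp_neg 0).const_mul M) (hmeas 0)
      (ae_restrict_of_forall_mem measurableSet_Ioi fun t ht => ?_)
    exact (hM t ht).2 _
  · exact ((c0 p).mul (c1 _)).aestronglyMeasurable measurableSet_Ioi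
  · refine ae_restrict_of_forall_mem measurableSet_Ioi fun t ht h _ => ?_
    rw [norm_mul, Real.norm_eq_abs, Real.norm_eq_abs, abs_of_nonneg (theta_nonneg ht p)]
    exact (mul_le_mul_of_nonneg_left (abs_thetaDeriv_le ht _) (theta_nonneg ht p)).trans (hM t ht).1
  · exact (integrableOn_exp_neg 0).const_mul M
  · refine ae_restrict_of_forall_mem measurableSet_Ioi fun t ht h _ => ?_
    revert q
    refine circ_forall fun q _ => ?_
    simp only [← AddCircle.coe_add]
    exact (((hasDerivAt_theta ht (q + h)).comp_const_add q h).const_mul _).sub_const 1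

lemma hasDerivAt_greenFunction_snd {x : Torus} (hx : x.1 ≠ 0) :
    HasDerivAt (fun h : ℝ => greenFunction (x + proj (0, h)))
      (-∫ t in Set.Ioi (0 : ℝ), (heatCurl t x).1) 0 := by
  have h := ((hasDerivAt_integral_theta_mul hx x.2).const_mul ((2 * Real.pi) ^ 2)⁻¹).fun_neg
  simp only [← integral_const_mul] at h
  refine (h.congr_of_eventuallyEq (Filter.Eventually.of_forall fun y => ?_))
  simp only [greenFunction]
  congr 1
  refine setIntegral_congr_fun measurableSet_Ioi fun t ht => ?_
  simp [heatKernel_eq ht, proj]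

lemma hasDerivAt_greenFunction_fst {x : Torus} (hx : x.2 ≠ 0) :
    HasDerivAt (fun h : ℝ => greenFunction (x + proj (h, 0)))
      (∫ t in Set.Ioi (0 : ℝ), (heatCurl t x).2) 0 := by
  have h := ((hasDerivAt_integral_theta_mul hx x.1).const_mul ((2 * Real.pi) ^ 2)⁻¹).fun_neg
  simp only [← integral_const_mul] at h
  refine (h.congr_of_eventuallyEq (Filter.Eventually.of_forall fun y => ?_)).congr_deriv ?_
  · simp only [greenFunction]
    congr 1
    refine setIntegral_congr_fun measurableSet_Ioi fun t ht => ?_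
    simp [heatKernel_eq ht, proj, mul_comm (theta t (x.2))]
  · rw [← integral_neg]
    congr 1; funext t
    simp only [heatCurl, Prod.smul_mk, smul_eq_mul]
    ring

lemma ae_circ_ne_zero : ∀ᵐ x : Circ, x ≠ 0 := by
  have h : (volume : Measure Circ) {0} = 0 := by
    rw [← Metric.closedBall_zero, AddCircle.volume_closedBall]
    simp [Real.pi_pos.le]
  simpa [ae_iff] using h

/-- The two partial derivatives are computed off the two coordinate circles, a null set. This
suffices because `K` is only ever integrated along measure preserving maps. -/
lemma kernelK_ae_eq : kernelK =ᵐ[volume] biotSavart := by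
  have h1 : ∀ᵐ x : Torus, x.1 ≠ 0 :=
    (Measure.quasiMeasurePreserving_fst (μ := (volume : Measure Circ))
      (ν := (volume : Measure Circ))).ae ae_circ_ne_zero
  have h2 : ∀ᵐ x : Torus, x.2 ≠ 0 :=
    (Measure.quasiMeasurePreserving_snd (μ := (volume : Measure Circ))
      (ν := (volume : Measure Circ))).ae ae_circ_ne_zero
  have h3 : ∀ᵐ x : Torus, IntegrableOn (fun t => heatCurl t x) (Set.Ioi (0 : ℝ)) :=
    integrable_heatCurl.prod_left_ae
  filter_upwards [h1, h2, h3] with x hx1 hx2 hx3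
  rw [kernelK, (hasDerivAt_greenFunction_snd hx1).deriv, (hasDerivAt_greenFunction_fst hx2).deriv,
    neg_neg, biotSavart]
  exact Prod.ext (fst_integral hx3).symm (snd_integral hx3).symm

lemma integrable_kernelK : Integrable kernelK := integrable_biotSavart.congr kernelK_ae_eq.symm

lemma exists_kernelK_translate_le : ∃ C : ℝ, 0 < C ∧ ∀ (a : ℝ × ℝ) (d : ℝ), 0 < d → d ≤ 1 →
    ∫ x, ‖kernelK (x + proj a) - kernelK x‖ ≤ C * (d + ‖a‖ * (1 - Real.log d)) := by
  obtain ⟨C, hC, h⟩ := exists_biotSavart_translate_le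
  refine ⟨C, hC, fun a d hd hd1 => (integral_congr_ae ?_).trans_le (h a d hd hd1)⟩
  have h2 := (measurePreserving_add_right_torus (proj a)).quasiMeasurePreserving.ae kernelK_ae_eq
  filter_upwards [kernelK_ae_eq, h2] with x hx1 hx2
  rw [hx1, hx2]

/-! ### Approximation of the kernel by finite sums of shear modes -/

/-- The shear flow `sin (k · x) k^⊥`. -/
noncomputable def shearMode (k : ℤ × ℤ) (x : Torus) : ℝ × ℝ :=
  (character k x).im • (-(k.2 : ℝ), (k.1 : ℝ))

lemma continuous_character (k : ℤ × ℤ) : Continuous (character k) := by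
  unfold character
  have h1 := (fourier (T := 2 * Real.pi) k.1).continuous
  have h2 := (fourier (T := 2 * Real.pi) k.2).continuous
  fun_prop

lemma continuous_character_im (k : ℤ × ℤ) : Continuous fun x => (character k x).im :=
  Complex.continuous_im.comp (continuous_character k)

lemma continuous_shearMode (k : ℤ × ℤ) : Continuous (shearMode k) := by
  have := continuous_character_im k
  unfold shearMode
  fun_prop

/-- Partial sums of the theta function. -/
noncomputable def thetaPartial (N : ℕ) (t : ℝ) (x : Circ) : ℝ :=
  ∑ n ∈ Finset.Icc (-(N : ℤ)) N, Real.exp (-((n : ℝ) ^ 2 * t)) * (fourier n x).re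

/-- Partial sums of the derivative of the theta function. -/
noncomputable def thetaDerivPartial (N : ℕ) (t : ℝ) (x : Circ) : ℝ :=
  ∑ n ∈ Finset.Icc (-(N : ℤ)) N, -((n : ℝ) * Real.exp (-((n : ℝ) ^ 2 * t)) * (fourier n x).im)

lemma sum_Icc_eq_zero_of_odd (N : ℕ) {f : ℤ → ℝ} (hf : ∀ n, f (-n) = -f n) :
    ∑ n ∈ Finset.Icc (-(N : ℤ)) N, f n = 0 := by
  have h : ∑ n ∈ Finset.Icc (-(N : ℤ)) N, f n = ∑ n ∈ Finset.Icc (-(N : ℤ)) N, f (-n) := by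
    refine Finset.sum_nbij' (fun n => -n) (fun n => -n) ?_ ?_ ?_ ?_ ?_ <;> intro n hn
    · rw [Finset.mem_Icc] at hn ⊢; omega
    · rw [Finset.mem_Icc] at hn ⊢; omega
    · simp
    · simp
    · simp
  simp only [hf, Finset.sum_neg_distrib] at h
  linarith

lemma sum_odd_im (N : ℕ) (t : ℝ) (x : Circ) : ∑ n ∈ Finset.Icc (-(N : ℤ)) N,
    Real.exp (-((n : ℝ) ^ 2 * t)) * (fourier n x).im = 0 := by
  refine sum_Icc_eq_zero_of_odd N fun n => ?_
  rw [fourier_neg, Complex.conj_im]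
  push_cast
  rw [neg_sq]; ring

/-- The addition formula for `sin (k · x)` yields two products. One is the product of partial sums
wanted here; the other contains a sum over a symmetric range of terms odd in the index and vanishes,
so it may be added freely. -/
lemma partial_eq_sum_shearMode (N : ℕ) (t : ℝ) (x : Torus) :
    ((thetaPartial N t x.1 * thetaDerivPartial N t x.2,
      -(thetaDerivPartial N t x.1 * thetaPartial N t x.2)) : ℝ × ℝ) =
    ∑ k ∈ Finset.Icc (-(N : ℤ)) N ×ˢ Finset.Icc (-(N : ℤ)) N,
      Real.exp (-(((k.1 : ℝ) ^ 2 + (k.2 : ℝ) ^ 2) * t)) • shearMode k x := by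
  rw [Prod.ext_iff, Prod.fst_sum, Prod.snd_sum]
  constructor
  · have h : thetaPartial N t x.1 * thetaDerivPartial N t x.2 =
        thetaPartial N t x.1 * thetaDerivPartial N t x.2 -
        (∑ n ∈ Finset.Icc (-(N : ℤ)) N, Real.exp (-((n : ℝ) ^ 2 * t)) * (fourier n x.1).im) *
        ∑ n ∈ Finset.Icc (-(N : ℤ)) N,
          (n : ℝ) * Real.exp (-((n : ℝ) ^ 2 * t)) * (fourier n x.2).re := by
      rw [sum_odd_im, zero_mul, sub_zero]
    refine h.trans ?_
    rw [thetaPartial, thetaDerivPartial, Finset.sum_mul_sum, Finset.sum_mul_sum,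
      ← Finset.sum_product', ← Finset.sum_product', ← Finset.sum_sub_distrib]
    refine Finset.sum_congr rfl fun k _ => ?_
    simp only [shearMode, character, Prod.smul_mk, smul_eq_mul, Complex.mul_im]
    rw [add_mul, neg_add, Real.exp_add]
    ring
  · have h : -(thetaDerivPartial N t x.1 * thetaPartial N t x.2) =
        -(thetaDerivPartial N t x.1 * thetaPartial N t x.2) +
        (∑ n ∈ Finset.Icc (-(N : ℤ)) N,
          (n : ℝ) * Real.exp (-((n : ℝ) ^ 2 * t)) * (fourier n x.1).re) *
        ∑ n ∈ Finset.Icc (-(N : ℤ)) N, Real.exp (-((n : ℝ) ^ 2 * t)) * (fourier n x.2).im := by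
      rw [sum_odd_im, mul_zero, add_zero]
    refine h.trans ?_
    rw [thetaPartial, thetaDerivPartial, Finset.sum_mul_sum, Finset.sum_mul_sum,
      ← Finset.sum_product', ← Finset.sum_product', ← Finset.sum_neg_distrib,
      ← Finset.sum_add_distrib]
    refine Finset.sum_congr rfl fun k _ => ?_
    simp only [shearMode, character, Prod.smul_mk, smul_eq_mul, Complex.mul_im]
    rw [add_mul, neg_add, Real.exp_add]
    ring

/-- The tail of `thetaBound`. -/
noncomputable def thetaTail (N : ℕ) (t : ℝ) : ℝ :=
  ∑' n : {n : ℤ // n ∉ Finset.Icc (-(N : ℤ)) N},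
    ((n : ℤ) : ℝ) ^ 2 * Real.exp (-(((n : ℤ) : ℝ) ^ 2 * t))

lemma thetaTail_nonneg (N : ℕ) (t : ℝ) : 0 ≤ thetaTail N t := tsum_nonneg fun n => by positivity

lemma summable_thetaTail (N : ℕ) {t : ℝ} (ht : 0 < t) :
    Summable fun n : {n : ℤ // n ∉ Finset.Icc (-(N : ℤ)) N} =>
      ((n : ℤ) : ℝ) ^ 2 * Real.exp (-(((n : ℤ) : ℝ) ^ 2 * t)) :=
  (summable_sq_mul_exp ht).subtype {n : ℤ | n ∉ Finset.Icc (-(N : ℤ)) N}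

lemma thetaTail_decay (N : ℕ) {e t : ℝ} (he : 0 < e) (het : e ≤ t) :
    thetaTail N t ≤ Real.exp (-(t - e)) * thetaTail N e := by
  unfold thetaTail
  rw [← tsum_mul_left]
  exact Summable.tsum_le_tsum (fun n => sq_mul_exp_decay het n)
    (summable_thetaTail N (he.trans_le het)) ((summable_thetaTail N he).mul_left _)

lemma exists_thetaTail_le {e η : ℝ} (he : 0 < e) (hη : 0 < η) : ∃ N, thetaTail N e ≤ η := by
  have hs := summable_sq_mul_exp he
  have h0 := hs.hasSum
  rw [HasSum, SummationFilter.unconditional_filter] at h0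
  have h1 : ∀ᶠ s : Finset ℤ in Filter.atTop, thetaBound e - η < ∑ n ∈ s,
      (n : ℝ) ^ 2 * Real.exp (-((n : ℝ) ^ 2 * e)) :=
    h0.eventually (lt_mem_nhds (sub_lt_self _ hη))
  obtain ⟨s, hs1⟩ := h1.exists
  obtain ⟨N, hN⟩ : ∃ N : ℕ, ∀ n ∈ s, n.natAbs ≤ N :=
    ⟨s.sup Int.natAbs, fun n hn => Finset.le_sup (f := Int.natAbs) hn⟩
  refine ⟨N, ?_⟩
  have h2 := hs.sum_add_tsum_subtype_compl (Finset.Icc (-(N : ℤ)) N)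
  have h3 : ∑ n ∈ s, (n : ℝ) ^ 2 * Real.exp (-((n : ℝ) ^ 2 * e)) ≤
      ∑ n ∈ Finset.Icc (-(N : ℤ)) N, (n : ℝ) ^ 2 * Real.exp (-((n : ℝ) ^ 2 * e)) := by
    refine Finset.sum_le_sum_of_subset_of_nonneg (fun n hn => ?_) fun n _ _ => by positivity
    have := hN n hn
    rw [Finset.mem_Icc]; omega
  unfold thetaTail
  unfold thetaBound at hs1
  linarith

lemma abs_thetaDeriv_sub_partial_le (N : ℕ) {t : ℝ} (ht : 0 < t) (x : Circ) :
    |thetaDeriv t x - thetaDerivPartial N t x| ≤ thetaTail N t := by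
  rw [thetaDeriv, ← (summable_thetaDeriv ht x).sum_add_tsum_subtype_compl
    (Finset.Icc (-(N : ℤ)) N), thetaDerivPartial, add_sub_cancel_left, ← Real.norm_eq_abs]
  exact tsum_of_norm_bounded (summable_thetaTail N ht).hasSum fun n => abs_deriv_term_le t n x

lemma abs_theta_sub_partial_le (N : ℕ) {t : ℝ} (ht : 0 < t) (x : Circ) :
    |theta t x - thetaPartial N t x| ≤ thetaTail N t := by
  rw [theta, ← (summable_theta ht x).sum_add_tsum_subtype_compl
    (Finset.Icc (-(N : ℤ)) N), thetaPartial, add_sub_cancel_left, ← Real.norm_eq_abs]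
  refine tsum_of_norm_bounded (summable_thetaTail N ht).hasSum fun n => ?_
  have hn : (n : ℤ) ≠ 0 := by
    rintro h
    have := n.2
    rw [h] at this
    simp at this
  have : (1 : ℝ) ≤ ((n : ℤ) : ℝ) ^ 2 := by
    have := Int.one_le_abs hn
    have h2 : (1 : ℝ) ≤ |((n : ℤ) : ℝ)| := by exact_mod_cast this
    exact h2.trans (abs_le_sq_int n)
  rw [norm_mul, Real.norm_eq_abs, Real.norm_eq_abs, abs_of_pos (Real.exp_pos _), mul_comm]
  gcongr
  exact (abs_fourier_re_le n x).trans this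

/-- The `N`-th partial sum of `heatCurl`. -/
noncomputable def heatCurlPartial (N : ℕ) (t : ℝ) (x : Torus) : ℝ × ℝ :=
  ((2 * Real.pi) ^ 2)⁻¹ • (thetaPartial N t x.1 * thetaDerivPartial N t x.2,
    -(thetaDerivPartial N t x.1 * thetaPartial N t x.2))

/-- The tail has no constant mode either, so smallness at time `e` persists with an exponential
factor and is integrable over all later times. -/
lemma norm_heatCurl_sub_partial_le (N : ℕ) {e t : ℝ} (he : 0 < e) (het : e ≤ t)
    (hN : thetaTail N e ≤ 1) (x : Torus) :
    ‖heatCurl t x - heatCurlPartial N t x‖ ≤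
      ((2 * Real.pi) ^ 2)⁻¹ * (4 * (1 + thetaBound e)) *
        (Real.exp (-(t - e)) * thetaTail N e) := by
  have ht : 0 < t := he.trans_le het
  set τ := thetaTail N t
  have hτ0 : 0 ≤ τ := thetaTail_nonneg N t
  have hτ : τ ≤ Real.exp (-(t - e)) * thetaTail N e := thetaTail_decay N he het
  have hexp : Real.exp (-(t - e)) ≤ 1 := Real.exp_le_one_iff.2 (by linarith)
  have hτ1 : τ ≤ 1 := hτ.trans (mul_le_one₀ hexp (thetaTail_nonneg N e) hN)
  have hS0 := thetaBound_nonneg e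
  have hS : thetaBound t ≤ thetaBound e :=
    (thetaBound_decay he het).trans (mul_le_of_le_one_left hS0 hexp)
  have key (p q : Circ) : |theta t p * thetaDeriv t q - thetaPartial N t p * thetaDerivPartial N t q|
      ≤ 2 * (1 + thetaBound e) * τ := by
    have e1 : theta t p * thetaDeriv t q - thetaPartial N t p * thetaDerivPartial N t q =
        (theta t p - thetaPartial N t p) * thetaDeriv t q +
        thetaPartial N t p * (thetaDeriv t q - thetaDerivPartial N t q) := by ring
    have h1 := abs_theta_sub_partial_le N ht p
    have h2 := abs_thetaDeriv_sub_partial_le N ht q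
    have h3 := (abs_thetaDeriv_le ht q).trans hS
    have h4 : |thetaPartial N t p| ≤ 2 + thetaBound e := by
      have h5 := abs_le.1 (abs_theta_sub_one_le ht p)
      have h6 := abs_le.1 h1
      rw [abs_le]; constructor <;> linarith [h5.1, h5.2, h6.1, h6.2]
    rw [e1]
    calc _ ≤ |theta t p - thetaPartial N t p| * |thetaDeriv t q| +
          |thetaPartial N t p| * |thetaDeriv t q - thetaDerivPartial N t q| := by
          rw [← abs_mul, ← abs_mul]; exact abs_add_le _ _
      _ ≤ τ * thetaBound e + (2 + thetaBound e) * τ := by gcongr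
      _ = _ := by ring
  rw [heatCurl, heatCurlPartial, ← smul_sub, Prod.mk_sub_mk]
  refine (norm_smul_pair_le (by positivity)).trans ?_
  rw [mul_assoc]
  gcongr
  have k2 := key x.2 x.1
  rw [← abs_neg] at k2
  have k3 : -(thetaDeriv t x.1 * theta t x.2) - -(thetaDerivPartial N t x.1 * thetaPartial N t x.2)
    = -(theta t x.2 * thetaDeriv t x.1 - thetaPartial N t x.2 * thetaDerivPartial N t x.1) := by
    ring
  rw [k3]
  calc _ ≤ 2 * (1 + thetaBound e) * τ + 2 * (1 + thetaBound e) * τ := add_le_add (key _ _) k2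
    _ = 4 * (1 + thetaBound e) * τ := by ring
    _ ≤ _ := by gcongr

lemma volume_real_torus : (volume : Measure Torus).real Set.univ = (2 * Real.pi) ^ 2 := by
  have h : (volume : Measure Torus) Set.univ =
      (volume : Measure Circ) Set.univ * (volume : Measure Circ) Set.univ := by
    rw [← Set.univ_prod_univ]
    exact Measure.prod_prod _ _
  rw [Measure.real, h, ENNReal.toReal_mul, ← Measure.real, volume_real_circ, sq]

lemma shearMode_zero : shearMode 0 = 0 := by
  funext x; simp [shearMode]

lemma heatCurlPartial_eq (N : ℕ) (t : ℝ) (x : Torus) : heatCurlPartial N t x =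
    ∑ k ∈ (Finset.Icc (-(N : ℤ)) N ×ˢ Finset.Icc (-(N : ℤ)) N).erase 0,
      (((2 * Real.pi) ^ 2)⁻¹ * Real.exp (-(((k.1 : ℝ) ^ 2 + (k.2 : ℝ) ^ 2) * t))) •
        shearMode k x := by
  rw [heatCurlPartial, partial_eq_sum_shearMode, Finset.smul_sum]
  rw [Finset.sum_erase _ (by simp [shearMode_zero])]
  simp only [smul_smul]

lemma sq_add_sq_pos {k : ℤ × ℤ} (hk : k ≠ 0) : 0 < (k.1 : ℝ) ^ 2 + (k.2 : ℝ) ^ 2 := by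
  by_contra! h
  have h1 : (k.1 : ℝ) = 0 := by nlinarith [sq_nonneg (k.1 : ℝ), sq_nonneg (k.2 : ℝ)]
  have h2 : (k.2 : ℝ) = 0 := by nlinarith [sq_nonneg (k.1 : ℝ), sq_nonneg (k.2 : ℝ)]
  exact hk (Prod.ext (by exact_mod_cast h1) (by exact_mod_cast h2))

/-- The kernel can be approximated in `L¹` by finite sums of shear modes. -/
lemma exists_shearMode_approx {η : ℝ} (hη : 0 < η) :
    ∃ (F : Finset (ℤ × ℤ)) (c : ℤ × ℤ → ℝ),
      ∫ x, ‖kernelK x - ∑ k ∈ F, c k • shearMode k x‖ ≤ η := by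
  -- Chosen so that the times up to `e` contribute at most `8 √e = η / 2`.
  set e : ℝ := (η / 16) ^ 2
  have he : 0 < e := by positivity
  obtain ⟨N, hN⟩ := exists_thetaTail_le he
    (η := min 1 (η / 2 / (4 * (1 + thetaBound e)))) (by
      have := thetaBound_nonneg e
      exact lt_min one_pos (by positivity))
  have hS0 := thetaBound_nonneg e
  have hN1 : thetaTail N e ≤ 1 := hN.trans (min_le_left _ _)
  have hN2 : (4 * (1 + thetaBound e)) * thetaTail N e ≤ η / 2 := by
    have := hN.trans (min_le_right _ _)
    rw [le_div_iff₀ (by positivity)] at this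
    linarith
  -- The mode `0` carries no velocity, but its coefficient would not be integrable in time.
  set F := (Finset.Icc (-(N : ℤ)) N ×ˢ Finset.Icc (-(N : ℤ)) N).erase 0
  -- The times before `e` are discarded and the rest is truncated in frequency; integration in time
  -- then leaves finitely many modes with constant coefficients.
  let f : ℤ × ℤ → ℝ → ℝ := fun k => (Set.Ioi e).indicator fun t =>
    ((2 * Real.pi) ^ 2)⁻¹ * Real.exp (-(((k.1 : ℝ) ^ 2 + (k.2 : ℝ) ^ 2) * t))
  set μ := (volume : Measure ℝ).restrict (Set.Ioi 0)
  have hf : ∀ k ∈ F, Integrable (f k) μ := by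
    intro k hk
    have h1 := exp_neg_integrableOn_Ioi e (sq_add_sq_pos (Finset.ne_of_mem_erase hk))
    refine Integrable.mono_measure ?_ Measure.restrict_le_self
    rw [integrable_indicator_iff measurableSet_Ioi]
    refine Integrable.const_mul ?_ _
    simp only [neg_mul] at h1
    exact h1
  have hH : ∀ k ∈ F, Integrable (fun z : ℝ × Torus => f k z.1 • shearMode k z.2)
      (μ.prod volume) := fun k hk =>
    (hf k hk).smul_prod (integrable_torus (continuous_shearMode k))
  have hHs : Integrable (Function.uncurry fun t x => ∑ k ∈ F, f k t • shearMode k x)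
      (μ.prod (volume : Measure Torus)) := integrable_finsetSum _ hH
  have hI : Integrable (Function.uncurry fun t x => heatCurl t x - ∑ k ∈ F, f k t • shearMode k x)
      (μ.prod (volume : Measure Torus)) := integrable_heatCurl.sub hHs
  have hae : ∀ᵐ x : Torus, Integrable (fun t => heatCurl t x) μ :=
    integrable_heatCurl.prod_left_ae
  refine ⟨F, fun k => ∫ t, f k t ∂μ, ?_⟩
  have e1 : Set.Ioi (0 : ℝ) = Set.Ioc 0 e ∪ Set.Ioi e := (Set.Ioc_union_Ioi_eq_Ioi he.le).symm
  set D : ℝ → ℝ := fun t => ∫ x, ‖heatCurl t x - ∑ k ∈ F, f k t • shearMode k x‖ with hD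
  have hDint : IntegrableOn D (Set.Ioi 0) := hI.norm.integral_prod_left
  have i1 : IntegrableOn D (Set.Ioc 0 e) := hDint.mono_set Set.Ioc_subset_Ioi_self
  have i2 : IntegrableOn D (Set.Ioi e) := hDint.mono_set (Set.Ioi_subset_Ioi he.le)
  calc ∫ x, ‖kernelK x - ∑ k ∈ F, (∫ t, f k t ∂μ) • shearMode k x‖
      = ∫ x, ‖∫ t, (heatCurl t x - ∑ k ∈ F, f k t • shearMode k x) ∂μ‖ := by
        refine integral_congr_ae ?_
        filter_upwards [kernelK_ae_eq, hae] with x h1 h2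
        rw [h1, integral_sub h2 (integrable_finsetSum _ fun k hk => (hf k hk).smul_const _),
          integral_finsetSum _ fun k hk => (hf k hk).smul_const _]
        simp only [integral_smul_const]
        rfl
    _ ≤ ∫ t in Set.Ioi 0, D t := integral_norm_integral_le hI
    _ = (∫ t in Set.Ioc 0 e, D t) + ∫ t in Set.Ioi e, D t := by
        rw [e1, setIntegral_union (Set.Ioc_disjoint_Ioi le_rfl) measurableSet_Ioi i1 i2]
    _ ≤ η / 2 + η / 2 := by
        gcongr
        · calc _ ≤ ∫ t in Set.Ioc 0 e, 4 * (1 / √t) := by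
                refine setIntegral_mono_on i1 ((integrableOn_inv_sqrt he.le).const_mul 4)
                  measurableSet_Ioc fun t ht => ?_
                have h1 : ∀ k, f k t = 0 := fun k =>
                  Set.indicator_of_notMem (fun h => absurd ht.2 (not_le.2 h)) _
                simp only [hD, h1, zero_smul, Finset.sum_const_zero, sub_zero]
                exact (integral_norm_heatCurl_le_sqrt ht.1).trans_eq (by ring)
            _ = 4 * (2 * (η / 16)) := by
                rw [integral_const_mul, integral_inv_sqrt he.le, Real.sqrt_sq (by positivity)]
            _ = η / 2 := by ring
        · have hexp : ∀ t, Real.exp (-(t - e)) = Real.exp e * Real.exp (-t) := fun t => by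
            rw [← Real.exp_add]; ring_nf
          calc _ ≤ ∫ t in Set.Ioi e, ((4 * (1 + thetaBound e)) * thetaTail N e) * Real.exp e *
                  Real.exp (-t) := by
                refine setIntegral_mono_on i2 ((integrableOn_exp_neg e).const_mul _)
                  measurableSet_Ioi fun t ht => ?_
                have h1 : ∀ x, ∑ k ∈ F, f k t • shearMode k x = heatCurlPartial N t x := fun x => by
                  rw [heatCurlPartial_eq]
                  refine Finset.sum_congr rfl fun k _ => ?_
                  rw [show f k t = _ from Set.indicator_of_mem ht _]
                have h2 : ∀ x, ‖heatCurl t x - heatCurlPartial N t x‖ ≤ _ :=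
                  norm_heatCurl_sub_partial_le N he (le_of_lt ht) hN1
                simp only [hD, h1]
                refine (integral_mono_of_nonneg (Filter.Eventually.of_forall fun x => norm_nonneg _)
                  (integrable_const _) (Filter.Eventually.of_forall h2)).trans_eq ?_
                rw [integral_const, volume_real_torus, smul_eq_mul, hexp]
                have := Real.pi_ne_zero
                field_simp
            _ = ((4 * (1 + thetaBound e)) * thetaTail N e) * (Real.exp e * Real.exp (-e)) := by
                rw [integral_const_mul, integral_exp_neg_Ioi, mul_assoc]
            _ ≤ η / 2 := by rw [← Real.exp_add, add_neg_cancel, Real.exp_zero, mul_one]; exact hN2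
    _ = η := by ring

/-! ### Osgood's inequality -/

/-- Picard iteration: inserting a bound for `E` into the inequality improves it from `(L t) ^ n /
n!` to the next order, and these tend to `0`. No continuity or measurability of `E` enters. -/
lemma gronwall_nonpos {T M L : ℝ} (hL : 0 ≤ L) {E v : ℝ → ℝ}
    (hv : IntegrableOn v (Set.Ioc 0 T))
    (hE : ∀ t ∈ Set.Icc 0 T, E t ≤ ∫ s in Set.Ioc 0 t, v s)
    (hvE : ∀ᵐ s, s ∈ Set.Ioc 0 T → v s ≤ L * max (E s) 0)
    (hM : ∀ t ∈ Set.Icc 0 T, E t ≤ M) : ∀ t ∈ Set.Icc 0 T, E t ≤ 0 := by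
  have hM' : ∀ t ∈ Set.Icc 0 T, E t ≤ max M 0 := fun t ht => (hM t ht).trans (le_max_left _ _)
  have hM0 : 0 ≤ max M 0 := le_max_right _ _
  set M' := max M 0
  have key : ∀ n : ℕ, ∀ t ∈ Set.Icc 0 T, E t ≤ M' * ((L * t) ^ n / n.factorial) := by
    intro n
    induction n with
    | zero => simpa using hM'
    | succ n ih =>
      intro t ht
      have hsub : Set.Ioc 0 t ⊆ Set.Ioc 0 T := Set.Ioc_subset_Ioc_right ht.2
      have hc : Continuous fun s : ℝ => L * (M' * ((L * s) ^ n / n.factorial)) := by fun_prop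
      calc E t ≤ ∫ s in Set.Ioc 0 t, v s := hE t ht
        _ ≤ ∫ s in Set.Ioc 0 t, L * (M' * ((L * s) ^ n / n.factorial)) := by
          refine integral_mono_ae (hv.mono_set hsub)
            ((intervalIntegrable_iff_integrableOn_Ioc_of_le ht.1).1
              (hc.intervalIntegrable 0 t)) ?_
          filter_upwards [ae_restrict_mem measurableSet_Ioc, ae_restrict_of_ae hvE] with s hs h
          refine (h (hsub hs)).trans ?_
          gcongr
          refine max_le (ih s ⟨hs.1.le, hs.2.trans ht.2⟩) ?_
          have := hs.1.le
          positivity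
        _ = M' * ((L * t) ^ (n + 1) / (n + 1).factorial) := by
          rw [← intervalIntegral.integral_of_le ht.1]
          have e1 : (fun s : ℝ => L * (M' * ((L * s) ^ n / n.factorial))) =
              fun s => (L * M' * L ^ n / n.factorial) * s ^ n := by
            funext s; rw [mul_pow]; ring
          rw [e1, intervalIntegral.integral_const_mul, integral_pow, Nat.factorial_succ]
          push_cast
          have h1 : (n.factorial : ℝ) ≠ 0 := by exact_mod_cast n.factorial_ne_zero
          have h2 : (n : ℝ) + 1 ≠ 0 := by positivity
          rw [zero_pow (Nat.succ_ne_zero n), mul_pow, sub_zero]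
          field_simp
          ring
  intro t ht
  have hlim : Filter.Tendsto (fun n : ℕ => M' * ((L * t) ^ n / n.factorial)) Filter.atTop
      (nhds (M' * 0)) := (FloorSemiring.tendsto_pow_div_factorial_atTop (L * t)).const_mul M'
  rw [mul_zero] at hlim
  exact ge_of_tendsto' hlim fun n => key n t ht

/-- Solutions of the integral inequality for the modulus `r (1 - log r)`. -/
structure OsgoodIneq (A T a : ℝ) (D w : ℝ → ℝ) : Prop where
  integrable : IntegrableOn w (Set.Ioc 0 T)
  le : ∀ t ∈ Set.Icc 0 T, D t ≤ a + ∫ s in Set.Ioc 0 t, w s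
  modulus : ∀ᵐ s, s ∈ Set.Ioc 0 T → ∀ d, 0 < d → d ≤ 1 → w s ≤ A * (d + D s * (1 - Real.log d))
  bounded : ∃ M, ∀ t ∈ Set.Icc 0 T, D t ≤ M

lemma OsgoodIneq.mono {A T a b : ℝ} {D w : ℝ → ℝ} (h : OsgoodIneq A T a D w) (hab : a ≤ b) :
    OsgoodIneq A T b D w :=
  ⟨h.integrable, fun t ht => (h.le t ht).trans (by gcongr), h.modulus, h.bounded⟩

/-- `D` is compared with the solution `y` of `y' = A y (2 - log y)`, `y 0 = a`. Using the tangent of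
the modulus at `y s` makes the inequality for `D - y` linear, so Gronwall applies. -/
lemma OsgoodIneq.le_rpow {A T a : ℝ} {D w : ℝ → ℝ} (h : OsgoodIneq A T a D w) (hA : 0 ≤ A)
    (hT : 0 ≤ T) (ha : 0 < a) (ha1 : a ≤ Real.exp (2 - 2 * Real.exp (A * T))) :
    ∀ t ∈ Set.Icc 0 T, D t ≤ Real.exp 2 * a ^ Real.exp (-(A * T)) := by
  obtain ⟨M, hM⟩ := h.bounded
  set z := 2 - Real.log a
  -- The smallness of `a` keeps `y ≤ 1` up to time `T`, so that `d = y s` is an admissible tangent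
  -- point.
  have hz : 2 * Real.exp (A * T) ≤ z := by
    have := (Real.log_le_iff_le_exp ha).2 ha1
    simp only [z]; linarith
  have hz2 : 2 ≤ z := by
    have : 1 ≤ Real.exp (A * T) := Real.one_le_exp (by positivity)
    linarith
  -- Here `2 - log (y s) = z exp (-A s)`: the differential equation is linear in the variable `2 -
  -- log y`.
  let y : ℝ → ℝ := fun s => Real.exp (2 - z * Real.exp (-(A * s)))
  let y' : ℝ → ℝ := fun s => A * (y s * (z * Real.exp (-(A * s))))
  have hy : ∀ s, HasDerivAt y (y' s) s := by
    intro s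
    have h1 := ((((hasDerivAt_id' s).const_mul A).fun_neg.exp.const_mul z).const_sub 2).exp
    refine h1.congr_deriv ?_
    simp only [y', y]; ring
  have hy'c : Continuous y' := by fun_prop
  have hlog : ∀ s, Real.log (y s) = 2 - z * Real.exp (-(A * s)) := fun s => Real.log_exp _
  have hy0 : y 0 = a := by
    simp only [y, z, mul_zero, neg_zero, Real.exp_zero, mul_one, sub_sub_cancel]
    exact Real.exp_log ha
  have hzs : ∀ s, 0 ≤ s → s ≤ T → 2 ≤ z * Real.exp (-(A * s)) := by
    intro s hs0 hs
    have h1 : Real.exp (A * s) ≤ Real.exp (A * T) := by gcongr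
    rw [Real.exp_neg, ← div_eq_mul_inv, le_div_iff₀ (Real.exp_pos _)]
    linarith
  have hE : ∀ t ∈ Set.Icc 0 T, D t - y t ≤ 0 := by
    -- The tangent at `y s` has slope `A (1 - log (y s)) = A (z exp (-A s) - 1)`, at most `A (z -
    -- 1)`.
    refine gronwall_nonpos (L := A * (z - 1)) (v := fun s => w s - y' s)
      (mul_nonneg hA (by linarith))
      (h.integrable.sub ((intervalIntegrable_iff_integrableOn_Ioc_of_le hT).1
        (hy'c.intervalIntegrable 0 T))) ?_ ?_ (M := M) ?_
    · intro t ht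
      have i1 : IntegrableOn y' (Set.Ioc 0 t) := (intervalIntegrable_iff_integrableOn_Ioc_of_le
        ht.1).1 (hy'c.intervalIntegrable 0 t)
      rw [integral_sub (h.integrable.mono_set (Set.Ioc_subset_Ioc_right ht.2)) i1,
        ← intervalIntegral.integral_of_le (f := y') ht.1,
        intervalIntegral.integral_eq_sub_of_hasDerivAt (fun s _ => hy s)
          (hy'c.intervalIntegrable 0 t), hy0]
      linarith [h.le t ht]
    · filter_upwards [h.modulus] with s hs hsT
      have hs1 := hzs s hsT.1.le hsT.2
      have hys : y s ≤ 1 := Real.exp_le_one_iff.2 (by linarith)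
      have h1 := hs hsT (y s) (Real.exp_pos _) hys
      rw [hlog] at h1
      have hexp : Real.exp (-(A * s)) ≤ 1 :=
        Real.exp_le_one_iff.2 (neg_nonpos.2 (mul_nonneg hA hsT.1.le))
      have h2 : z * Real.exp (-(A * s)) - 1 ≤ z - 1 := by
        have := mul_le_of_le_one_right (by linarith : 0 ≤ z) hexp
        linarith
      calc w s - y' s ≤ A * ((z * Real.exp (-(A * s)) - 1) * (D s - y s)) := by
            simp only [y']; linarith
        _ ≤ A * ((z * Real.exp (-(A * s)) - 1) * max (D s - y s) 0) :=
            mul_le_mul_of_nonneg_left (mul_le_mul_of_nonneg_left (le_max_left _ _)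
              (by linarith)) hA
        _ ≤ A * ((z - 1) * max (D s - y s) 0) :=
            mul_le_mul_of_nonneg_left (mul_le_mul_of_nonneg_right h2 (le_max_right _ _)) hA
        _ = _ := by ring
    · intro t ht
      have := Real.exp_pos (2 - z * Real.exp (-(A * t)))
      have := hM t ht
      simp only [y]; linarith
  intro t ht
  refine (sub_nonpos.1 (hE t ht)).trans ?_
  rw [Real.rpow_def_of_pos ha, ← Real.exp_add]
  simp only [y, z]
  gcongr
  have hla : Real.log a ≤ 0 := by
    have := hz2; simp only [z] at this; linarith
  have h1 : Real.exp (-(A * T)) ≤ Real.exp (-(A * t)) := by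
    gcongr; exact ht.2
  have h2 := Real.exp_pos (-(A * t))
  nlinarith

/-- The bound is a positive power of `a`. Every `a ≤ a0` is admitted, in particular `a = 0`, which
is the case behind uniqueness. -/
lemma exists_osgood_small (A T : ℝ) (hA : 0 ≤ A) (hT : 0 ≤ T) {η : ℝ} (hη : 0 < η) :
    ∃ a0 : ℝ, 0 < a0 ∧ ∀ a ≤ a0, ∀ D w : ℝ → ℝ, OsgoodIneq A T a D w →
      ∀ t ∈ Set.Icc 0 T, D t ≤ η := by
  have h1 : Filter.Tendsto (fun a : ℝ => Real.exp 2 * a ^ Real.exp (-(A * T))) (nhds 0)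
      (nhds (Real.exp 2 * 0 ^ Real.exp (-(A * T)))) :=
    (Real.continuousAt_rpow_const 0 _ (Or.inr (Real.exp_pos _).le)).tendsto.const_mul _
  rw [Real.zero_rpow (Real.exp_pos _).ne', mul_zero] at h1
  obtain ⟨r, hr, hr2⟩ := Metric.eventually_nhds_iff.1 (h1.eventually (gt_mem_nhds hη))
  set a0 := min (r / 2) (Real.exp (2 - 2 * Real.exp (A * T)))
  have ha0 : 0 < a0 := lt_min (by positivity) (Real.exp_pos _)
  refine ⟨a0, ha0, fun a ha D w h t ht => ?_⟩
  refine ((h.mono ha).le_rpow hA hT ha0 (min_le_right _ _) t ht).trans (hr2 ?_).le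
  rw [Real.dist_eq, sub_zero, abs_of_pos ha0]
  exact (min_le_left _ _).trans_lt (by linarith)

/-! ### Integrals over the time interval -/

lemma setIntegral_timeMeasure {E : Type*} [NormedAddCommGroup E] [NormedSpace ℝ E] {T : ℝ}
    (hT : 0 ≤ T) (t : Set.Icc (0 : ℝ) T) (f : Set.Icc (0 : ℝ) T → E) :
    ∫ s in Set.Iic t, f s ∂(timeMeasure T) =
      ∫ s in Set.Ioc (0 : ℝ) t, f (Set.projIcc 0 T hT s) := by
  have h1 : ∀ s : Set.Icc (0 : ℝ) T, (Set.Iic t).indicator f s =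
      (Set.Iic (t : ℝ)).indicator (fun s => f (Set.projIcc 0 T hT s)) (s : ℝ) := by
    intro s
    by_cases hs : s ≤ t
    · rw [Set.indicator_of_mem (by exact hs), Set.indicator_of_mem (by exact hs),
        Set.projIcc_val]
    · rw [Set.indicator_of_notMem (by exact hs), Set.indicator_of_notMem (by exact hs)]
  rw [← integral_indicator measurableSet_Iic]
  simp only [h1]
  rw [timeMeasure, integral_subtype_comap measurableSet_Icc
    (fun s : ℝ => (Set.Iic (t : ℝ)).indicator (fun s => f (Set.projIcc 0 T hT s)) s),
    setIntegral_indicator measurableSet_Iic, ← integral_Icc_eq_integral_Ioc]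
  congr 2
  ext s
  simp only [Set.mem_inter_iff, Set.mem_Icc, Set.mem_Iic]
  exact ⟨fun h => ⟨h.1.1, h.2⟩, fun h => ⟨⟨h.1, h.2.trans t.2.2⟩, h.2⟩⟩

lemma measurePreserving_timeMeasure (T : ℝ) :
    MeasurePreserving (Subtype.val : Set.Icc (0 : ℝ) T → ℝ) (timeMeasure T)
      (volume.restrict (Set.Icc 0 T)) :=
  ⟨measurable_subtype_coe, by rw [timeMeasure, map_comap_subtype_coe measurableSet_Icc]⟩

instance isFiniteMeasure_timeMeasure (T : ℝ) : IsFiniteMeasure (timeMeasure T) := by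
  constructor
  have := (measurePreserving_timeMeasure T).measure_preimage (s := Set.univ)
    MeasurableSet.univ.nullMeasurableSet
  rw [Set.preimage_univ] at this
  rw [this, Measure.restrict_apply_univ]
  exact measure_Icc_lt_top

lemma ae_timeMeasure_iff {T : ℝ} (hT : 0 ≤ T) {p : Set.Icc (0 : ℝ) T → Prop} :
    (∀ᵐ s ∂(timeMeasure T), p s) ↔ ∀ᵐ s, s ∈ Set.Icc 0 T → p (Set.projIcc 0 T hT s) := by
  rw [← ae_restrict_iff' measurableSet_Icc, ← (measurePreserving_timeMeasure T).map_eq,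
    (MeasurableEmbedding.subtype_coe measurableSet_Icc).ae_map_iff]
  simp only [Set.projIcc_val]

lemma integrable_timeMeasure_iff {E : Type*} [NormedAddCommGroup E] {T : ℝ}
    (hT : 0 ≤ T) {f : Set.Icc (0 : ℝ) T → E} : Integrable f (timeMeasure T) ↔
      IntegrableOn (fun s => f (Set.projIcc 0 T hT s)) (Set.Icc 0 T) := by
  rw [IntegrableOn, ← (measurePreserving_timeMeasure T).map_eq,
    (MeasurableEmbedding.subtype_coe measurableSet_Icc).integrable_map_iff]
  have : (fun s => f (Set.projIcc 0 T hT s)) ∘ (Subtype.val : Set.Icc (0 : ℝ) T → ℝ) = f := by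
    funext s; simp only [Function.comp, Set.projIcc_val]
  rw [this]

lemma OsgoodIneq.of_timeMeasure {A T a : ℝ} (hT : 0 ≤ T) {D w : Set.Icc (0 : ℝ) T → ℝ}
    (hw : Integrable w (timeMeasure T))
    (hD : ∀ t, D t ≤ a + ∫ s in Set.Iic t, w s ∂(timeMeasure T))
    (hm : ∀ᵐ s ∂(timeMeasure T), ∀ d, 0 < d → d ≤ 1 → w s ≤ A * (d + D s * (1 - Real.log d)))
    {M : ℝ} (hM : ∀ t, D t ≤ M) :
    OsgoodIneq A T a (fun s => D (Set.projIcc 0 T hT s)) (fun s => w (Set.projIcc 0 T hT s)) where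
  integrable := ((integrable_timeMeasure_iff hT).1 hw).mono_set Set.Ioc_subset_Icc_self
  le t ht := by
    have := hD (Set.projIcc 0 T hT t)
    rw [setIntegral_timeMeasure hT] at this
    rwa [Set.projIcc_of_mem hT ht] at this ⊢
  modulus := by
    filter_upwards [(ae_timeMeasure_iff hT).1 hm] with s hs hsT
    exact hs (Set.Ioc_subset_Icc_self hsT)
  bounded := ⟨M, fun t _ => hM _⟩

/-! ### Velocity fields generated by measure preserving maps -/

instance isNegInvariant_torus : (volume : Measure Torus).IsNegInvariant :=
  Measure.IsAddHaarMeasure.isNegInvariant_of_regular _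

/-- The `L^∞` norm of the vorticity. -/
noncomputable def supNorm (ξ : Torus → ℝ) : ℝ := (eLpNorm ξ ⊤ volume).toReal

/-- The velocity with kernel `k` generated by the map `ψ`. -/
noncomputable def convVel (k : Torus → ℝ × ℝ) (ξ : Torus → ℝ) (ψ : Torus → Torus) (z : Torus) :
    ℝ × ℝ := ∫ y, ξ y • k (z - ψ y)

lemma supNorm_nonneg (ξ : Torus → ℝ) : 0 ≤ supNorm ξ := ENNReal.toReal_nonneg

lemma ae_abs_le_supNorm {ξ : Torus → ℝ} (hξ : MemLp ξ ⊤ volume) : ∀ᵐ y, ‖ξ y‖ ≤ supNorm ξ := by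
  have h := hξ.2
  have h2 := ae_le_eLpNormEssSup (f := ξ) (μ := volume)
  rw [supNorm]
  rw [eLpNorm_exponent_top] at h ⊢
  filter_upwards [h2] with y hy
  have := ENNReal.toReal_mono h.ne hy
  rwa [toReal_enorm] at this

section

variable {ξ : Torus → ℝ} {ψ χ φ : Torus → Torus} {k : Torus → ℝ × ℝ}

lemma measurePreserving_sub_map (hψ : MeasurePreserving ψ volume volume) (z : Torus) :
    MeasurePreserving (fun y => z - ψ y) volume volume :=
  (Measure.measurePreserving_sub_left volume z).comp hψ

lemma integrable_smul_kernel (hξ : MemLp ξ ⊤ volume) (hk : Integrable k)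
    (hψ : MeasurePreserving ψ volume volume) (z : Torus) :
    Integrable (fun y => ξ y • k (z - ψ y)) :=
  ((measurePreserving_sub_map hψ z).integrable_comp_of_integrable hk).bdd_smul _ hξ.1
    (ae_abs_le_supNorm hξ)

lemma norm_convVel_le_integral (hξ : MemLp ξ ⊤ volume) {f : Torus → ℝ × ℝ} (hf : Integrable f) :
    ‖∫ y, ξ y • f y‖ ≤ supNorm ξ * ∫ y, ‖f y‖ := by
  rw [← integral_const_mul]
  refine norm_integral_le_of_norm_le (hf.norm.const_mul _) ?_
  filter_upwards [ae_abs_le_supNorm hξ] with y hy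
  rw [norm_smul]
  gcongr

lemma integral_norm_comp_sub (hk : Integrable k) (hψ : MeasurePreserving ψ volume volume)
    (z : Torus) : ∫ y, ‖k (z - ψ y)‖ = ∫ x, ‖k x‖ := by
  have h := measurePreserving_sub_map hψ z
  have h2 := integral_map (μ := volume) (φ := fun y => z - ψ y) h.measurable.aemeasurable
    (f := fun x => ‖k x‖) (by rw [h.map_eq]; exact hk.1.norm)
  rw [h.map_eq] at h2
  exact h2.symm

/-- Incompressibility enters here: the change of variables `y ↦ z - ψ y` leaves only the `L¹` norm
of the kernel, uniformly in `z` and `ψ`. -/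
lemma norm_convVel_le (hξ : MemLp ξ ⊤ volume) (hk : Integrable k)
    (hψ : MeasurePreserving ψ volume volume) (z : Torus) :
    ‖convVel k ξ ψ z‖ ≤ supNorm ξ * ∫ x, ‖k x‖ := by
  rw [← integral_norm_comp_sub hk hψ z]
  exact norm_convVel_le_integral hξ
    ((measurePreserving_sub_map hψ z).integrable_comp_of_integrable hk)

lemma convVel_sub {k' : Torus → ℝ × ℝ} (hξ : MemLp ξ ⊤ volume) (hk : Integrable k)
    (hk' : Integrable k') (hψ : MeasurePreserving ψ volume volume) (z : Torus) :
    convVel k ξ ψ z - convVel k' ξ ψ z = convVel (fun x => k x - k' x) ξ ψ z := by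
  simp only [convVel, smul_sub]
  rw [integral_sub (integrable_smul_kernel hξ hk hψ z) (integrable_smul_kernel hξ hk' hψ z)]

lemma exists_lift_circ (x : Circ) : ∃ a : ℝ, (a : Circ) = x ∧ |a| = ‖x‖ := by
  revert x
  refine circ_forall fun x => ?_
  refine ⟨x - round ((2 * Real.pi)⁻¹ * x) * (2 * Real.pi), ?_, (AddCircle.norm_eq _).symm⟩
  rw [AddCircle.coe_sub, sub_eq_self, AddCircle.coe_eq_zero_iff]
  exact ⟨_, zsmul_eq_mul _ _⟩

lemma exists_lift (x : Torus) : ∃ a : ℝ × ℝ, proj a = x ∧ ‖a‖ = ‖x‖ := by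
  obtain ⟨a, ha, ha'⟩ := exists_lift_circ x.1
  obtain ⟨b, hb, hb'⟩ := exists_lift_circ x.2
  refine ⟨(a, b), Prod.ext ha hb, ?_⟩
  rw [Prod.norm_def, Prod.norm_def, Real.norm_eq_abs, Real.norm_eq_abs, ha', hb']

lemma norm_proj_le (a : ℝ × ℝ) : ‖proj a‖ ≤ ‖a‖ := by
  rw [Prod.norm_def, Prod.norm_def]
  exact max_le_max QuotientAddGroup.norm_mk_le_norm QuotientAddGroup.norm_mk_le_norm

lemma proj_add (a b : ℝ × ℝ) : proj (a + b) = proj a + proj b := rfl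

lemma proj_sub (a b : ℝ × ℝ) : proj (a - b) = proj a - proj b := rfl

lemma proj_zero : proj 0 = 0 := rfl

lemma continuous_proj : Continuous proj := by
  have : Continuous ((↑) : ℝ → Circ) := AddCircle.continuous_mk' _
  unfold proj
  fun_prop

lemma exists_kernelK_shift_le : ∃ C : ℝ, 0 < C ∧ ∀ (w w' : Torus) (d : ℝ), 0 < d → d ≤ 1 →
    ∫ x, ‖kernelK (x - w) - kernelK (x - w')‖ ≤ C * (d + dist w w' * (1 - Real.log d)) := by
  obtain ⟨C, hC, h⟩ := exists_kernelK_translate_le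
  refine ⟨C, hC, fun w w' d hd hd1 => ?_⟩
  obtain ⟨a, ha, ha'⟩ := exists_lift (w' - w)
  have h1 := h a d hd hd1
  rw [ha', ha, ← dist_eq_norm, dist_comm] at h1
  refine le_of_eq_of_le ?_ h1
  rw [← integral_sub_right_eq_self (μ := (volume : Measure Torus))
    (fun x => ‖kernelK (x + (w' - w)) - kernelK x‖) w']
  congr 1; funext x
  congr 3; abel

lemma exists_kernelK_point_le : ∃ C : ℝ, 0 < C ∧ ∀ (z z' : Torus) (d : ℝ), 0 < d → d ≤ 1 →
    ∫ x, ‖kernelK (z - x) - kernelK (z' - x)‖ ≤ C * (d + dist z z' * (1 - Real.log d)) := by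
  obtain ⟨C, hC, h⟩ := exists_kernelK_translate_le
  refine ⟨C, hC, fun w w' d hd hd1 => ?_⟩
  obtain ⟨a, ha, ha'⟩ := exists_lift (w - w')
  have h1 := h a d hd hd1
  rw [ha', ha, ← dist_eq_norm] at h1
  refine le_of_eq_of_le ?_ h1
  rw [← integral_sub_left_eq_self
    (fun x => ‖kernelK (x + (w - w')) - kernelK x‖) (volume : Measure Torus) w']
  congr 1; funext x
  congr 3; abel

/-- The velocity field is log-Lipschitz. -/
lemma exists_convVel_logLipschitz : ∃ C : ℝ, 0 < C ∧ ∀ {ξ : Torus → ℝ} {ψ : Torus → Torus},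
    MemLp ξ ⊤ volume → MeasurePreserving ψ volume volume → ∀ (z z' : Torus) (d : ℝ), 0 < d →
    d ≤ 1 → ‖convVel kernelK ξ ψ z - convVel kernelK ξ ψ z'‖ ≤
      C * supNorm ξ * (d + dist z z' * (1 - Real.log d)) := by
  obtain ⟨C, hC, h⟩ := exists_kernelK_point_le
  refine ⟨C, hC, fun {ξ ψ} hξ hψ z z' d hd hd1 => ?_⟩
  have hmp : ∀ z, MeasurePreserving (fun y : Torus => z - y) volume volume :=
    fun z => Measure.measurePreserving_sub_left volume z
  have hk : Integrable fun x => kernelK (z - x) - kernelK (z' - x) :=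
    ((hmp z).integrable_comp_of_integrable integrable_kernelK).sub
      ((hmp z').integrable_comp_of_integrable integrable_kernelK)
  have e : convVel kernelK ξ ψ z - convVel kernelK ξ ψ z' =
      ∫ y, ξ y • (fun x => kernelK (z - x) - kernelK (z' - x)) (ψ y) := by
    simp only [convVel, smul_sub]
    rw [integral_sub (integrable_smul_kernel hξ integrable_kernelK hψ z)
      (integrable_smul_kernel hξ integrable_kernelK hψ z')]
  have e2 : ∫ y, ‖(fun x => kernelK (z - x) - kernelK (z' - x)) (ψ y)‖ =
      ∫ x, ‖kernelK (z - x) - kernelK (z' - x)‖ := by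
    have h2 := integral_map (μ := volume) (φ := ψ) hψ.measurable.aemeasurable
      (f := fun x => ‖kernelK (z - x) - kernelK (z' - x)‖) (by rw [hψ.map_eq]; exact hk.1.norm)
    rw [hψ.map_eq] at h2
    exact h2.symm
  rw [e]
  refine (norm_convVel_le_integral hξ (f := fun y => (fun x => kernelK (z - x) -
    kernelK (z' - x)) (ψ y)) (hψ.integrable_comp_of_integrable hk)).trans ?_
  rw [e2, mul_comm C, mul_assoc]
  exact mul_le_mul_of_nonneg_left (h z z' d hd hd1) (supNorm_nonneg ξ)

lemma measurePreserving_fst_sub_snd :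
    MeasurePreserving (fun p : Torus × Torus => (p.1 - p.2, p.2))
      ((volume : Measure Torus).prod volume) ((volume : Measure Torus).prod volume) :=
  measurePreserving_sub_prod _ _

lemma integrable_kernel_prod (hk : Integrable k) (hφ : MeasurePreserving φ volume volume)
    (hψ : MeasurePreserving ψ volume volume) :
    Integrable (fun p : Torus × Torus => k (φ p.1 - ψ p.2))
      ((volume : Measure Torus).prod volume) := by
  have h1 : Integrable (fun p : Torus × Torus => k p.1)
      ((volume : Measure Torus).prod volume) := hk.comp_fst volume
  have h2 := measurePreserving_fst_sub_snd.integrable_comp_of_integrable h1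
  exact (hφ.prod hψ).integrable_comp_of_integrable h2

lemma dist_torus_le (x y : Torus) : dist x y ≤ Real.pi := by
  rw [dist_eq_norm, Prod.norm_def]
  have h (x : Circ) : ‖x‖ ≤ Real.pi := by
    have := AddCircle.norm_le_half_period (2 * Real.pi) (x := x) Real.two_pi_pos.ne'
    rwa [abs_of_pos Real.two_pi_pos, mul_div_cancel_left₀ _ two_ne_zero] at this
  exact max_le (h _) (h _)

lemma integrable_dist_maps (hψ : Measurable ψ) (hχ : Measurable χ) :
    Integrable (fun y => dist (ψ y) (χ y)) :=
  Integrable.of_bound (hψ.dist hχ).aestronglyMeasurable Real.pi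
    (Filter.Eventually.of_forall fun y => by
      rw [Real.norm_of_nonneg dist_nonneg]; exact dist_torus_le _ _)

/-- `L¹` stability of the velocity with respect to the generating map. -/
lemma exists_convVel_stability : ∃ C : ℝ, 0 < C ∧ ∀ {ξ : Torus → ℝ} {ψ χ φ : Torus → Torus},
    MemLp ξ ⊤ volume → MeasurePreserving ψ volume volume → MeasurePreserving χ volume volume →
    MeasurePreserving φ volume volume → ∀ d : ℝ, 0 < d → d ≤ 1 →
    ∫ x, ‖convVel kernelK ξ ψ (φ x) - convVel kernelK ξ χ (φ x)‖ ≤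
      C * supNorm ξ * (d + (∫ y, dist (ψ y) (χ y)) * (1 - Real.log d)) := by
  obtain ⟨C, hC, h⟩ := exists_kernelK_shift_le
  refine ⟨C * (2 * Real.pi) ^ 2, by positivity, fun {ξ ψ χ φ} hξ hψ hχ hφ d hd hd1 => ?_⟩
  have hk := integrable_kernelK
  have hX := supNorm_nonneg ξ
  have hF : Integrable (fun p : Torus × Torus =>
      kernelK (φ p.1 - ψ p.2) - kernelK (φ p.1 - χ p.2)) ((volume : Measure Torus).prod volume) :=
    (integrable_kernel_prod hk hφ hψ).sub (integrable_kernel_prod hk hφ hχ)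
  have e1 (x : Torus) : ‖convVel kernelK ξ ψ (φ x) - convVel kernelK ξ χ (φ x)‖ ≤
      supNorm ξ * ∫ y, ‖kernelK (φ x - ψ y) - kernelK (φ x - χ y)‖ := by
    have : convVel kernelK ξ ψ (φ x) - convVel kernelK ξ χ (φ x) =
        ∫ y, ξ y • (kernelK (φ x - ψ y) - kernelK (φ x - χ y)) := by
      simp only [convVel, smul_sub]
      rw [integral_sub (integrable_smul_kernel hξ hk hψ _) (integrable_smul_kernel hξ hk hχ _)]
    rw [this]
    exact norm_convVel_le_integral hξ
      (((measurePreserving_sub_map hψ (φ x)).integrable_comp_of_integrable hk).sub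
        ((measurePreserving_sub_map hχ (φ x)).integrable_comp_of_integrable hk))
  have e2 (w w' : Torus) : ∫ x, ‖kernelK (φ x - w) - kernelK (φ x - w')‖ =
      ∫ z, ‖kernelK (z - w) - kernelK (z - w')‖ := by
    have hmp : ∀ z, MeasurePreserving (fun y : Torus => y - z) volume volume :=
      fun z => measurePreserving_sub_right volume z
    have hk2 : Integrable fun x => kernelK (x - w) - kernelK (x - w') :=
      ((hmp w).integrable_comp_of_integrable hk).sub ((hmp w').integrable_comp_of_integrable hk)
    have h2 := integral_map (μ := volume) (φ := φ) hφ.measurable.aemeasurable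
      (f := fun x => ‖kernelK (x - w) - kernelK (x - w')‖) (by rw [hφ.map_eq]; exact hk2.1.norm)
    rw [hφ.map_eq] at h2
    exact h2.symm
  have hd0 := integrable_dist_maps hψ.measurable hχ.measurable
  have hl : 0 ≤ 1 - Real.log d := by have := Real.log_nonpos hd.le hd1; linarith
  have hD0 : 0 ≤ ∫ y, dist (ψ y) (χ y) := integral_nonneg fun y => dist_nonneg
  have hpi : 1 ≤ (2 * Real.pi) ^ 2 := by nlinarith [Real.pi_gt_three]
  calc ∫ x, ‖convVel kernelK ξ ψ (φ x) - convVel kernelK ξ χ (φ x)‖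
      ≤ ∫ x, supNorm ξ * ∫ y, ‖kernelK (φ x - ψ y) - kernelK (φ x - χ y)‖ :=
        integral_mono_of_nonneg (Filter.Eventually.of_forall fun x => norm_nonneg _)
          (hF.norm.integral_prod_left.const_mul _) (Filter.Eventually.of_forall e1)
    -- With `y` fixed, integrating in `x` first removes `φ` and leaves the `L¹` modulus of `K` at
    -- the pair `ψ y`, `χ y`. As this bound is affine in the distance, integrating in `y` gives the
    -- mean distance.
    _ = supNorm ξ * ∫ y, ∫ x, ‖kernelK (φ x - ψ y) - kernelK (φ x - χ y)‖ := by
        rw [integral_const_mul, integral_integral_swap (f := fun x y =>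
          ‖kernelK (φ x - ψ y) - kernelK (φ x - χ y)‖) hF.norm]
    _ ≤ supNorm ξ * ∫ y, C * (d + dist (ψ y) (χ y) * (1 - Real.log d)) := by
        refine mul_le_mul_of_nonneg_left ?_ hX
        have hi : Integrable (fun y => C * (d + dist (ψ y) (χ y) * (1 - Real.log d))) :=
          ((integrable_const _).add (hd0.mul_const _)).const_mul _
        refine integral_mono (f := fun y => ∫ x, ‖kernelK (φ x - ψ y) - kernelK (φ x - χ y)‖)
          hF.norm.integral_prod_right hi fun y => ?_
        simp only [e2]
        exact h _ _ d hd hd1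
    _ = supNorm ξ * (C * ((2 * Real.pi) ^ 2 * d +
          (∫ y, dist (ψ y) (χ y)) * (1 - Real.log d))) := by
        rw [integral_const_mul, integral_add (integrable_const _) (hd0.mul_const _),
          integral_const, volume_real_torus, integral_mul_const, smul_eq_mul]
    _ ≤ supNorm ξ * (C * ((2 * Real.pi) ^ 2 * d +
          (2 * Real.pi) ^ 2 * ((∫ y, dist (ψ y) (χ y)) * (1 - Real.log d)))) := by
        have := le_mul_of_one_le_left (mul_nonneg hD0 hl) hpi
        refine mul_le_mul_of_nonneg_left (mul_le_mul_of_nonneg_left ?_ hC.le) hX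
        linarith
    _ = _ := by ring

end

/-! ### Shear modes in coordinates and uniform stability of the velocity -/

lemma character_proj (k : ℤ × ℤ) (v : ℝ × ℝ) : character k (proj v) =
    Complex.exp (((k.1 * v.1 + k.2 * v.2 : ℝ) : ℂ) * Complex.I) := by
  rw [character, proj, fourier_coe_eq, fourier_coe_eq, ← Complex.exp_add]
  congr 1
  push_cast
  ring

lemma character_proj_im (k : ℤ × ℤ) (v : ℝ × ℝ) :
    (character k (proj v)).im = Real.sin (k.1 * v.1 + k.2 * v.2) := by
  rw [character_proj, Complex.exp_ofReal_mul_I_im]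

lemma norm_shearMode_sub_le (k : ℤ × ℤ) (x y : Torus) : ‖shearMode k x - shearMode k y‖ ≤
    (|(k.1 : ℝ)| + |(k.2 : ℝ)|) * ‖(-(k.2 : ℝ), (k.1 : ℝ))‖ * dist x y := by
  obtain ⟨b, hb, -⟩ := exists_lift y
  obtain ⟨a, ha, ha'⟩ := exists_lift (x - y)
  have hx : x = proj (a + b) := by rw [proj_add, ha, hb, sub_add_cancel]
  rw [dist_eq_norm, ← ha', shearMode, shearMode, ← sub_smul, norm_smul, mul_right_comm]
  gcongr
  rw [hx, ← hb, character_proj_im, character_proj_im]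
  have hsin (u v : ℝ) : ‖Real.sin u - Real.sin v‖ ≤ |u - v| := by
    have := Real.lipschitzWith_sin.dist_le_mul u v
    simpa [Real.dist_eq] using this
  refine (hsin _ _).trans ?_
  have e : (k.1 : ℝ) * (a + b).1 + k.2 * (a + b).2 - (k.1 * b.1 + k.2 * b.2) =
      k.1 * a.1 + k.2 * a.2 := by
    simp only [Prod.fst_add, Prod.snd_add]; ring
  rw [e]
  refine (abs_add_le _ _).trans ?_
  rw [abs_mul, abs_mul, add_mul]
  have h1 : |a.1| ≤ ‖a‖ := norm_fst_le a
  have h2 : |a.2| ≤ ‖a‖ := norm_snd_le a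
  gcongr

/-- The velocity depends continuously on the generating map, uniformly in space. -/
lemma exists_convVel_uniform {η : ℝ} (hη : 0 < η) : ∃ L : ℝ, 0 ≤ L ∧
    ∀ {ξ : Torus → ℝ} {ψ χ : Torus → Torus}, MemLp ξ ⊤ volume →
    MeasurePreserving ψ volume volume → MeasurePreserving χ volume volume → ∀ z,
    ‖convVel kernelK ξ ψ z - convVel kernelK ξ χ z‖ ≤
      supNorm ξ * (η + L * ∫ y, dist (ψ y) (χ y)) := by
  -- `K` is split into a Lipschitz part and a part small in `L¹`. The small part costs `η / 2` for
  -- each of the two maps, the Lipschitz part costs `L` times the mean distance, all uniformly in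
  -- `z`.
  obtain ⟨F, c, hF⟩ := exists_shearMode_approx (half_pos hη)
  set g : Torus → ℝ × ℝ := fun x => ∑ k ∈ F, c k • shearMode k x
  set L : ℝ := ∑ k ∈ F, |c k| * ((|(k.1 : ℝ)| + |(k.2 : ℝ)|) * ‖(-(k.2 : ℝ), (k.1 : ℝ))‖)
  have hg : Continuous g := continuous_finsetSum _ fun k _ =>
    (continuous_shearMode k).fun_const_smul (c k)
  have hgi := integrable_torus hg
  have hgL (x y : Torus) : ‖g x - g y‖ ≤ L * dist x y := by
    simp only [g, L]
    rw [← Finset.sum_sub_distrib, Finset.sum_mul]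
    refine norm_sum_le_of_le _ fun k _ => ?_
    rw [← smul_sub, norm_smul, Real.norm_eq_abs, mul_assoc]
    gcongr
    exact norm_shearMode_sub_le k x y
  refine ⟨L, Finset.sum_nonneg fun k _ => by positivity, fun {ξ ψ χ} hξ hψ hχ z => ?_⟩
  have hX := supNorm_nonneg ξ
  have hk := integrable_kernelK
  have h1 {ψ : Torus → Torus} (hψ : MeasurePreserving ψ volume volume) :
      ‖convVel kernelK ξ ψ z - convVel g ξ ψ z‖ ≤ supNorm ξ * (η / 2) := by
    rw [convVel_sub hξ hk hgi hψ]
    exact (norm_convVel_le hξ (hk.sub hgi) hψ z).trans (mul_le_mul_of_nonneg_left hF hX)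
  have hd := integrable_dist_maps hψ.measurable hχ.measurable
  have h2 : ‖convVel g ξ ψ z - convVel g ξ χ z‖ ≤ supNorm ξ * (L * ∫ y, dist (ψ y) (χ y)) := by
    have e : convVel g ξ ψ z - convVel g ξ χ z = ∫ y, ξ y • (g (z - ψ y) - g (z - χ y)) := by
      simp only [convVel, smul_sub]
      rw [integral_sub (integrable_smul_kernel hξ hgi hψ z) (integrable_smul_kernel hξ hgi hχ z)]
    have hi : Integrable fun y => g (z - ψ y) - g (z - χ y) :=
      ((measurePreserving_sub_map hψ z).integrable_comp_of_integrable hgi).sub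
        ((measurePreserving_sub_map hχ z).integrable_comp_of_integrable hgi)
    rw [e]
    refine (norm_convVel_le_integral hξ hi).trans ?_
    refine mul_le_mul_of_nonneg_left ?_ hX
    rw [← integral_const_mul]
    refine integral_mono hi.norm (hd.const_mul L) fun y => ?_
    refine (hgL _ _).trans_eq ?_
    rw [dist_sub_left]
  have e : convVel kernelK ξ ψ z - convVel kernelK ξ χ z =
      (convVel kernelK ξ ψ z - convVel g ξ ψ z) + (convVel g ξ ψ z - convVel g ξ χ z) -
      (convVel kernelK ξ χ z - convVel g ξ χ z) := by abel
  rw [e]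
  calc _ ≤ ‖convVel kernelK ξ ψ z - convVel g ξ ψ z‖ + ‖convVel g ξ ψ z - convVel g ξ χ z‖ +
        ‖convVel kernelK ξ χ z - convVel g ξ χ z‖ :=
        (norm_sub_le _ _).trans (by gcongr; exact norm_add_le _ _)
    _ ≤ supNorm ξ * (η / 2) + supNorm ξ * (L * ∫ y, dist (ψ y) (χ y)) + supNorm ξ * (η / 2) :=
        add_le_add (add_le_add (h1 hψ) h2) (h1 hχ)
    _ = _ := by ring

/-! ### Velocity along flows and the flow equation up to an error -/

section

variable {T : ℝ} {ξ : Torus → ℝ} {Φ Ψ : Flow T}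

lemma velocity_eq_convVel (ξ : Torus → ℝ) (Φ : Flow T) (t : Set.Icc (0 : ℝ) T) (z : Torus) :
    velocity ξ Φ t z = convVel kernelK ξ (Φ t) z := rfl

/-- Neither `ξ` nor `K` need be Borel. Borel representatives change nothing in the integral at times
when the flow preserves the measure, and then for every `z` at once, so the velocity may be
evaluated along single curves. -/
lemma exists_measurable_velocity (hξ : MemLp ξ ⊤ volume) (hΦ : MemM Φ) :
    ∃ U : Set.Icc (0 : ℝ) T × Torus → ℝ × ℝ, StronglyMeasurable U ∧
      ∀ᵐ s ∂(timeMeasure T), ∀ z, velocity ξ Φ s z = U (s, z) := by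
  set K' := integrable_kernelK.1.mk kernelK
  set ξ' := hξ.1.mk ξ
  have hK' : Measurable K' := integrable_kernelK.1.stronglyMeasurable_mk.measurable
  have hξ' : Measurable ξ' := hξ.1.stronglyMeasurable_mk.measurable
  have hm : Measurable fun q : (Set.Icc (0 : ℝ) T × Torus) × Torus =>
      ξ' q.2 • K' (q.1.2 - Φ q.1.1 q.2) := by
    have h1 : Measurable fun q : (Set.Icc (0 : ℝ) T × Torus) × Torus => Φ q.1.1 q.2 :=
      hΦ.measurable.comp (f := fun q : (Set.Icc (0 : ℝ) T × Torus) × Torus => (q.1.1, q.2))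
        (by fun_prop)
    exact (hξ'.comp measurable_snd).smul (hK'.comp ((measurable_snd.comp measurable_fst).sub h1))
  refine ⟨fun p => ∫ y, ξ' y • K' (p.2 - Φ p.1 y), hm.stronglyMeasurable.integral_prod_right, ?_⟩
  filter_upwards [hΦ.measurePreserving] with s hs z
  refine integral_congr_ae ?_
  filter_upwards [hξ.1.ae_eq_mk, (measurePreserving_sub_map hs z).quasiMeasurePreserving.ae
    integrable_kernelK.1.ae_eq_mk] with y h1 h2
  rw [h1, h2]

lemma ae_norm_velocity_le (hξ : MemLp ξ ⊤ volume) (hΦ : MemM Φ) :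
    ∀ᵐ s ∂(timeMeasure T), ∀ z, ‖velocity ξ Φ s z‖ ≤ supNorm ξ * ∫ x, ‖kernelK x‖ := by
  filter_upwards [hΦ.measurePreserving] with s hs z
  exact norm_convVel_le hξ integrable_kernelK hs z

lemma integrable_velocity_curve (hξ : MemLp ξ ⊤ volume) (hΦ : MemM Φ)
    {γ : Set.Icc (0 : ℝ) T → Torus} (hγ : Measurable γ) :
    Integrable (fun s => velocity ξ Φ s (γ s)) (timeMeasure T) := by
  obtain ⟨U, hU, h⟩ := exists_measurable_velocity hξ hΦ
  have hm : AEStronglyMeasurable (fun s => velocity ξ Φ s (γ s)) (timeMeasure T) := by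
    refine (hU.comp_measurable (g := fun s => (s, γ s)) (by fun_prop)).aestronglyMeasurable.congr ?_
    filter_upwards [h] with s hs
    exact (hs _).symm
  refine Integrable.of_bound hm (supNorm ξ * ∫ x, ‖kernelK x‖) ?_
  filter_upwards [ae_norm_velocity_le hξ hΦ] with s hs
  exact hs _

lemma integrable_velocity_joint (hξ : MemLp ξ ⊤ volume) (hΦ : MemM Φ) (hΨ : MemM Ψ) :
    Integrable (fun p : Set.Icc (0 : ℝ) T × Torus => velocity ξ Φ p.1 (Ψ p.1 p.2))
      ((timeMeasure T).prod volume) := by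
  obtain ⟨U, hU, h⟩ := exists_measurable_velocity hξ hΦ
  have hΨm := hΨ.measurable
  have hq := Measure.quasiMeasurePreserving_fst (μ := timeMeasure T) (ν := (volume : Measure Torus))
  have hm : AEStronglyMeasurable
      (fun p : Set.Icc (0 : ℝ) T × Torus => velocity ξ Φ p.1 (Ψ p.1 p.2))
      ((timeMeasure T).prod volume) := by
    refine (hU.comp_measurable (g := fun p : Set.Icc (0 : ℝ) T × Torus => (p.1, Ψ p.1 p.2))
      (by fun_prop)).aestronglyMeasurable.congr ?_
    filter_upwards [hq.ae h] with p hp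
    exact (hp _).symm
  refine Integrable.of_bound hm (supNorm ξ * ∫ x, ‖kernelK x‖) ?_
  filter_upwards [hq.ae (ae_norm_velocity_le hξ hΦ)] with p hp
  exact hp _

/-- The flow equation at `(t, x)`, up to an error `e`. -/
def SolvesUpTo (ξ : Torus → ℝ) (Φ : Flow T) (e : ℝ) (t : Set.Icc (0 : ℝ) T) (x : Torus) : Prop :=
  ∃ v : ℝ × ℝ, Φ t x = x + proj v ∧
    ‖v - ∫ s in Set.Iic t, velocity ξ Φ s (Φ s x) ∂(timeMeasure T)‖ ≤ e

lemma SolvesAt.solvesUpTo {t : Set.Icc (0 : ℝ) T} {x : Torus} (h : SolvesAt ξ Φ t x) :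
    SolvesUpTo ξ Φ 0 t x := ⟨_, h.eq, by rw [sub_self, norm_zero]⟩

lemma solvesAt_of_solvesUpTo (hξ : MemLp ξ ⊤ volume) (hΦ : MemM Φ) {t : Set.Icc (0 : ℝ) T}
    {x : Torus} (h : SolvesUpTo ξ Φ 0 t x) : SolvesAt ξ Φ t x where
  integrable_space := by
    refine ae_restrict_of_ae ?_
    filter_upwards [hΦ.measurePreserving] with s hs
    exact integrable_smul_kernel hξ integrable_kernelK hs _
  integrable_time := (integrable_velocity_curve hξ hΦ
    (hΦ.measurable.comp (f := fun s => (s, x)) (by fun_prop))).integrableOn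
  eq := by
    obtain ⟨v, hv, h0⟩ := h
    rw [hv, sub_eq_zero.1 (norm_le_zero_iff.1 h0)]

lemma dist_add_proj_le (x y : Torus) (v w : ℝ × ℝ) :
    dist (x + proj v) (y + proj w) ≤ dist x y + ‖v - w‖ := by
  refine (dist_add_add_le _ _ _ _).trans ?_
  gcongr
  rw [dist_eq_norm, ← proj_sub]
  exact norm_proj_le _

lemma SolvesUpTo.dist_le (hξ : MemLp ξ ⊤ volume) (hΦ : MemM Φ) (hΨ : MemM Ψ) {e : ℝ}
    {t : Set.Icc (0 : ℝ) T} {x y : Torus} (h : SolvesUpTo ξ Φ e t x) (h' : SolvesUpTo ξ Ψ e t y) :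
    dist (Φ t x) (Ψ t y) ≤ dist x y + 2 * e + ∫ s in Set.Iic t,
      ‖velocity ξ Φ s (Φ s x) - velocity ξ Ψ s (Ψ s y)‖ ∂(timeMeasure T) := by
  obtain ⟨v, hv, hve⟩ := h
  obtain ⟨w, hw, hwe⟩ := h'
  have i1 := (integrable_velocity_curve hξ hΦ (γ := fun s => Φ s x)
    (hΦ.measurable.comp (f := fun s => (s, x)) (by fun_prop))).integrableOn (s := Set.Iic t)
  have i2 := (integrable_velocity_curve hξ hΨ (γ := fun s => Ψ s y)
    (hΨ.measurable.comp (f := fun s => (s, y)) (by fun_prop))).integrableOn (s := Set.Iic t)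
  set a := ∫ s in Set.Iic t, velocity ξ Φ s (Φ s x) ∂(timeMeasure T)
  set b := ∫ s in Set.Iic t, velocity ξ Ψ s (Ψ s y) ∂(timeMeasure T)
  have hab : ‖a - b‖ ≤ ∫ s in Set.Iic t,
      ‖velocity ξ Φ s (Φ s x) - velocity ξ Ψ s (Ψ s y)‖ ∂(timeMeasure T) := by
    rw [← integral_sub i1 i2]
    exact norm_integral_le_integral_norm _
  rw [hv, hw]
  refine (dist_add_proj_le _ _ _ _).trans ?_
  have e1 : v - w = (v - a) - (w - b) + (a - b) := by abel
  have h3 : ‖v - w‖ ≤ ‖v - a‖ + ‖w - b‖ + ‖a - b‖ := by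
    rw [e1]
    exact (norm_add_le _ _).trans (by gcongr; exact norm_sub_le _ _)
  linarith

end

/-- Two approximate trajectories satisfy Osgood's inequality. -/
lemma exists_osgood_pointwise : ∃ C : ℝ, 0 < C ∧ ∀ {T : ℝ} (hT : 0 ≤ T) {ξ : Torus → ℝ}
    {Φ Ψ : Flow T}, MemLp ξ ⊤ volume → MemM Φ → MemM Ψ → ∀ {e σ : ℝ} {x y : Torus}, 0 ≤ σ →
    (∀ t, SolvesUpTo ξ Φ e t x) → (∀ t, SolvesUpTo ξ Ψ e t y) →
    (∀ᵐ s ∂(timeMeasure T), ∀ z, ‖velocity ξ Φ s z - velocity ξ Ψ s z‖ ≤ σ) →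
    OsgoodIneq (C * supNorm ξ) T (dist x y + 2 * e + σ * T)
      (fun s => dist (Φ (Set.projIcc 0 T hT s) x) (Ψ (Set.projIcc 0 T hT s) y))
      (fun s => ‖velocity ξ Φ (Set.projIcc 0 T hT s) (Φ (Set.projIcc 0 T hT s) x) -
        velocity ξ Ψ (Set.projIcc 0 T hT s) (Ψ (Set.projIcc 0 T hT s) y)‖ - σ) := by
  obtain ⟨C, hC, hlog⟩ := exists_convVel_logLipschitz
  refine ⟨C, hC, fun {T} hT {ξ Φ Ψ} hξ hΦ hΨ {e σ x y} hσ hx hy hs => ?_⟩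
  have i1 := integrable_velocity_curve hξ hΦ (γ := fun s => Φ s x)
    (hΦ.measurable.comp (f := fun s => (s, x)) (by fun_prop))
  have i2 := integrable_velocity_curve hξ hΨ (γ := fun s => Ψ s y)
    (hΨ.measurable.comp (f := fun s => (s, y)) (by fun_prop))
  have iw : Integrable (fun s => ‖velocity ξ Φ s (Φ s x) - velocity ξ Ψ s (Ψ s y)‖)
    (timeMeasure T) := (i1.sub i2).norm
  -- The uniform velocity error `σ` is subtracted from the integrand and paid for by `σ T` in the
  -- initial value, so the modulus inequality holds without an additive term.
  refine OsgoodIneq.of_timeMeasure hT (D := fun s => dist (Φ s x) (Ψ s y))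
    (w := fun s => ‖velocity ξ Φ s (Φ s x) - velocity ξ Ψ s (Ψ s y)‖ - σ)
    (iw.sub (integrable_const σ)) (fun t => ?_) ?_ (M := Real.pi)
    fun t => dist_torus_le _ _
  · have h1 := SolvesUpTo.dist_le hξ hΦ hΨ (hx t) (hy t)
    rw [integral_sub iw.integrableOn (integrable_const σ).integrableOn,
      setIntegral_timeMeasure hT t (fun _ => σ), setIntegral_const]
    have h2 : (volume : Measure ℝ).real (Set.Ioc 0 (t : ℝ)) • σ ≤ σ * T := by
      rw [Measure.real, Real.volume_Ioc, ENNReal.toReal_ofReal (by linarith [t.2.1]), sub_zero,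
        smul_eq_mul, mul_comm]
      exact mul_le_mul_of_nonneg_left t.2.2 hσ
    linarith
  · filter_upwards [hs, hΨ.measurePreserving] with s hs1 hs2 d hd hd1
    have h1 := hlog hξ hs2 (Φ s x) (Ψ s y) d hd hd1
    have h2 := hs1 (Φ s x)
    rw [← velocity_eq_convVel, ← velocity_eq_convVel] at h1
    have h3 := norm_sub_le_norm_sub_add_norm_sub (velocity ξ Φ s (Φ s x))
      (velocity ξ Ψ s (Φ s x)) (velocity ξ Ψ s (Ψ s y))
    linarith

/-- The mean distance of two approximate solutions satisfies Osgood's inequality. -/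
lemma exists_osgood_mean : ∃ C : ℝ, 0 < C ∧ ∀ {T : ℝ} (hT : 0 ≤ T) {ξ : Torus → ℝ}
    {Φ Ψ : Flow T}, MemLp ξ ⊤ volume → MemM Φ → MemM Ψ → ∀ {e : ℝ},
    (∀ t, ∀ᵐ x, SolvesUpTo ξ Φ e t x) → (∀ t, ∀ᵐ x, SolvesUpTo ξ Ψ e t x) →
    OsgoodIneq (C * supNorm ξ) T ((2 * Real.pi) ^ 2 * (2 * e))
      (fun s => ∫ x, dist (Φ (Set.projIcc 0 T hT s) x) (Ψ (Set.projIcc 0 T hT s) x))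
      (fun s => ∫ x, ‖velocity ξ Φ (Set.projIcc 0 T hT s) (Φ (Set.projIcc 0 T hT s) x) -
        velocity ξ Ψ (Set.projIcc 0 T hT s) (Ψ (Set.projIcc 0 T hT s) x)‖) := by
  obtain ⟨C, hC, hlog⟩ := exists_convVel_logLipschitz
  obtain ⟨C', hC', hstab⟩ := exists_convVel_stability
  refine ⟨C * (2 * Real.pi) ^ 2 + C', by positivity,
    fun {T} hT {ξ Φ Ψ} hξ hΦ hΨ {e} hx hy => ?_⟩
  have hX := supNorm_nonneg ξ
  have iΦΦ := integrable_velocity_joint hξ hΦ hΦ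
  have iΨΨ := integrable_velocity_joint hξ hΨ hΨ
  have iΦΨ := integrable_velocity_joint hξ hΦ hΨ
  have iW : Integrable (Function.uncurry fun s x =>
      ‖velocity ξ Φ s (Φ s x) - velocity ξ Ψ s (Ψ s x)‖)
      ((timeMeasure T).prod (volume : Measure Torus)) := (iΦΦ.sub iΨΨ).norm
  have hmΦ (s : Set.Icc (0 : ℝ) T) : Measurable (Φ s) :=
    hΦ.measurable.comp (f := fun x => (s, x)) (by fun_prop)
  have hmΨ (s : Set.Icc (0 : ℝ) T) : Measurable (Ψ s) :=
    hΨ.measurable.comp (f := fun x => (s, x)) (by fun_prop)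
  refine OsgoodIneq.of_timeMeasure hT (D := fun s => ∫ x, dist (Φ s x) (Ψ s x))
    (w := fun s => ∫ x, ‖velocity ξ Φ s (Φ s x) - velocity ξ Ψ s (Ψ s x)‖)
    iW.integral_prod_left (fun t => ?_) ?_ (M := (2 * Real.pi) ^ 2 * Real.pi) fun t => ?_
  · have iWt : Integrable (Function.uncurry fun s x =>
        ‖velocity ξ Φ s (Φ s x) - velocity ξ Ψ s (Ψ s x)‖)
        (((timeMeasure T).restrict (Set.Iic t)).prod (volume : Measure Torus)) :=
      iW.mono_measure (Measure.prod_mono Measure.restrict_le_self le_rfl)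
    have iR : Integrable fun x => ∫ s in Set.Iic t,
        ‖velocity ξ Φ s (Φ s x) - velocity ξ Ψ s (Ψ s x)‖ ∂(timeMeasure T) :=
      iWt.integral_prod_right
    rw [integral_integral_swap iWt]
    calc ∫ x, dist (Φ t x) (Ψ t x) ≤ ∫ x, (2 * e + ∫ s in Set.Iic t,
          ‖velocity ξ Φ s (Φ s x) - velocity ξ Ψ s (Ψ s x)‖ ∂(timeMeasure T)) := by
          refine integral_mono_ae (integrable_dist_maps (hmΦ t) (hmΨ t))
            ((integrable_const _).add iR) ?_
          filter_upwards [hx t, hy t] with x h1 h2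
          have := SolvesUpTo.dist_le hξ hΦ hΨ h1 h2
          rwa [dist_self, zero_add] at this
      _ = _ := by
          rw [integral_add (integrable_const _) iR, integral_const,
            volume_real_torus, smul_eq_mul]
  · filter_upwards [hΦ.measurePreserving, hΨ.measurePreserving, iΦΦ.prod_right_ae,
      iΨΨ.prod_right_ae, iΦΨ.prod_right_ae] with s h1 h2 j1 j2 j3 d hd hd1
    have hl : 0 ≤ 1 - Real.log d := by have := Real.log_nonpos hd.le hd1; linarith
    have hpi : 1 ≤ (2 * Real.pi) ^ 2 := by nlinarith [Real.pi_gt_three]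
    have hdist := integrable_dist_maps h1.measurable h2.measurable
    have hD0 : 0 ≤ ∫ x, dist (Φ s x) (Ψ s x) := integral_nonneg fun y => dist_nonneg
    set D := ∫ x, dist (Φ s x) (Ψ s x)
    -- The velocity difference is split at `u^Φ (Ψ x)`: `g1` uses the regularity of one velocity
    -- field, `g2` its dependence on the generating map.
    have g1 : ∫ x, ‖velocity ξ Φ s (Φ s x) - velocity ξ Φ s (Ψ s x)‖ ≤
        C * supNorm ξ * ((2 * Real.pi) ^ 2 * d + D * (1 - Real.log d)) := by
      calc _ ≤ ∫ x, C * supNorm ξ * (d + dist (Φ s x) (Ψ s x) * (1 - Real.log d)) :=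
            integral_mono (j1.sub j3).norm
              (((integrable_const _).add (hdist.mul_const _)).const_mul _)
              fun x => hlog hξ h1 _ _ d hd hd1
        _ = _ := by
            rw [integral_const_mul, integral_add (integrable_const _) (hdist.mul_const _),
              integral_const, volume_real_torus, integral_mul_const, smul_eq_mul]
    have g2 : ∫ x, ‖velocity ξ Φ s (Ψ s x) - velocity ξ Ψ s (Ψ s x)‖ ≤
        C' * supNorm ξ * (d + D * (1 - Real.log d)) := hstab hξ h1 h2 h2 d hd hd1
    have g3 : ∫ x, ‖velocity ξ Φ s (Φ s x) - velocity ξ Ψ s (Ψ s x)‖ ≤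
        (∫ x, ‖velocity ξ Φ s (Φ s x) - velocity ξ Φ s (Ψ s x)‖) +
        ∫ x, ‖velocity ξ Φ s (Ψ s x) - velocity ξ Ψ s (Ψ s x)‖ := by
      rw [← integral_add (f := fun x => ‖velocity ξ Φ s (Φ s x) - velocity ξ Φ s (Ψ s x)‖)
        (g := fun x => ‖velocity ξ Φ s (Ψ s x) - velocity ξ Ψ s (Ψ s x)‖)
        (j1.sub j3).norm (j3.sub j2).norm]
      exact integral_mono (j1.sub j2).norm ((j1.sub j3).norm.add (j3.sub j2).norm)
        fun x => norm_sub_le_norm_sub_add_norm_sub _ _ _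
    have g4 : (2 * Real.pi) ^ 2 * d + D * (1 - Real.log d) ≤
        (2 * Real.pi) ^ 2 * (d + D * (1 - Real.log d)) := by
      have := le_mul_of_one_le_left (mul_nonneg hD0 hl) hpi
      linarith
    have g5 := mul_le_mul_of_nonneg_left g4 (mul_nonneg hC.le hX)
    have e1 : (C * (2 * Real.pi) ^ 2 + C') * supNorm ξ * (d + D * (1 - Real.log d)) =
        C * supNorm ξ * ((2 * Real.pi) ^ 2 * (d + D * (1 - Real.log d))) +
        C' * supNorm ξ * (d + D * (1 - Real.log d)) := by ring
    rw [e1]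
    linarith
  · calc ∫ x, dist (Φ t x) (Ψ t x) ≤ ∫ _ : Torus, Real.pi :=
          integral_mono (integrable_dist_maps (hmΦ t) (hmΨ t)) (integrable_const _)
            fun x => dist_torus_le _ _
      _ = _ := by rw [integral_const, volume_real_torus, smul_eq_mul]

/-! ### Measure preserving steps along the velocity field -/

lemma measurePreserving_of_integral {S : Torus → Torus} (hS : Measurable S)
    (h : ∀ f : BoundedContinuousFunction Torus ℝ, ∫ x, f (S x) = ∫ x, f x) :
    MeasurePreserving S volume volume := by
  refine ⟨hS, ?_⟩
  have : IsFiniteMeasure (Measure.map S (volume : Measure Torus)) :=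
    Measure.isFiniteMeasure_map _ _
  refine ext_of_forall_integral_eq_of_IsFiniteMeasure fun f => ?_
  rw [integral_map hS.aemeasurable f.continuous.aestronglyMeasurable]
  exact h f

/-- A shear in a rational direction preserves the measure. -/
lemma measurePreserving_shear {g : Torus → ℝ} (hg : Continuous g) {e : ℝ × ℝ} {m n : ℤ}
    (he : e = ((m : ℝ), (n : ℝ))) (hinv : ∀ z (s : ℝ), g (z + proj (s • e)) = g z) :
    MeasurePreserving (fun z => z + proj (g z • e)) volume volume := by
  have hp := continuous_proj
  have hS : Continuous fun z => z + proj (g z • e) := by fun_prop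
  refine measurePreserving_of_integral hS.measurable fun f => ?_
  have hf := f.continuous
  -- Translating `z` along `e` does not change `g z`, so a constant may be added to the shear
  -- without affecting the integral.
  have h0 (s : ℝ) : ∫ z, f (z + proj ((g z + s) • e)) = ∫ z, f (z + proj (g z • e)) := by
    rw [← integral_add_right_eq_self (μ := (volume : Measure Torus))
      (fun z => f (z + proj (g z • e))) (proj (s • e))]
    refine integral_congr_ae (Filter.Eventually.of_forall fun z => ?_)
    simp only
    rw [hinv, add_smul, proj_add, add_assoc, add_comm (proj (s • e))]
  have hper (z : Torus) : Function.Periodic (fun s : ℝ => f (z + proj (s • e)))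
      (2 * Real.pi) := by
    intro s
    have h2 : proj ((2 * Real.pi) • e) = 0 := by
      rw [he]
      refine Prod.ext ?_ ?_
      · exact (AddCircle.coe_eq_zero_iff _).2 ⟨m, by simp [mul_comm]⟩
      · exact (AddCircle.coe_eq_zero_iff _).2 ⟨n, by simp [mul_comm]⟩
    simp only [add_smul, proj_add, h2, add_zero]
  have hint {q : Torus × ℝ → ℝ} (hq : Continuous q) : Integrable (fun p => f (p.1 + proj (q p • e)))
      ((volume : Measure Torus).prod (volume.restrict (Set.Ioc 0 (2 * Real.pi)))) := by
    refine Integrable.of_bound (C := ‖f‖) ?_ (Filter.Eventually.of_forall fun p => f.norm_coe_le_norm _)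
    have : Continuous fun p : Torus × ℝ => f (p.1 + proj (q p • e)) := by fun_prop
    exact this.aestronglyMeasurable
  have hpi := Real.two_pi_pos
  -- Averaging over the added constant: along the integer direction `e` the integrand is `2
  -- π`-periodic, so the value `g z` drops out.
  have key : ∫ s in Set.Ioc 0 (2 * Real.pi), (∫ z, f (z + proj ((g z + s) • e))) =
      ∫ s in Set.Ioc 0 (2 * Real.pi), (∫ z, f (z + proj (s • e))) := by
    rw [← integral_integral_swap (f := fun (z : Torus) (s : ℝ) => f (z + proj ((g z + s) • e)))
      (hint (q := fun p => g p.1 + p.2) (by fun_prop)),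
      ← integral_integral_swap (f := fun (z : Torus) (s : ℝ) => f (z + proj (s • e)))
      (hint (q := fun p => p.2) (by fun_prop))]
    congr 1; funext z
    rw [← intervalIntegral.integral_of_le hpi.le, ← intervalIntegral.integral_of_le hpi.le,
      intervalIntegral.integral_comp_add_left (fun s => f (z + proj (s • e)))]
    have := (hper z).intervalIntegral_add_eq (g z) 0
    rwa [zero_add, add_zero] at *
  have h1 (s : ℝ) : ∫ z, f (z + proj (s • e)) = ∫ z, f z :=
    integral_add_right_eq_self (μ := (volume : Measure Torus)) (fun z => f z) _
  simp only [h0, h1, integral_const, smul_eq_mul] at key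
  refine mul_left_cancel₀ ?_ key
  rw [Measure.real, Measure.restrict_apply_univ, Real.volume_Ioc,
    ENNReal.toReal_ofReal (by linarith)]
  linarith

/-- The composition of finitely many measure preserving Euler steps. -/
lemma exists_composition {ι : Type*} [DecidableEq ι] (F : Finset ι) (f : ι → Torus → ℝ × ℝ)
    {A B h : ℝ} (hA : 0 ≤ A) (hB : 0 ≤ B) (hh : 0 ≤ h)
    (hlip : ∀ k ∈ F, ∀ z z', ‖f k z - f k z'‖ ≤ A * dist z z')
    (hbd : ∀ k ∈ F, ∀ z, ‖f k z‖ ≤ B) (hcont : ∀ k, Continuous (f k))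
    (hmp : ∀ k, MeasurePreserving (fun z => z + proj (h • f k z)) volume volume) :
    ∃ W : Torus → ℝ × ℝ, Continuous W ∧
      MeasurePreserving (fun z => z + proj (W z)) volume volume ∧
      ∀ z, ‖W z - h • ∑ k ∈ F, f k z‖ ≤ h ^ 2 * (A * B * (F.card : ℝ) ^ 2) := by
  induction F using Finset.induction_on with
  | empty =>
    refine ⟨fun _ => 0, continuous_const, ?_, fun z => by simp⟩
    simp only [proj_zero, add_zero]
    exact MeasurePreserving.id _
  | insert a F ha ih =>
    obtain ⟨W, hW, hWm, hWe⟩ := ih (fun k hk => hlip k (Finset.mem_insert_of_mem hk))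
      (fun k hk => hbd k (Finset.mem_insert_of_mem hk))
    have hp := continuous_proj
    have hfa := hcont a
    refine ⟨fun z => h • f a z + W (z + proj (h • f a z)), by fun_prop, ?_, fun z => ?_⟩
    · have := hWm.comp (hmp a)
      convert this using 1
      funext z
      simp only [Function.comp, proj_add, add_assoc]
    · set z' := z + proj (h • f a z)
      have hzz : dist z' z ≤ h * B := by
        have := dist_add_proj_le z z (h • f a z) 0
        rw [proj_zero, add_zero, dist_self, zero_add, sub_zero, norm_smul,
          Real.norm_of_nonneg hh] at this
        exact this.trans (mul_le_mul_of_nonneg_left (hbd a (Finset.mem_insert_self _ _) z) hh)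
      -- The first step moves the point by at most `h B`; each of the `F.card` remaining fields then
      -- changes by at most `A h B`. Summed over the induction this gives the square of the
      -- cardinality.
      have h2 : ‖h • ∑ k ∈ F, f k z' - h • ∑ k ∈ F, f k z‖ ≤ h * (F.card * (A * (h * B))) := by
        rw [← smul_sub, norm_smul, Real.norm_of_nonneg hh, ← Finset.sum_sub_distrib]
        refine mul_le_mul_of_nonneg_left ?_ hh
        rw [← nsmul_eq_mul]
        refine (norm_sum_le _ _).trans (Finset.sum_le_card_nsmul _ _ _ fun k hk => ?_)
        exact (hlip k (Finset.mem_insert_of_mem hk) _ _).trans (by gcongr)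
      have e1 : h • f a z + W z' - h • ∑ k ∈ insert a F, f k z = (W z' - h • ∑ k ∈ F, f k z') +
          (h • ∑ k ∈ F, f k z' - h • ∑ k ∈ F, f k z) := by
        rw [Finset.sum_insert ha, smul_add]; abel
      rw [e1, Finset.card_insert_of_notMem ha]
      refine (norm_add_le _ _).trans ((add_le_add (hWe z') h2).trans ?_)
      push_cast
      have h3 : 0 ≤ h ^ 2 * (A * B) := by positivity
      have hc : (0 : ℝ) ≤ F.card := Nat.cast_nonneg _
      nlinarith [mul_nonneg h3 hc]

section

variable {ξ : Torus → ℝ} {ψ : Torus → Torus}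

lemma norm_convVel_sub_le_of_lipschitz (hξ : MemLp ξ ⊤ volume)
    (hψ : MeasurePreserving ψ volume volume) {g : Torus → ℝ × ℝ} (hg : Continuous g) {L : ℝ}
    (hL : ∀ x y, ‖g x - g y‖ ≤ L * dist x y) (z z' : Torus) :
    ‖convVel g ξ ψ z - convVel g ξ ψ z'‖ ≤ supNorm ξ * ((2 * Real.pi) ^ 2 * L) * dist z z' := by
  have hgi := integrable_torus hg
  have e : convVel g ξ ψ z - convVel g ξ ψ z' = ∫ y, ξ y • (g (z - ψ y) - g (z' - ψ y)) := by
    simp only [convVel, smul_sub]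
    rw [integral_sub (integrable_smul_kernel hξ hgi hψ z) (integrable_smul_kernel hξ hgi hψ z')]
  have hi : Integrable fun y => g (z - ψ y) - g (z' - ψ y) :=
    ((measurePreserving_sub_map hψ z).integrable_comp_of_integrable hgi).sub
      ((measurePreserving_sub_map hψ z').integrable_comp_of_integrable hgi)
  rw [e, mul_assoc]
  refine (norm_convVel_le_integral hξ hi).trans
    (mul_le_mul_of_nonneg_left ?_ (supNorm_nonneg ξ))
  calc ∫ y, ‖g (z - ψ y) - g (z' - ψ y)‖ ≤ ∫ _ : Torus, L * dist z z' :=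
        integral_mono hi.norm (integrable_const _) fun y => by
          simpa only [dist_sub_right] using hL (z - ψ y) (z' - ψ y)
    _ = _ := by rw [integral_const, volume_real_torus, smul_eq_mul, mul_assoc]

lemma continuous_of_norm_sub_le {f : Torus → ℝ × ℝ} {A : ℝ}
    (h : ∀ z z', ‖f z - f z'‖ ≤ A * dist z z') : Continuous f := by
  refine (LipschitzWith.of_dist_le_mul (K := A.toNNReal) fun z z' => ?_).continuous
  rw [dist_eq_norm]
  exact (h z z').trans (mul_le_mul_of_nonneg_right (Real.le_coe_toNNReal A) dist_nonneg)

lemma character_add (k : ℤ × ℤ) (x y : Torus) :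
    character k (x + y) = character k x * character k y := by
  simp only [character, Prod.fst_add, Prod.snd_add, AddCircle.toCircle_add,
    smul_add, Circle.coe_mul, fourier_apply]
  ring

/-- The flow of the velocity generated by a shear mode preserves the measure. -/
lemma measurePreserving_shearMode_step (hξ : MemLp ξ ⊤ volume)
    (hψ : MeasurePreserving ψ volume volume) (c h : ℝ) (k : ℤ × ℤ) :
    MeasurePreserving (fun z => z + proj (h • convVel (fun x => c • shearMode k x) ξ ψ z))
      volume volume := by
  set e : ℝ × ℝ := (-(k.2 : ℝ), (k.1 : ℝ))
  set g : Torus → ℝ := fun z => h * ∫ y, ξ y * (c * (character k (z - ψ y)).im)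
  have hchar := continuous_character_im k
  have hchar1 (x : Torus) : |(character k x).im| ≤ 1 := by
    obtain ⟨a, rfl, -⟩ := exists_lift x
    rw [character_proj_im]
    exact Real.abs_sin_le_one _
  have hm (z : Torus) : AEStronglyMeasurable (fun y => ξ y * (c * (character k (z - ψ y)).im))
      volume := by
    refine hξ.1.mul (Measurable.aestronglyMeasurable ?_)
    have := hψ.measurable
    exact (hchar.measurable.comp (measurable_const.sub this)).const_mul c
  have hg : Continuous g := by
    refine continuous_const.mul (continuous_of_dominated (bound := fun _ => supNorm ξ * |c|) hm ?_
      (integrable_const _) (Filter.Eventually.of_forall fun y => by fun_prop))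
    intro z
    filter_upwards [ae_abs_le_supNorm hξ] with y hy
    rw [norm_mul, norm_mul, Real.norm_eq_abs c, Real.norm_eq_abs (character k _).im]
    have := hchar1 (z - ψ y)
    have h0 := supNorm_nonneg ξ
    calc ‖ξ y‖ * (|c| * |(character k (z - ψ y)).im|) ≤ supNorm ξ * (|c| * 1) := by gcongr
      _ = _ := by rw [mul_one]
  have hv (z : Torus) : h • convVel (fun x => c • shearMode k x) ξ ψ z = g z • e := by
    simp only [convVel, g, shearMode, smul_smul]
    rw [integral_smul_const, smul_smul]
  simp only [hv]
  refine measurePreserving_shear hg (m := -k.2) (n := k.1) (by simp [e]) fun z s => ?_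
  -- Since `k · k^⊥ = 0`, the amplitude `g` is constant along the direction of the shear.
  have h1 : character k (proj (s • e)) = 1 := by
    rw [character_proj]
    have : (k.1 : ℝ) * (s • e).1 + k.2 * (s • e).2 = 0 := by
      simp only [e, Prod.smul_mk, smul_eq_mul]; ring
    rw [this]; simp
  have h2 (y : Torus) : character k (z + proj (s • e) - ψ y) = character k (z - ψ y) := by
    rw [add_sub_right_comm, character_add, h1, mul_one]
  simp only [g, h2]

/-- Short steps along the velocity field can be approximated by measure preserving maps. -/
lemma exists_step (hξ : MemLp ξ ⊤ volume) {ε : ℝ} (hε : 0 < ε) : ∃ h0 : ℝ, 0 < h0 ∧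
    ∀ h, 0 ≤ h → h ≤ h0 → ∀ ψ : Torus → Torus, MeasurePreserving ψ volume volume →
    ∃ W : Torus → ℝ × ℝ, Continuous W ∧
      MeasurePreserving (fun z => z + proj (W z)) volume volume ∧
      ∀ z, ‖W z - h • convVel kernelK ξ ψ z‖ ≤ h * ε := by
  have hX := supNorm_nonneg ξ
  -- Half of `ε` is for the kernel approximation, half for the quadratic error of the composition;
  -- the `+ 1` covers vanishing vorticity.
  obtain ⟨F, c, hF⟩ := exists_shearMode_approx (η := ε / (2 * (supNorm ξ + 1))) (by positivity)
  set q : ℤ × ℤ → Torus → ℝ × ℝ := fun k x => c k • shearMode k x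
  have hq (k) : Continuous (q k) := (continuous_shearMode k).fun_const_smul (c k)
  set l : ℤ × ℤ → ℝ := fun k =>
    |c k| * ((|(k.1 : ℝ)| + |(k.2 : ℝ)|) * ‖(-(k.2 : ℝ), (k.1 : ℝ))‖)
  have hql (k) (x y : Torus) : ‖q k x - q k y‖ ≤ l k * dist x y := by
    simp only [q, l]
    rw [← smul_sub, norm_smul, Real.norm_eq_abs, mul_assoc]
    gcongr
    exact norm_shearMode_sub_le k x y
  have hl (k) : 0 ≤ l k := by positivity
  set A := ∑ k ∈ F, supNorm ξ * ((2 * Real.pi) ^ 2 * l k)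
  set B := ∑ k ∈ F, supNorm ξ * ∫ x, ‖q k x‖
  have hqn (k) : 0 ≤ ∫ x, ‖q k x‖ := integral_nonneg fun x => norm_nonneg _
  have hA : 0 ≤ A := Finset.sum_nonneg fun k _ => by have := hl k; positivity
  have hB : 0 ≤ B := Finset.sum_nonneg fun k _ => by have := hqn k; positivity
  set R := A * B * (F.card : ℝ) ^ 2
  have hR : 0 ≤ R := by positivity
  -- This bound on the step turns the composition error `h ^ 2 R` into at most `h ε / 2`.
  refine ⟨ε / (2 * (R + 1)), by positivity, fun h hh hh0 ψ hψ => ?_⟩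
  obtain ⟨W, hW, hWm, hWe⟩ := exists_composition F (fun k => convVel (q k) ξ ψ) hA hB hh
    (fun k hk z z' => (norm_convVel_sub_le_of_lipschitz hξ hψ (hq k) (hql k) z z').trans
      (mul_le_mul_of_nonneg_right (Finset.single_le_sum
        (f := fun k => supNorm ξ * ((2 * Real.pi) ^ 2 * l k))
        (fun k _ => by have := hl k; positivity) hk) dist_nonneg))
    (fun k hk z => (norm_convVel_le hξ (integrable_torus (hq k)) hψ z).trans
      (Finset.single_le_sum (f := fun k => supNorm ξ * ∫ x, ‖q k x‖)
        (fun k _ => by have := hqn k; positivity) hk))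
    (fun k => continuous_of_norm_sub_le
      (norm_convVel_sub_le_of_lipschitz hξ hψ (hq k) (hql k)))
    (fun k => measurePreserving_shearMode_step hξ hψ (c k) h k)
  refine ⟨W, hW, hWm, fun z => ?_⟩
  have hsum : ∑ k ∈ F, convVel (q k) ξ ψ z = convVel (fun x => ∑ k ∈ F, q k x) ξ ψ z := by
    simp only [convVel, Finset.smul_sum]
    rw [integral_finsetSum _ fun k _ => integrable_smul_kernel hξ (integrable_torus (hq k)) hψ z]
  have hgi : Integrable fun x => ∑ k ∈ F, q k x :=
    integrable_torus (continuous_finsetSum _ fun k _ => hq k)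
  have h1 : ‖convVel kernelK ξ ψ z - ∑ k ∈ F, convVel (q k) ξ ψ z‖ ≤ ε / 2 := by
    rw [hsum, convVel_sub hξ integrable_kernelK hgi hψ]
    refine (norm_convVel_le hξ (integrable_kernelK.sub hgi) hψ z).trans
      ((mul_le_mul_of_nonneg_left hF hX).trans ?_)
    rw [mul_div_assoc', div_le_div_iff₀ (by positivity) two_pos]
    nlinarith
  have h2 : h ^ 2 * R ≤ h * (ε / 2) := by
    rw [le_div_iff₀ (by positivity)] at hh0
    nlinarith [mul_le_mul_of_nonneg_left hh0 hh]
  have e1 : W z - h • convVel kernelK ξ ψ z = (W z - h • ∑ k ∈ F, convVel (q k) ξ ψ z) -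
      h • (convVel kernelK ξ ψ z - ∑ k ∈ F, convVel (q k) ξ ψ z) := by
    rw [smul_sub]; abel
  have h3 : ‖h • (convVel kernelK ξ ψ z - ∑ k ∈ F, convVel (q k) ξ ψ z)‖ ≤ h * (ε / 2) := by
    rw [norm_smul, Real.norm_of_nonneg hh]
    exact mul_le_mul_of_nonneg_left h1 hh
  rw [e1]
  refine (norm_sub_le _ _).trans ?_
  have := hWe z
  linarith

end

/-! ### Approximate solutions -/

/-- The displacements of a time-discrete approximation of the Euler flow with step `h`. -/
lemma exists_discrete_flow {ξ : Torus → ℝ} {h ε : ℝ}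
    (hstep : ∀ ψ : Torus → Torus, MeasurePreserving ψ volume volume →
      ∃ W : Torus → ℝ × ℝ, Continuous W ∧
        MeasurePreserving (fun z => z + proj (W z)) volume volume ∧
        ∀ z, ‖W z - h • convVel kernelK ξ ψ z‖ ≤ h * ε) :
    ∃ V : ℕ → Torus → ℝ × ℝ, (∀ x, V 0 x = 0) ∧ (∀ j, Continuous (V j)) ∧
      (∀ j, MeasurePreserving (fun x => x + proj (V j x)) volume volume) ∧
      ∀ j x, ‖V (j + 1) x - V j x -
        h • convVel kernelK ξ (fun x => x + proj (V j x)) (x + proj (V j x))‖ ≤ h * ε := by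
  have hp := continuous_proj
  -- The measure preserving property is carried along with the displacement, since the next step
  -- requires it of the current map.
  have hnext (V : {V : Torus → ℝ × ℝ // Continuous V ∧
      MeasurePreserving (fun x => x + proj (V x)) volume volume}) :
      ∃ V' : {V : Torus → ℝ × ℝ // Continuous V ∧
        MeasurePreserving (fun x => x + proj (V x)) volume volume},
      ∀ x, ‖V'.1 x - V.1 x -
        h • convVel kernelK ξ (fun x => x + proj (V.1 x)) (x + proj (V.1 x))‖ ≤ h * ε := by
    obtain ⟨V, hV, hVm⟩ := V
    obtain ⟨W, hW, hWm, hWe⟩ := hstep _ hVm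
    refine ⟨⟨fun x => V x + W (x + proj (V x)), by fun_prop, ?_⟩, fun x => ?_⟩
    · convert hWm.comp hVm using 1
      funext x
      simp only [Function.comp, proj_add, add_assoc]
    · simpa only [add_sub_cancel_left] using hWe (x + proj (V x))
  choose next hn using hnext
  let V0 : {V : Torus → ℝ × ℝ // Continuous V ∧
      MeasurePreserving (fun x => x + proj (V x)) volume volume} :=
    ⟨fun _ => 0, continuous_const, by
      simp only [proj_zero, add_zero]; exact MeasurePreserving.id _⟩
  exact ⟨fun j => (next^[j] V0).1, fun x => rfl, fun j => (next^[j] V0).2.1,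
    fun j => (next^[j] V0).2.2, fun j x => by
      simp only [Function.iterate_succ_apply']
      exact hn _ x⟩

/-- Intervals open on the left match integrals over `Ioc`. At time `0` the truncated subtraction
gives index `0`, the identity map. -/
lemma ceil_sub_one_eq {h s : ℝ} (hh : 0 < h) {j : ℕ} (hs : s ∈ Set.Ioc (j * h) ((j + 1) * h)) :
    ⌈s / h⌉₊ - 1 = j := by
  have : ⌈s / h⌉₊ = j + 1 := by
    rw [Nat.ceil_eq_iff (Nat.succ_ne_zero j), lt_div_iff₀ hh, div_le_iff₀ hh]
    simpa using hs
  omega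

lemma ceil_sub_one_bounds {h t : ℝ} (hh : 0 < h) (ht : 0 ≤ t) :
    ((⌈t / h⌉₊ - 1 : ℕ) : ℝ) * h ≤ t ∧ t ≤ (((⌈t / h⌉₊ - 1 : ℕ) : ℝ) + 1) * h := by
  rw [← le_div_iff₀ hh, ← div_le_iff₀ hh]
  have h0 : 0 ≤ t / h := by positivity
  rcases Nat.eq_zero_or_pos ⌈t / h⌉₊ with hc | hc
  · have := Nat.ceil_eq_zero.1 hc
    rw [hc]
    simp only [Nat.zero_sub, Nat.cast_zero, zero_add]
    exact ⟨h0, by linarith⟩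
  · rw [Nat.cast_sub hc, Nat.cast_one, sub_add_cancel]
    have := Nat.ceil_lt_add_one h0
    exact ⟨by linarith, Nat.le_ceil _⟩

/-- The sum is the exact integral up to the last grid point used; the remaining interval has length
at most `h`. -/
lemma integral_step_function {h B : ℝ} (hh : 0 < h) {G : ℕ → ℝ × ℝ} (hG : ∀ j, ‖G j‖ ≤ B)
    {t : ℝ} (ht : 0 ≤ t) :
    ‖(h • ∑ j ∈ Finset.range (⌈t / h⌉₊ - 1), G j) - ∫ s in (0 : ℝ)..t, G (⌈s / h⌉₊ - 1)‖ ≤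
      B * h := by
  set n := ⌈t / h⌉₊ - 1
  obtain ⟨h1, h2⟩ := ceil_sub_one_bounds hh ht
  have hB : 0 ≤ B := (norm_nonneg _).trans (hG 0)
  have hm : Measurable fun s : ℝ => G (⌈s / h⌉₊ - 1) :=
    (measurable_from_nat (f := fun j => G (j - 1))).comp
      (Nat.measurable_ceil.comp (measurable_id.div_const h))
  have hi (a b : ℝ) : IntervalIntegrable (fun s : ℝ => G (⌈s / h⌉₊ - 1)) volume a b := by
    rw [intervalIntegrable_iff]
    have : IsFiniteMeasure ((volume : Measure ℝ).restrict (Set.uIoc a b)) :=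
      ⟨by rw [Measure.restrict_apply_univ]; exact measure_Ioc_lt_top⟩
    exact Integrable.of_bound hm.aestronglyMeasurable B (Filter.Eventually.of_forall fun s => hG _)
  have hj (j : ℕ) : ∫ s in ((j : ℝ) * h)..(((j + 1 : ℕ) : ℝ) * h), G (⌈s / h⌉₊ - 1) = h • G j := by
    have hle : (j : ℝ) * h ≤ ((j + 1 : ℕ) : ℝ) * h := by push_cast; nlinarith
    have : ∫ s in ((j : ℝ) * h)..(((j + 1 : ℕ) : ℝ) * h), G (⌈s / h⌉₊ - 1) =
        ∫ _ in ((j : ℝ) * h)..(((j + 1 : ℕ) : ℝ) * h), G j := by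
      rw [intervalIntegral.integral_of_le hle, intervalIntegral.integral_of_le hle]
      refine setIntegral_congr_fun measurableSet_Ioc fun s hs => ?_
      push_cast at hs
      simp only [ceil_sub_one_eq hh hs]
    rw [this, intervalIntegral.integral_const]
    congr 1
    push_cast; ring
  have hsum := intervalIntegral.sum_integral_adjacent_intervals (μ := volume)
    (a := fun j : ℕ => (j : ℝ) * h) (n := n) (f := fun s : ℝ => G (⌈s / h⌉₊ - 1))
    fun k _ => hi _ _
  simp only [hj, Nat.cast_zero, zero_mul] at hsum
  rw [Finset.smul_sum, hsum, ← intervalIntegral.integral_add_adjacent_intervals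
    (hi 0 (n * h)) (hi (n * h) t), sub_add_cancel_left, norm_neg]
  refine (intervalIntegral.norm_integral_le_of_norm_le_const fun s _ => hG _).trans ?_
  rw [abs_of_nonneg (by linarith)]
  exact mul_le_mul_of_nonneg_left (by linarith) hB

/-- The Euler flow equation has approximate solutions. -/
lemma exists_approx_solution {ξ : Torus → ℝ} (hξ : MemLp ξ ⊤ volume) {T : ℝ} (hT : 0 < T) {e : ℝ}
    (he : 0 < e) : ∃ Φ : Flow T, MemM Φ ∧ (∀ t, Continuous (Φ t)) ∧
      (∀ t, MeasurePreserving (Φ t) volume volume) ∧ ∀ t x, SolvesUpTo ξ Φ e t x := by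
  set B := supNorm ξ * ∫ x, ‖kernelK x‖
  have hB : 0 ≤ B := mul_nonneg (supNorm_nonneg ξ) (integral_nonneg fun x => norm_nonneg _)
  -- The step errors add up to at most `T ε = e / 2`; the bound on `h` leaves `e / 2` for the last,
  -- incomplete time interval.
  set ε := e / (2 * T)
  obtain ⟨h0, hh0, hstep⟩ := exists_step hξ (ε := ε) (by positivity)
  set h := min h0 (e / (2 * (B + 1)))
  have hh : 0 < h := lt_min hh0 (by positivity)
  have hhB : B * h ≤ e / 2 := by
    have : h ≤ e / (2 * (B + 1)) := min_le_right _ _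
    rw [le_div_iff₀ (by positivity)] at this
    nlinarith
  obtain ⟨V, hV0, hV, hVm, hVe⟩ := exists_discrete_flow (hstep h hh.le (min_le_left _ _))
  set φ : ℕ → Torus → Torus := fun j x => x + proj (V j x)
  have hφ (j) : Continuous (φ j) := by
    have := continuous_proj
    have := hV j
    fun_prop
  have hVsum (n : ℕ) (x : Torus) : ‖V n x - h • ∑ j ∈ Finset.range n,
      convVel kernelK ξ (φ j) (φ j x)‖ ≤ n * h * ε := by
    induction n with
    | zero => simp [hV0]
    | succ n ih =>
      have e1 : V (n + 1) x - h • ∑ j ∈ Finset.range (n + 1), convVel kernelK ξ (φ j) (φ j x) =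
          (V n x - h • ∑ j ∈ Finset.range n, convVel kernelK ξ (φ j) (φ j x)) +
          (V (n + 1) x - V n x - h • convVel kernelK ξ (φ n) (φ n x)) := by
        rw [Finset.sum_range_succ, smul_add]; abel
      rw [e1]
      refine (norm_add_le _ _).trans ((add_le_add ih (hVe n x)).trans_eq ?_)
      push_cast; ring
  set Φ : Flow T := fun t => φ (⌈(t : ℝ) / h⌉₊ - 1)
  have hΦmp (t) : MeasurePreserving (Φ t) volume volume := hVm _
  have hΦ : MemM Φ := by
    refine ⟨?_, ⟨∫ _ : Torus, Real.pi, fun t => ?_⟩, Filter.Eventually.of_forall hΦmp⟩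
    · have h1 : Measurable fun p : ℕ × Torus => φ (p.1 - 1) p.2 :=
        measurable_from_prod_countable_right fun j => (hφ (j - 1)).measurable
      have h2 : Measurable fun p : Set.Icc (0 : ℝ) T × Torus => ⌈(p.1 : ℝ) / h⌉₊ :=
        Nat.measurable_ceil.comp ((measurable_subtype_coe.comp measurable_fst).div_const h)
      exact h1.comp (h2.prodMk measurable_snd)
    · refine integral_mono_of_nonneg (Filter.Eventually.of_forall fun x => norm_nonneg _)
        (integrable_const _) (Filter.Eventually.of_forall fun x => ?_)
      simpa only [dist_zero_right] using dist_torus_le (Φ t x) 0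
  refine ⟨Φ, hΦ, fun t => hφ _, hΦmp, fun t x => ⟨V (⌈(t : ℝ) / h⌉₊ - 1) x, rfl, ?_⟩⟩
  have h1 : ∫ s in Set.Iic t, velocity ξ Φ s (Φ s x) ∂(timeMeasure T) =
      ∫ s in (0 : ℝ)..t, (fun j => convVel kernelK ξ (φ j) (φ j x)) (⌈s / h⌉₊ - 1) := by
    rw [setIntegral_timeMeasure hT.le, intervalIntegral.integral_of_le t.2.1]
    refine setIntegral_congr_fun measurableSet_Ioc fun s hs => ?_
    simp only [velocity_eq_convVel, Φ]
    rw [Set.projIcc_of_mem hT.le ⟨hs.1.le, hs.2.trans t.2.2⟩]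
  rw [h1]
  have h2 := integral_step_function hh (G := fun j => convVel kernelK ξ (φ j) (φ j x)) (B := B)
    (fun j => norm_convVel_le hξ integrable_kernelK (hVm j) _) t.2.1
  have h3 := hVsum (⌈(t : ℝ) / h⌉₊ - 1) x
  have h4 : ((⌈(t : ℝ) / h⌉₊ - 1 : ℕ) : ℝ) * h * ε ≤ e / 2 := by
    have h5 : ((⌈(t : ℝ) / h⌉₊ - 1 : ℕ) : ℝ) * h ≤ T :=
      (ceil_sub_one_bounds hh t.2.1).1.trans t.2.2
    have h6 : T * ε = e / 2 := by simp only [ε]; field_simp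
    rw [← h6]
    exact mul_le_mul_of_nonneg_right h5 (by positivity)
  have h7 := norm_sub_le_norm_sub_add_norm_sub (V (⌈(t : ℝ) / h⌉₊ - 1) x)
    (h • ∑ j ∈ Finset.range (⌈(t : ℝ) / h⌉₊ - 1), convVel kernelK ξ (φ j) (φ j x))
    (∫ s in (0 : ℝ)..t, (fun j => convVel kernelK ξ (φ j) (φ j x)) (⌈s / h⌉₊ - 1))
  simp only at h2 h7 ⊢
  linarith

/-! ### Existence of solutions -/

lemma OsgoodIneq.nonpos {A T : ℝ} (hA : 0 ≤ A) (hT : 0 ≤ T) {D w : ℝ → ℝ}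
    (h : OsgoodIneq A T 0 D w) : ∀ t ∈ Set.Icc 0 T, D t ≤ 0 := by
  intro t ht
  refine le_of_forall_pos_le_add fun η hη => ?_
  obtain ⟨a, ha, h1⟩ := exists_osgood_small A T hA hT hη
  rw [zero_add]
  exact h1 0 ha.le D w h t ht

section

variable {T : ℝ} {ξ : Torus → ℝ}

lemma SolvesUpTo.mono {Φ : Flow T} {e e' : ℝ} {t : Set.Icc (0 : ℝ) T} {x : Torus}
    (h : SolvesUpTo ξ Φ e t x) (he : e ≤ e') : SolvesUpTo ξ Φ e' t x := by
  obtain ⟨v, h1, h2⟩ := h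
  exact ⟨v, h1, h2.trans he⟩

/-- Approximate solutions with small errors are uniformly close. -/
lemma exists_approx_close (hξ : MemLp ξ ⊤ volume) (hT : 0 < T) {η : ℝ} (hη : 0 < η) :
    ∃ δ : ℝ, 0 < δ ∧ ∀ Φ Ψ : Flow T, MemM Φ → MemM Ψ → (∀ t x, SolvesUpTo ξ Φ δ t x) →
      (∀ t x, SolvesUpTo ξ Ψ δ t x) → ∀ t x, dist (Φ t x) (Ψ t x) ≤ η := by
  have hX := supNorm_nonneg ξ
  obtain ⟨C, hC, hpt⟩ := exists_osgood_pointwise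
  obtain ⟨C', hC', hmean⟩ := exists_osgood_mean
  obtain ⟨a, ha, hsmall⟩ := exists_osgood_small (C * supNorm ξ) T (by positivity) hT.le hη
  -- The constants are fixed backwards: `σ T = a / 2` and `2 δ ≤ a / 2` fit the pointwise Osgood
  -- bound; `L` then depends on `σ`, and `a'` on the mean distance that keeps the velocities within
  -- `σ`.
  set σ := a / (2 * T)
  have hσ : 0 < σ := by positivity
  obtain ⟨L, hL, hunif⟩ := exists_convVel_uniform (η := σ / (2 * (supNorm ξ + 1))) (by positivity)
  obtain ⟨a', ha', hsmall'⟩ := exists_osgood_small (C' * supNorm ξ) T (by positivity) hT.le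
    (η := σ / (2 * (supNorm ξ + 1) * (L + 1))) (by positivity)
  have hpi := Real.pi_pos
  refine ⟨min (a / 4) (a' / (2 * (2 * Real.pi) ^ 2)), by positivity,
    fun Φ Ψ hΦ hΨ h1 h2 t x => ?_⟩
  set δ := min (a / 4) (a' / (2 * (2 * Real.pi) ^ 2))
  have hδ : (2 * Real.pi) ^ 2 * (2 * δ) ≤ a' := by
    have : δ ≤ a' / (2 * (2 * Real.pi) ^ 2) := min_le_right _ _
    rw [le_div_iff₀ (by positivity)] at this
    linarith
  have hd : ∀ s : Set.Icc (0 : ℝ) T, ∫ x, dist (Φ s x) (Ψ s x) ≤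
      σ / (2 * (supNorm ξ + 1) * (L + 1)) := fun s => by
    simpa only [Set.projIcc_val] using hsmall' _ hδ _ _ (hmean hT.le hξ hΦ hΨ (e := δ)
      (fun t => Filter.Eventually.of_forall (h1 t))
      (fun t => Filter.Eventually.of_forall (h2 t))) s s.2
  have hvel : ∀ᵐ s ∂(timeMeasure T), ∀ z, ‖velocity ξ Φ s z - velocity ξ Ψ s z‖ ≤ σ := by
    filter_upwards [hΦ.measurePreserving, hΨ.measurePreserving] with s h3 h4 z
    refine (hunif hξ h3 h4 z).trans ?_
    have h5 : L * ∫ x, dist (Φ s x) (Ψ s x) ≤ σ / (2 * (supNorm ξ + 1)) := by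
      refine (mul_le_mul_of_nonneg_left (hd s) hL).trans ?_
      rw [mul_div_assoc', div_le_div_iff₀ (by positivity) (by positivity)]
      have : 0 ≤ σ * (2 * (supNorm ξ + 1)) := by positivity
      nlinarith
    calc _ ≤ supNorm ξ * (σ / (2 * (supNorm ξ + 1)) + σ / (2 * (supNorm ξ + 1))) := by gcongr
      _ ≤ (supNorm ξ + 1) * (σ / (2 * (supNorm ξ + 1)) + σ / (2 * (supNorm ξ + 1))) := by
          gcongr; linarith
      _ = σ := by field_simp; ring
  have hle : dist x x + 2 * δ + σ * T ≤ a := by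
    have h3 : δ ≤ a / 4 := min_le_left _ _
    have h4 : σ * T = a / 2 := by simp only [σ]; field_simp
    rw [dist_self, h4]; linarith
  simpa only [Set.projIcc_val] using hsmall _ hle _ _
    (hpt hT.le hξ hΦ hΨ hσ.le (fun t => h1 t x) (fun t => h2 t x) hvel) t t.2

lemma continuous_convVel (hξ : MemLp ξ ⊤ volume) {ψ : Torus → Torus}
    (hψ : MeasurePreserving ψ volume volume) : Continuous (convVel kernelK ξ ψ) := by
  obtain ⟨C, hC, h⟩ := exists_convVel_logLipschitz
  have hX := supNorm_nonneg ξ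
  rw [Metric.continuous_iff]
  intro z ε hε
  set A := C * supNorm ξ + 1
  have hA : 0 < A := by positivity
  set d := min 1 (ε / (4 * A))
  have hd : 0 < d := by positivity
  have hd1 : d ≤ 1 := min_le_left _ _
  have hl : 0 ≤ -Real.log d := by have := Real.log_nonpos hd.le hd1; linarith
  have hl1 : 0 < 1 - Real.log d := by linarith
  refine ⟨ε / (4 * A * (1 - Real.log d)), by positivity, fun z' hz => ?_⟩
  have h1 : dist z' z * (1 - Real.log d) ≤ ε / (4 * A) := by
    rw [← div_div] at hz
    exact ((lt_div_iff₀ hl1).1 hz).le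
  have h2 : d ≤ ε / (4 * A) := min_le_right _ _
  rw [dist_eq_norm]
  calc _ ≤ C * supNorm ξ * (d + dist z' z * (1 - Real.log d)) := h hξ hψ z' z d hd hd1
    _ ≤ A * (ε / (4 * A) + ε / (4 * A)) := by
        gcongr
        simp only [A]; linarith
    _ = ε / 2 := by field_simp; ring
    _ < ε := by linarith

/-- Pointwise convergence of the maps gives convergence in mean by dominated convergence, hence
uniform convergence of the velocities; the limit velocity is continuous, so the base point may move.
-/
lemma tendsto_convVel (hξ : MemLp ξ ⊤ volume) {ψ : ℕ → Torus → Torus} {χ : Torus → Torus}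
    {z : ℕ → Torus} {w : Torus} (hψ : ∀ n, MeasurePreserving (ψ n) volume volume)
    (hχ : MeasurePreserving χ volume volume)
    (h : ∀ y, Filter.Tendsto (fun n => ψ n y) Filter.atTop (nhds (χ y)))
    (hz : Filter.Tendsto z Filter.atTop (nhds w)) :
    Filter.Tendsto (fun n => convVel kernelK ξ (ψ n) (z n)) Filter.atTop
      (nhds (convVel kernelK ξ χ w)) := by
  have hX := supNorm_nonneg ξ
  have h1 : Filter.Tendsto (fun n => convVel kernelK ξ χ (z n)) Filter.atTop
      (nhds (convVel kernelK ξ χ w)) := ((continuous_convVel hξ hχ).tendsto w).comp hz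
  have h2 : Filter.Tendsto (fun n => ∫ y, dist (ψ n y) (χ y)) Filter.atTop (nhds 0) := by
    have := tendsto_integral_of_dominated_convergence (μ := (volume : Measure Torus))
      (F := fun n y => dist (ψ n y) (χ y)) (f := fun _ => 0) (fun _ => Real.pi)
      (fun n => (integrable_dist_maps (hψ n).measurable hχ.measurable).1) (integrable_const _)
      (fun n => Filter.Eventually.of_forall fun y => by
        rw [Real.norm_of_nonneg dist_nonneg]; exact dist_torus_le _ _)
      (Filter.Eventually.of_forall fun y => tendsto_iff_dist_tendsto_zero.1 (h y))
    simpa using this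
  have h3 : Filter.Tendsto (fun n => convVel kernelK ξ (ψ n) (z n) - convVel kernelK ξ χ (z n))
      Filter.atTop (nhds 0) := by
    rw [Metric.tendsto_atTop]
    intro ε hε
    obtain ⟨L, hL, hu⟩ := exists_convVel_uniform (η := ε / (4 * (supNorm ξ + 1))) (by positivity)
    obtain ⟨N, hN⟩ := Metric.tendsto_atTop.1 h2 (ε / (4 * (supNorm ξ + 1) * (L + 1)))
      (by positivity)
    refine ⟨N, fun n hn => ?_⟩
    have h4 := hN n hn
    rw [dist_zero_right, Real.norm_of_nonneg (integral_nonneg fun y => dist_nonneg)] at h4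
    rw [dist_zero_right]
    have h5 : L * ∫ y, dist (ψ n y) (χ y) ≤ ε / (4 * (supNorm ξ + 1)) := by
      refine (mul_le_mul_of_nonneg_left h4.le hL).trans ?_
      rw [mul_div_assoc', div_le_div_iff₀ (by positivity) (by positivity)]
      have : 0 ≤ ε * (4 * (supNorm ξ + 1)) := by positivity
      nlinarith
    calc _ ≤ supNorm ξ * (ε / (4 * (supNorm ξ + 1)) + L * ∫ y, dist (ψ n y) (χ y)) :=
          hu hξ (hψ n) hχ (z n)
      _ ≤ (supNorm ξ + 1) * (ε / (4 * (supNorm ξ + 1)) + ε / (4 * (supNorm ξ + 1))) := by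
          gcongr; linarith
      _ = ε / 2 := by field_simp; ring
      _ < ε := by linarith
  simpa using h3.add h1

lemma measurePreserving_of_tendsto {S : ℕ → Torus → Torus} {R : Torus → Torus}
    (hS : ∀ n, MeasurePreserving (S n) volume volume)
    (h : ∀ x, Filter.Tendsto (fun n => S n x) Filter.atTop (nhds (R x))) :
    MeasurePreserving R volume volume := by
  refine measurePreserving_of_integral
    (measurable_of_tendsto_metrizable (fun n => (hS n).measurable) (tendsto_pi_nhds.2 h))
    fun f => ?_
  have h1 := tendsto_integral_of_dominated_convergence (μ := (volume : Measure Torus))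
    (F := fun n y => f (S n y)) (f := fun y => f (R y)) (fun _ => ‖f‖)
    (fun n => (f.continuous.measurable.comp (hS n).measurable).aestronglyMeasurable)
    (integrable_const _) (fun n => Filter.Eventually.of_forall fun y => f.norm_coe_le_norm _)
    (Filter.Eventually.of_forall fun y => (f.continuous.tendsto _).comp (h y))
  have h2 (n : ℕ) : ∫ y, f (S n y) = ∫ y, f y := by
    rw [← integral_map (hS n).measurable.aemeasurable f.continuous.aestronglyMeasurable,
      (hS n).map_eq]
  simp only [h2] at h1
  exact tendsto_nhds_unique h1 tendsto_const_nhds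

/-- The Euler flow equation has a solution. -/
lemma exists_solution (hξ : MemLp ξ ⊤ volume) (hT : 0 < T) : ∃ Φ : Flow T, MemM Φ ∧
    (∀ t, MeasurePreserving (Φ t) volume volume) ∧ ∀ t x, SolvesUpTo ξ Φ 0 t x := by
  have hex (n : ℕ) := exists_approx_solution hξ hT (e := 1 / ((n : ℝ) + 1)) (by positivity)
  choose S hSM _ hSmp hS using hex
  have he : Filter.Tendsto (fun n : ℕ => 1 / ((n : ℝ) + 1)) Filter.atTop (nhds 0) :=
    tendsto_one_div_add_atTop_nhds_zero_nat
  have hcauchy (t) (x) : CauchySeq fun n => S n t x := by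
    rw [Metric.cauchySeq_iff']
    intro ε hε
    obtain ⟨δ, hδ, h⟩ := exists_approx_close hξ hT (half_pos hε)
    obtain ⟨N, hN⟩ := Filter.eventually_atTop.1 (he.eventually (ge_mem_nhds hδ))
    refine ⟨N, fun n hn => (h _ _ (hSM n) (hSM N) (fun t x => (hS n t x).mono (hN n hn))
      (fun t x => (hS N t x).mono (hN N le_rfl)) t x).trans_lt (by linarith)⟩
  choose Φ hΦ using fun t x => cauchySeq_tendsto_of_complete (hcauchy t x)
  have hmp (t) : MeasurePreserving (Φ t) volume volume :=
    measurePreserving_of_tendsto (fun n => hSmp n t) (hΦ t)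
  have hM : MemM Φ := by
    refine ⟨?_, ⟨∫ _ : Torus, Real.pi, fun t => ?_⟩, Filter.Eventually.of_forall hmp⟩
    · exact measurable_of_tendsto_metrizable (fun n => (hSM n).measurable)
        (tendsto_pi_nhds.2 fun p => hΦ p.1 p.2)
    · refine integral_mono_of_nonneg (Filter.Eventually.of_forall fun x => norm_nonneg _)
        (integrable_const _) (Filter.Eventually.of_forall fun x => ?_)
      simpa only [dist_zero_right] using dist_torus_le (Φ t x) 0
  refine ⟨Φ, hM, hmp, fun t x => ⟨_, ?_, (by rw [sub_self, norm_zero] :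
    ‖(∫ s in Set.Iic t, velocity ξ Φ s (Φ s x) ∂(timeMeasure T)) - _‖ ≤ 0)⟩⟩
  have hI : Filter.Tendsto
      (fun n => ∫ s in Set.Iic t, velocity ξ (S n) s (S n s x) ∂(timeMeasure T)) Filter.atTop
      (nhds (∫ s in Set.Iic t, velocity ξ Φ s (Φ s x) ∂(timeMeasure T))) := by
    refine tendsto_integral_of_dominated_convergence (fun _ => supNorm ξ * ∫ x, ‖kernelK x‖)
      (fun n => (integrable_velocity_curve hξ (hSM n) ((hSM n).measurable.comp
        (f := fun s => (s, x)) (by fun_prop))).integrableOn.1) (integrable_const _)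
      (fun n => Filter.Eventually.of_forall fun s =>
        norm_convVel_le hξ integrable_kernelK (hSmp n s) _)
      (Filter.Eventually.of_forall fun s => ?_)
    exact tendsto_convVel hξ (fun n => hSmp n s) (hmp s) (hΦ s) (hΦ s x)
  -- Convergence is shown for the displacements in the plane, where the integrals live, and only
  -- then projected to the torus.
  choose v hv hve using fun n => hS n t x
  have hv0 : Filter.Tendsto (fun n => v n -
      ∫ s in Set.Iic t, velocity ξ (S n) s (S n s x) ∂(timeMeasure T)) Filter.atTop (nhds 0) :=
    squeeze_zero_norm hve he
  have hvI := hv0.add hI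
  simp only [sub_add_cancel, zero_add] at hvI
  have h1 := ((continuous_proj.tendsto _).comp hvI).const_add x
  refine tendsto_nhds_unique (hΦ t x) (h1.congr fun n => ?_)
  rw [hv n]; rfl

end

/-! ### Regularity and uniqueness of solutions -/

section

variable {T : ℝ} {ξ : Torus → ℝ} {Φ Ψ : Flow T}

lemma intervalIntegrable_velocity (hξ : MemLp ξ ⊤ volume) (hT : 0 ≤ T) (hΦ : MemM Φ) (x : Torus)
    {a b : ℝ} (ha : a ∈ Set.Icc 0 T) (hb : b ∈ Set.Icc 0 T) :
    IntervalIntegrable (fun s => velocity ξ Φ (Set.projIcc 0 T hT s)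
      (Φ (Set.projIcc 0 T hT s) x)) volume a b := by
  rw [intervalIntegrable_iff]
  exact ((integrable_timeMeasure_iff hT).1 (integrable_velocity_curve hξ hΦ
    (hΦ.measurable.comp (f := fun s => (s, x)) (by fun_prop)))).mono_set
    (Set.uIoc_subset_uIcc.trans (Set.uIcc_subset_Icc ha hb))

lemma SolvesUpTo.eq_intervalIntegral (hT : 0 ≤ T) {t : Set.Icc (0 : ℝ) T} {x : Torus}
    (h : SolvesUpTo ξ Φ 0 t x) : Φ t x = x + proj (∫ s in (0 : ℝ)..t,
      velocity ξ Φ (Set.projIcc 0 T hT s) (Φ (Set.projIcc 0 T hT s) x)) := by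
  obtain ⟨v, hv, h0⟩ := h
  rw [hv, sub_eq_zero.1 (norm_le_zero_iff.1 h0), setIntegral_timeMeasure hT,
    intervalIntegral.integral_of_le t.2.1]

lemma exists_lipschitz_time (hξ : MemLp ξ ⊤ volume) (hT : 0 ≤ T) (hΦ : MemM Φ)
    (hmp : ∀ t, MeasurePreserving (Φ t) volume volume) (h : ∀ t x, SolvesUpTo ξ Φ 0 t x) :
    ∃ L : ℝ, ∀ t t' x, dist (Φ t x) (Φ t' x) ≤ L * dist t t' := by
  refine ⟨supNorm ξ * ∫ x, ‖kernelK x‖, fun t t' x => ?_⟩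
  have h0 : (0 : ℝ) ∈ Set.Icc 0 T := ⟨le_rfl, hT⟩
  rw [(h t x).eq_intervalIntegral hT, (h t' x).eq_intervalIntegral hT]
  refine (dist_add_proj_le _ _ _ _).trans ?_
  rw [dist_self, zero_add, intervalIntegral.integral_interval_sub_left
    (intervalIntegrable_velocity hξ hT hΦ x h0 t.2) (intervalIntegrable_velocity hξ hT hΦ x h0 t'.2)]
  refine (intervalIntegral.norm_integral_le_of_norm_le_const fun s _ =>
    norm_convVel_le hξ integrable_kernelK (hmp _) _).trans_eq ?_
  rw [Subtype.dist_eq, Real.dist_eq]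

/-- Solutions are Hölder continuous in space. -/
lemma exists_holder : ∃ C : ℝ, 0 < C ∧ ∀ {T : ℝ} {ξ : Torus → ℝ} {Φ : Flow T}, 0 ≤ T →
    MemLp ξ ⊤ volume → MemM Φ → (∀ t x, SolvesUpTo ξ Φ 0 t x) →
    ∃ H : ℝ, ∀ t x x', dist (Φ t x) (Φ t x') ≤
      H * dist x x' ^ Real.exp (-(C * supNorm ξ * T)) := by
  obtain ⟨C, hC, h⟩ := exists_osgood_pointwise
  refine ⟨C, hC, fun {T ξ Φ} hT hξ hΦ hs => ?_⟩
  have hX := supNorm_nonneg ξ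
  set A := C * supNorm ξ
  have hA : 0 ≤ A := by positivity
  set α := Real.exp (-(A * T))
  have hα : 0 < α := Real.exp_pos _
  set a0 := Real.exp (2 - 2 * Real.exp (A * T))
  have ha0 : 0 < a0 := Real.exp_pos _
  have hpi := Real.pi_pos
  -- The first summand is the Osgood bound for distances up to `a0`; the second covers larger ones,
  -- where the diameter bound `π` suffices.
  refine ⟨Real.exp 2 + Real.pi * (a0 ^ α)⁻¹, fun t x x' => ?_⟩
  have hr : 0 ≤ dist x x' ^ α := by positivity
  have hi : 0 < a0 ^ α := Real.rpow_pos_of_pos ha0 α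
  rw [add_mul]
  rcases eq_or_ne x x' with rfl | hne
  · rw [dist_self (Φ t x)]
    positivity
  · have hd : 0 < dist x x' := dist_pos.2 hne
    rcases le_total (dist x x') a0 with hle | hle
    · have h1 := h hT hξ hΦ hΦ (e := 0) (σ := 0) (x := x) (y := x') le_rfl (fun t => hs t x)
        (fun t => hs t x') (Filter.Eventually.of_forall fun s z => by rw [sub_self, norm_zero])
      rw [mul_zero, zero_mul, add_zero, add_zero] at h1
      have h2 := h1.le_rpow hA hT hd hle t t.2
      simp only [Set.projIcc_val] at h2
      have : 0 ≤ Real.pi * (a0 ^ α)⁻¹ * dist x x' ^ α := by positivity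
      linarith
    · have h1 : a0 ^ α ≤ dist x x' ^ α := Real.rpow_le_rpow ha0.le hle hα.le
      have h2 : Real.pi ≤ Real.pi * (a0 ^ α)⁻¹ * dist x x' ^ α := by
        rw [mul_assoc, inv_mul_eq_div]
        exact le_mul_of_one_le_right hpi.le ((one_le_div hi).2 h1)
      have h3 := dist_torus_le (Φ t x) (Φ t x')
      have h4 : 0 ≤ Real.exp 2 * dist x x' ^ α := by positivity
      linarith

/-- Trajectories of a solution do not meet. -/
lemma injective_of_solvesUpTo (hξ : MemLp ξ ⊤ volume) (hT : 0 ≤ T) (hΦ : MemM Φ)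
    (h : ∀ t x, SolvesUpTo ξ Φ 0 t x) (t : Set.Icc (0 : ℝ) T) : Function.Injective (Φ t) := by
  intro x y hxy
  obtain ⟨C, hC, hO⟩ := exists_osgood_pointwise
  have hA : 0 ≤ C * supNorm ξ := mul_nonneg hC.le (supNorm_nonneg ξ)
  have h1 := hO hT hξ hΦ hΦ (e := 0) (σ := 0) le_rfl (fun t => h t x)
    (fun t => h t y) (Filter.Eventually.of_forall fun s z => by rw [sub_self, norm_zero])
  set G : Torus → ℝ → ℝ × ℝ := fun x s => velocity ξ Φ (Set.projIcc 0 T hT s)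
    (Φ (Set.projIcc 0 T hT s) x)
  set D : ℝ → ℝ := fun s => dist (Φ (Set.projIcc 0 T hT s) x) (Φ (Set.projIcc 0 T hT s) y)
  set w : ℝ → ℝ := fun s => ‖G x s - G y s‖ - 0
  have h0 : (0 : ℝ) ∈ Set.Icc 0 T := ⟨le_rfl, hT⟩
  -- Followed backwards from time `t`, the two trajectories start at distance `0` and satisfy the
  -- same inequality, so they also agree at time `0`.
  have hrev : OsgoodIneq (C * supNorm ξ) t 0 (fun r => D (t - r)) (fun r => w (t - r)) := by
    have hwi : IntervalIntegrable w volume 0 t := by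
      rw [intervalIntegrable_iff_integrableOn_Ioc_of_le t.2.1]
      exact h1.integrable.mono_set (Set.Ioc_subset_Ioc_right t.2.2)
    refine ⟨?_, fun r hr => ?_, ?_, ⟨Real.pi, fun r _ => dist_torus_le _ _⟩⟩
    · have := hwi.comp_sub_left (t : ℝ)
      rw [sub_zero, sub_self] at this
      exact (intervalIntegrable_iff_integrableOn_Ioc_of_le t.2.1).1 this.symm
    · have hu : (t : ℝ) - r ∈ Set.Icc 0 T := ⟨by linarith [hr.2], by linarith [hr.1, t.2.2]⟩
      rw [zero_add, ← intervalIntegral.integral_of_le hr.1, intervalIntegral.integral_comp_sub_left,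
        sub_zero]
      have hback (x : Torus) : Φ (Set.projIcc 0 T hT (t - r)) x = Φ t x +
          proj (∫ s in (t : ℝ)..(t - r), G x s) := by
        rw [(h _ x).eq_intervalIntegral hT, (h t x).eq_intervalIntegral hT, add_assoc, ← proj_add,
          intervalIntegral.integral_add_adjacent_intervals
            (intervalIntegrable_velocity hξ hT hΦ x h0 t.2)
            (intervalIntegrable_velocity hξ hT hΦ x t.2 hu), Set.projIcc_of_mem hT hu]
      have h2 : D (t - r) ≤ dist (Φ t x) (Φ t y) +
          ‖(∫ s in (t : ℝ)..(t - r), G x s) - ∫ s in (t : ℝ)..(t - r), G y s‖ := by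
        simp only [D]
        rw [hback x, hback y]
        exact dist_add_proj_le _ _ _ _
      rw [hxy, dist_self, zero_add, ← intervalIntegral.integral_sub
        (intervalIntegrable_velocity hξ hT hΦ x t.2 hu)
        (intervalIntegrable_velocity hξ hT hΦ y t.2 hu), intervalIntegral.integral_symm,
        norm_neg] at h2
      refine h2.trans ((intervalIntegral.norm_integral_le_integral_norm (by linarith [hr.1])).trans ?_)
      simp only [w, sub_zero]
      exact le_rfl
    · have hq := (Measure.measurePreserving_sub_left (volume : Measure ℝ)
        (t : ℝ)).quasiMeasurePreserving
      -- Reflection maps the endpoint `r = t` to time `0`, which lies outside the half-open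
      -- interval; a single point is negligible.
      filter_upwards [hq.ae h1.modulus, Measure.ae_ne volume (t : ℝ)] with r h3 h4 hr d hd hd1
      exact h3 ⟨sub_pos.2 (lt_of_le_of_ne hr.2 h4), by linarith [hr.1, t.2.2]⟩ d hd hd1
  have h2 := hrev.nonpos hA t.2.1 t ⟨t.2.1, le_rfl⟩
  simp only [D, sub_self] at h2
  have hz (x : Torus) : Φ (Set.projIcc 0 T hT 0) x = x := by
    rw [(h _ x).eq_intervalIntegral hT, Set.projIcc_left]
    simp only [intervalIntegral.integral_same, proj_zero, add_zero]
  rw [hz, hz] at h2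
  exact dist_le_zero.1 h2

/-- The complement of the compact range is open and has empty preimage, hence is null; a nonempty
open set has positive measure. -/
lemma surjective_of_measurePreserving {S : Torus → Torus} (hS : Continuous S)
    (hmp : MeasurePreserving S volume volume) : Function.Surjective S := by
  have hopen : IsOpen (Set.range S)ᶜ := (isCompact_range hS).isClosed.isOpen_compl
  have h0 : volume (Set.range S)ᶜ = 0 := by
    rw [← hmp.measure_preimage hopen.measurableSet.nullMeasurableSet, Set.preimage_compl,
      Set.preimage_range, Set.compl_univ, measure_empty]
  rw [hopen.measure_eq_zero_iff (μ := (volume : Measure Torus)), Set.compl_empty_iff] at h0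
  exact Set.range_eq_univ.1 h0

/-- Solutions in the almost everywhere sense are unique up to null sets. -/
lemma ae_eq_of_ae_solvesUpTo (hξ : MemLp ξ ⊤ volume) (hT : 0 ≤ T) (hΦ : MemM Φ) (hΨ : MemM Ψ)
    (h : ∀ t, ∀ᵐ x, SolvesUpTo ξ Φ 0 t x) (h' : ∀ t, ∀ᵐ x, SolvesUpTo ξ Ψ 0 t x)
    (t : Set.Icc (0 : ℝ) T) : ∀ᵐ x, Φ t x = Ψ t x := by
  obtain ⟨C, hC, hO⟩ := exists_osgood_mean
  have h1 := hO hT hξ hΦ hΨ h h'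
  rw [mul_zero, mul_zero] at h1
  have h2 := h1.nonpos (mul_nonneg hC.le (supNorm_nonneg ξ)) hT t t.2
  simp only [Set.projIcc_val] at h2
  have hm {Φ : Flow T} (hΦ : MemM Φ) : Measurable (Φ t) :=
    hΦ.measurable.comp (f := fun x => (t, x)) (by fun_prop)
  have h3 := (integral_eq_zero_iff_of_nonneg (fun x => dist_nonneg)
    (integrable_dist_maps (hm hΦ) (hm hΨ))).1 (le_antisymm h2 (integral_nonneg fun x => dist_nonneg))
  filter_upwards [h3] with x hx
  exact dist_eq_zero.1 hx

/-- Solutions in the pointwise sense are unique. -/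
lemma eq_of_solvesUpTo (hξ : MemLp ξ ⊤ volume) (hT : 0 ≤ T) (hΦ : MemM Φ) (hΨ : MemM Ψ)
    (h : ∀ t x, SolvesUpTo ξ Φ 0 t x) (h' : ∀ t x, SolvesUpTo ξ Ψ 0 t x) : Φ = Ψ := by
  have hae := ae_eq_of_ae_solvesUpTo hξ hT hΦ hΨ (fun t => Filter.Eventually.of_forall (h t))
    (fun t => Filter.Eventually.of_forall (h' t))
  -- Agreement of the maps almost everywhere already makes the velocity fields equal at every point.
  -- Both flows then follow the same log-Lipschitz field from the same starting point.
  have hvel (s : Set.Icc (0 : ℝ) T) (z : Torus) : velocity ξ Φ s z = velocity ξ Ψ s z := by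
    refine integral_congr_ae ?_
    filter_upwards [hae s] with y hy
    rw [hy]
  obtain ⟨C, hC, hO⟩ := exists_osgood_pointwise
  funext t x
  have h1 := hO hT hξ hΦ hΨ (e := 0) (σ := 0) (x := x) (y := x) le_rfl (fun t => h t x)
    (fun t => h' t x) (Filter.Eventually.of_forall fun s z => by rw [hvel, sub_self, norm_zero])
  rw [dist_self, mul_zero, zero_mul, add_zero, add_zero] at h1
  have h2 := h1.nonpos (mul_nonneg hC.le (supNorm_nonneg ξ)) hT t t.2
  simp only [Set.projIcc_val] at h2
  exact dist_le_zero.1 h2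

end

end EulerFlow

theorem mainTheorem8 :
    ∃ C : ℝ, 0 < C ∧
      ∀ (T : ℝ) (_ : 0 < T) (ξ₀ : EulerFlow.Torus → ℝ) (_ : MemLp ξ₀ ⊤ volume),
        ∃ Φ : EulerFlow.Flow T,
          EulerFlow.MemM Φ ∧
          (∀ t x, EulerFlow.SolvesAt ξ₀ Φ t x) ∧
          (∀ t, IsHomeomorph (Φ t)) ∧
          (∀ t, MeasurePreserving (Φ t) volume volume) ∧
          (∃ H : ℝ, ∀ t x x', dist (Φ t x) (Φ t x') ≤
            H * dist x x' ^ Real.exp (-(C * (eLpNorm ξ₀ ⊤ volume).toReal * T))) ∧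
          (∃ L : ℝ, ∀ t t' x, dist (Φ t x) (Φ t' x) ≤ L * dist t t') ∧
          (∀ Ψ : EulerFlow.Flow T, EulerFlow.MemM Ψ →
            (∀ t, ∀ᵐ x : EulerFlow.Torus, EulerFlow.SolvesAt ξ₀ Ψ t x) →
            ∀ t, ∀ᵐ x : EulerFlow.Torus, Ψ t x = Φ t x) ∧
          (∀ Ψ : EulerFlow.Flow T, EulerFlow.MemM Ψ →
            (∀ t x, EulerFlow.SolvesAt ξ₀ Ψ t x) → Ψ = Φ) := by
  obtain ⟨C, hC, hhol⟩ := EulerFlow.exists_holder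
  refine ⟨C, hC, fun T hT ξ hξ => ?_⟩
  obtain ⟨Φ, hΦ, hmp, hsol⟩ := EulerFlow.exists_solution hξ hT
  obtain ⟨H, hH⟩ := hhol hT.le hξ hΦ hsol
  -- The Hölder exponent is positive, so the Hölder bound tends to `0`; continuity is needed for the
  -- homeomorphism and for surjectivity.
  have hcont (t) : Continuous (Φ t) := by
    refine Metric.continuous_iff'.2 fun x ε hε => ?_
    have h1 : Continuous fun x' => H * dist x' x ^ Real.exp (-(C * EulerFlow.supNorm ξ * T)) :=
      continuous_const.mul ((continuous_id.dist continuous_const).rpow_const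
        fun _ => Or.inr (Real.exp_pos _).le)
    have h2 := h1.tendsto x
    rw [dist_self, Real.zero_rpow (Real.exp_pos _).ne', mul_zero] at h2
    filter_upwards [h2.eventually (gt_mem_nhds hε)] with x' hx'
    exact (hH t x' x).trans_lt hx'
  refine ⟨Φ, hΦ, fun t x => EulerFlow.solvesAt_of_solvesUpTo hξ hΦ (hsol t x), fun t => ?_, hmp,
    ⟨H, hH⟩, EulerFlow.exists_lipschitz_time hξ hT.le hΦ hmp hsol, fun Ψ hΨ h => ?_,
    fun Ψ hΨ h => ?_⟩
  · exact isHomeomorph_iff_continuous_bijective.2 ⟨hcont t,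
      EulerFlow.injective_of_solvesUpTo hξ hT.le hΦ hsol t,
      EulerFlow.surjective_of_measurePreserving (hcont t) (hmp t)⟩
  · exact EulerFlow.ae_eq_of_ae_solvesUpTo hξ hT.le hΨ hΦ
      (fun t => (h t).mono fun x hx => hx.solvesUpTo)
      (fun t => Filter.Eventually.of_forall (hsol t))
  · exact EulerFlow.eq_of_solvesUpTo hξ hT.le hΨ hΦ (fun t x => (h t x).solvesUpTo) hsol
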